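/- Let $\Omega\subset\mathbb R^2$ be a bounded polygonal domain with Lipschitz boundary, and let $\alpha_0<\pi$ and $C_1\in\mathbb R$. For a conforming triangulation $\mathcal T_h$ of $\Omega$ let $h$ be the maximal diameter of its elements, let $\mathcal T_h^2$ be the set of elements whose maximum angle exceeds $\alpha_0$, let $X_h\subset H^1(\Omega)$ be the space of functions that are continuous on $\overline\Omega$ and affine on each element, and let $V_h=X_h\cap H^1_0(\Omega)$. A cluster is a simply connected union of (closed) elements of $\mathcal T_h$, at least one of which lies in $\mathcal T_h^2$. There is a constant $C$, depending only on $\Omega,\alpha_0,C_1$, such that the following holds. Let $\mathcal T_h$ be a conforming triangulation of $\Omega$ with clusters $\mathcal C_1,\dots,\mathcal C_N$ ($N\ge 0$) of diameters $r_i=\operatorname{diam}\mathcal C_i$, such that every element of $\mathcal T_h^2$ belongs to some $\mathcal C_i$ and $$\text{(i)}\ \sum_{i=1}^N r_i^2\le C_1h,\qquad \text{(ii)}\ \operatorname{dist}(\mathcal C_i,\mathcal C_j)\ge 2(r_i+r_j)\quad\text{for } i\ne j .$$ Then for every $u\in W^{2,\infty}(\Omega)$ (taken continuous on $\overline\Omega$)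 there is a discrete Dirichlet lift $g_h\in X_h$ such that - $|g_h(p)-u(p)|\le C|u|_{2,\infty}h$ at every vertex $p\in\partial\Omega$ of $\mathcal T_h$; - $g_h(p)=u(p)$ at every vertex $p\in\partial\Omega$ with $\operatorname{dist}(p,\mathcal C_i)\ge 2r_i$ for all $i$; - $g_h=0$ if $u=0$ on $\partial\Omega$; and such that, whenever $f\in L^2(\Omega)$ and $u$ is a weak solution of $-\Delta u=f$, i.e. $\int_\Omega\nabla u\cdot\nabla v\,dx=\int_\Omega fv\,dx$ for all $v\in H^1_0(\Omega)$, the finite element solution $U=U_0+g_h$, $U_0\in V_h$, defined by $\int_\Omega\nabla U\cdot\nabla v_h\,dx=\int_\Omega fv_h\,dx$ for all $v_h\in V_h$, satisfies $$|u-U|_{H^1(\Omega)}\le C\,|u|_{2,\infty}\,h .$$ Here $|u|_{2,\infty}$ is the largest $L^\infty(\Omega)$ norm of a second-order weak derivative of $u$. Thus $O(h)$ convergence holds along every family of such triangulations, and clusters of diameter up to $O(h^{1/2})$ are allowed. -/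

import Mathlib

open MeasureTheory Filter Topology Set
open scoped ENNReal NNReal ContDiff

/-- The plane `ℝ²` with its Euclidean norm. -/
abbrev Plane : Type := EuclideanSpace ℝ (Fin 2)

namespace ClusterFEM

noncomputable section

/-! ### The domain -/

/-- `Ω` has a Lipschitz boundary: near each boundary point, in suitable Cartesian coordinates,
`Ω` is the region strictly above the graph of a Lipschitz function. -/
def HasLipschitzBoundary (Ω : Set Plane) : Prop :=
  ∀ x ∈ frontier Ω, ∃ (R : Plane ≃ₗᵢ[ℝ] Plane) (γ : ℝ → ℝ) (L : ℝ≥0) (ρ : ℝ),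
    0 < ρ ∧ LipschitzWith L γ ∧
      ∀ y ∈ Metric.ball x ρ, y ∈ Ω ↔ γ (R y 0) < R y 1

/-- Bounded polygonal domains with Lipschitz boundary. -/
structure IsPolygonalDomain (Ω : Set Plane) : Prop where
  isOpen : IsOpen Ω
  isConnected : IsConnected Ω
  isBounded : Bornology.IsBounded Ω
  polygonal : ∃ S : Finset (Plane × Plane), frontier Ω = ⋃ e ∈ S, segment ℝ e.1 e.2
  lipschitz : HasLipschitzBoundary Ω

/-! ### Sobolev spaces -/

/-- `C_c^∞(Ω)`. -/
structure IsTestFunction (Ω : Set Plane) (φ : Plane → ℝ) : Prop where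
  contDiff : ContDiff ℝ ∞ φ
  hasCompactSupport : HasCompactSupport φ
  tsupport_subset : tsupport φ ⊆ Ω

/-- `G` is the weak (distributional) gradient of `v` on `Ω`. -/
structure IsWeakGradient (Ω : Set Plane) (v : Plane → ℝ) (G : Plane → Plane) : Prop where
  locallyIntegrableOn : LocallyIntegrableOn v Ω
  locallyIntegrableOn_grad : LocallyIntegrableOn G Ω
  integral_eq : ∀ φ : Plane → ℝ, IsTestFunction Ω φ →
    ∫ x in Ω, v x • gradient φ x = -∫ x in Ω, φ x • G x

/-- Functions in `H¹(Ω)`, together with (a representative of) their weak gradient. Values outside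
the closure of `Ω` carry no meaning. -/
structure H1 (Ω : Set Plane) where
  toFun : Plane → ℝ
  grad : Plane → Plane
  memLp : MemLp toFun 2 (volume.restrict Ω)
  memLp_grad : MemLp grad 2 (volume.restrict Ω)
  isWeakGradient : IsWeakGradient Ω toFun grad

instance (Ω : Set Plane) : CoeFun (H1 Ω) (fun _ => Plane → ℝ) := ⟨H1.toFun⟩

theorem integrableOn_smul_of_isTestFunction {Ω : Set Plane} {F : Type*} [NormedAddCommGroup F]
    [NormedSpace ℝ F] {G : Plane → F} (hG : LocallyIntegrableOn G Ω)
    {φ : Plane → ℝ} (hφ : IsTestFunction Ω φ) : IntegrableOn (fun x => φ x • G x) Ω := by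
  have h1 : IntegrableOn G (tsupport φ) :=
    hG.integrableOn_compact_subset hφ.tsupport_subset hφ.hasCompactSupport
  have h2 : IntegrableOn (fun x => φ x • G x) (tsupport φ) :=
    h1.continuousOn_smul hφ.contDiff.continuous.continuousOn hφ.hasCompactSupport
  have h3 : Integrable (fun x => φ x • G x) := by
    refine (integrableOn_iff_integrable_of_support_subset ?_).1 h2
    intro x hx
    apply subset_tsupport
    intro h0
    exact hx (by simp [h0])
  exact h3.integrableOn

theorem integrableOn_smul_gradient {Ω : Set Plane} {v : Plane → ℝ}
    (hv : LocallyIntegrableOn v Ω) {φ : Plane → ℝ} (hφ : IsTestFunction Ω φ) :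
    IntegrableOn (fun x => v x • gradient φ x) Ω := by
  have hc : Continuous (gradient φ) :=
    (InnerProductSpace.toDual ℝ Plane).symm.continuous.comp
      (hφ.contDiff.continuous_fderiv (by simp))
  have h1 : IntegrableOn v (tsupport φ) :=
    hv.integrableOn_compact_subset hφ.tsupport_subset hφ.hasCompactSupport
  have h2 : IntegrableOn (fun x => v x • gradient φ x) (tsupport φ) :=
    h1.smul_continuousOn hc.continuousOn hφ.hasCompactSupport
  have h3 : Integrable (fun x => v x • gradient φ x) := by
    refine (integrableOn_iff_integrable_of_support_subset ?_).1 h2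
    intro x hx
    by_contra h0
    apply hx
    have h4 : fderiv ℝ φ x = 0 := by
      by_contra h5
      exact h0 (support_fderiv_subset ℝ h5)
    simp [gradient, h4]
  exact h3.integrableOn

theorem IsWeakGradient.add {Ω : Set Plane} {v w : Plane → ℝ} {G H : Plane → Plane}
    (hv : IsWeakGradient Ω v G) (hw : IsWeakGradient Ω w H) :
    IsWeakGradient Ω (fun x => v x + w x) (fun x => G x + H x) where
  locallyIntegrableOn := hv.locallyIntegrableOn.add hw.locallyIntegrableOn
  locallyIntegrableOn_grad := hv.locallyIntegrableOn_grad.add hw.locallyIntegrableOn_grad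
  integral_eq φ hφ := by
    simp only [add_smul, smul_add]
    rw [integral_add (integrableOn_smul_gradient hv.locallyIntegrableOn hφ)
        (integrableOn_smul_gradient hw.locallyIntegrableOn hφ),
      integral_add (integrableOn_smul_of_isTestFunction hv.locallyIntegrableOn_grad hφ)
        (integrableOn_smul_of_isTestFunction hw.locallyIntegrableOn_grad hφ),
      hv.integral_eq φ hφ, hw.integral_eq φ hφ, neg_add]

instance (Ω : Set Plane) : Add (H1 Ω) where
  add v w :=
    { toFun := fun x => v x + w x
      grad := fun x => v.grad x + w.grad x
      memLp := v.memLp.add w.memLp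
      memLp_grad := v.memLp_grad.add w.memLp_grad
      isWeakGradient := v.isWeakGradient.add w.isWeakGradient }

/-- `H¹₀(Ω)`: the closure of `C_c^∞(Ω)` in the `H¹(Ω)` norm. -/
def IsH10 {Ω : Set Plane} (v : H1 Ω) : Prop :=
  ∃ φ : ℕ → Plane → ℝ, (∀ n, IsTestFunction Ω (φ n)) ∧
    Tendsto (fun n => eLpNorm (fun x => φ n x - v x) 2 (volume.restrict Ω)) atTop (𝓝 0) ∧
    Tendsto (fun n => eLpNorm (fun x => gradient (φ n) x - v.grad x) 2 (volume.restrict Ω))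
      atTop (𝓝 0)

/-- `u ∈ W^{2,∞}(Ω)`, represented by its version that is continuous on the closure of `Ω`;
`D2 i` is the weak gradient of `∂ᵢ u`, so that `D2 i x j` is `∂ⱼ∂ᵢ u (x)`. -/
structure IsW2Inf {Ω : Set Plane} (u : H1 Ω) (D2 : Fin 2 → Plane → Plane) : Prop where
  continuousOn : ContinuousOn u (closure Ω)
  memLp : MemLp u ∞ (volume.restrict Ω)
  memLp_grad : MemLp u.grad ∞ (volume.restrict Ω)
  memLp_hess : ∀ i, MemLp (D2 i) ∞ (volume.restrict Ω)
  isWeakGradient : ∀ i, IsWeakGradient Ω (fun x => u.grad x i) (D2 i)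

/-- The seminorm `|u|_{2,∞}`: the largest `L^∞(Ω)` norm of a second derivative. -/
def semiNormW2Inf (Ω : Set Plane) (D2 : Fin 2 → Plane → Plane) : ℝ :=
  ⨆ p : Fin 2 × Fin 2, (eLpNorm (fun x => D2 p.1 x p.2) ∞ (volume.restrict Ω)).toReal

/-- `a(v, w) = ∫_Ω ∇v · ∇w`. -/
def bilin {Ω : Set Plane} (v w : H1 Ω) : ℝ :=
  ∫ x in Ω, inner ℝ (v.grad x) (w.grad x)

/-- The `H¹(Ω)` seminorm `|v - w|₁` of a difference. -/
def semiDistH1 {Ω : Set Plane} (v w : H1 Ω) : ℝ :=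
  √(∫ x in Ω, ‖v.grad x - w.grad x‖ ^ 2)

/-! ### Triangulations and finite element spaces -/

/-- `T` is a conforming triangulation of `Ω`: a finite simplicial complex all of whose maximal
faces are triangles and which fills the closure of `Ω`. -/
structure IsTriangulation (Ω : Set Plane) (T : Geometry.SimplicialComplex ℝ Plane) : Prop where
  finite : T.faces.Finite
  pure : ∀ s ∈ T.faces, ∃ t ∈ T.faces, s ⊆ t ∧ t.card = 3
  space_eq : T.space = closure Ω

/-- The elements (triangles) of the triangulation, each given by its set of three vertices. -/
def elements (T : Geometry.SimplicialComplex ℝ Plane) : Set (Finset Plane) :=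
  {K | K ∈ T.faces ∧ K.card = 3}

/-- The closed triangle with vertex set `K`. -/
def tri (K : Finset Plane) : Set Plane := convexHull ℝ (K : Set Plane)

/-- The mesh size: the maximal diameter of an element. -/
def meshSize (T : Geometry.SimplicialComplex ℝ Plane) : ℝ :=
  sSup ((fun K => Metric.diam (tri K)) '' elements T)

/-- The maximum angle of the triangle with vertex set `K`. -/
def maxAngle (K : Finset Plane) : ℝ :=
  sSup {θ | ∃ p ∈ K, ∃ q ∈ K, ∃ r ∈ K, p ≠ q ∧ q ≠ r ∧ p ≠ r ∧ θ = EuclideanGeometry.angle p q r}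

/-- The elements violating the maximum angle condition with bound `α₀`. -/
def badElements (T : Geometry.SimplicialComplex ℝ Plane) (α₀ : ℝ) : Set (Finset Plane) :=
  {K | K ∈ elements T ∧ α₀ < maxAngle K}

/-- `X_h`: globally continuous functions that are affine on each element. -/
structure IsFEFunction {Ω : Set Plane} (T : Geometry.SimplicialComplex ℝ Plane) (v : H1 Ω) :
    Prop where
  continuousOn : ContinuousOn v (closure Ω)
  affine : ∀ K ∈ elements T, ∃ A : Plane →ᵃ[ℝ] ℝ, ∀ x ∈ tri K, v x = A x

/-- `V_h = X_h ∩ H¹₀(Ω)`. -/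
def IsFEFunction0 {Ω : Set Plane} (T : Geometry.SimplicialComplex ℝ Plane) (v : H1 Ω) : Prop :=
  IsFEFunction T v ∧ IsH10 v

/-- `u` satisfies `-Δu = f` in `Ω` in the weak sense. -/
def IsWeakSolution {Ω : Set Plane} (f : Plane → ℝ) (u : H1 Ω) : Prop :=
  ∀ v : H1 Ω, IsH10 v → bilin u v = ∫ x in Ω, f x * v x

/-- `U` is the finite element solution on `T` with right-hand side `f` and discrete Dirichlet
lift `g`: `U = U₀ + g` with `U₀ ∈ V_h`, and `a(U, v) = (f, v)` for all `v ∈ V_h`. -/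
def IsFEMSolution {Ω : Set Plane} (T : Geometry.SimplicialComplex ℝ Plane) (f : Plane → ℝ)
    (g U : H1 Ω) : Prop :=
  (∃ U₀ : H1 Ω, IsFEFunction0 T U₀ ∧ U = U₀ + g) ∧
    ∀ v : H1 Ω, IsFEFunction0 T v → bilin U v = ∫ x in Ω, f x * v x

/-! ### Clusters -/

/-- The region covered by a set of elements. -/
def region (𝒞 : Set (Finset Plane)) : Set Plane := ⋃ K ∈ 𝒞, tri K

/-- A cluster: a set of elements, at least one of which violates the maximum angle condition,
whose union is simply connected. -/
structure IsCluster (T : Geometry.SimplicialComplex ℝ Plane) (α₀ : ℝ)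
    (𝒞 : Set (Finset Plane)) : Prop where
  subset : 𝒞 ⊆ elements T
  simplyConnected : IsSimplyConnected (region 𝒞)
  exists_bad : ∃ K ∈ 𝒞, K ∈ badElements T α₀

/-- `r_𝒞 = diam 𝒞`. -/
def clusterDiam (𝒞 : Set (Finset Plane)) : ℝ := Metric.diam (region 𝒞)

/-- The cluster condition: every element violating the maximum angle condition belongs to one of
the clusters, `∑ᵢ (diam 𝒞ᵢ)² ≤ C₁ h`, and
`dist (𝒞ᵢ, 𝒞ⱼ) ≥ 2 (diam 𝒞ᵢ + diam 𝒞ⱼ)` for `i ≠ j`. -/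
structure IsClusterFamily (T : Geometry.SimplicialComplex ℝ Plane) (α₀ C₁ : ℝ) {N : ℕ}
    (𝒞 : Fin N → Set (Finset Plane)) : Prop where
  isCluster : ∀ i, IsCluster T α₀ (𝒞 i)
  cover : ∀ K ∈ badElements T α₀, ∃ i, K ∈ 𝒞 i
  sum_le : ∑ i, clusterDiam (𝒞 i) ^ 2 ≤ C₁ * meshSize T
  separated : ∀ i j, i ≠ j → ∀ x ∈ region (𝒞 i), ∀ y ∈ region (𝒞 j),
    2 * (clusterDiam (𝒞 i) + clusterDiam (𝒞 j)) ≤ dist x y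

/-- `g` is admissible discrete Dirichlet data for `u`, up to nodal errors of size at most `ε`:
`g ∈ X_h`; at every boundary vertex `|g - u| ≤ ε`; `g` interpolates `u` at every boundary vertex
whose distance to each cluster is at least twice the diameter of the cluster; and `g = 0` if `u`
has homogeneous boundary values. -/
structure IsBoundaryApprox {Ω : Set Plane} (T : Geometry.SimplicialComplex ℝ Plane) {N : ℕ}
    (𝒞 : Fin N → Set (Finset Plane)) (u : H1 Ω) (ε : ℝ) (g : H1 Ω) : Prop where
  isFEFunction : IsFEFunction T g
  nodal_le : ∀ p ∈ T.vertices, p ∈ frontier Ω → |g p - u p| ≤ ε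
  nodal_eq : ∀ p ∈ T.vertices, p ∈ frontier Ω →
    (∀ i, ∀ x ∈ region (𝒞 i), 2 * clusterDiam (𝒞 i) ≤ dist p x) → g p = u p
  homogeneous : (∀ x ∈ frontier Ω, u x = 0) → ∀ x ∈ closure Ω, g x = 0

end

end ClusterFEM

namespace ClusterFEM

/-! By Galerkin orthogonality the error of `U` is at most that of any competitor in the affine trial
space (`semiDistH1_le_of_orthogonal`). So it suffices to find one finite element function `w` with
admissible boundary values and `|u - w|₁ = O(h)`; this is `exists_feApprox`. Nodal interpolation of
`u` itself is good on elements with angles at most `α₀`, but may fail on the others. Therefore `u`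
is first made affine on each cluster. Around the `i`-th cluster choose an affine function `A i`
close to `u` and a cutoff `η i`, equal to 1 on the ball of radius `r i` about a point of the cluster
and to 0 outside the ball of radius `2 * r i`. Let `v = u - ∑ η i * (u - A i)`, and let `w` be the
nodal interpolant of `v`. On a cluster `v = A i`, so interpolation is exact there whatever the
angles are.

Two facts make this work. The first is scaling: near the cluster `u - A i` is `O(r²)` and its
gradient `O(r)`, while the first and second derivatives of `η i` are `O(r⁻¹)` and `O(r⁻²)`. The
product thus has second-order size independent of `r` (`IsCutoff.isJet_mul`). Separation makes the
balls disjoint, so `v` is as regular as `u` up to a constant, and its interpolation error is `O(h)`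
on elements obeying the angle condition (`exists_maxAngle_bound`, `norm_sub_affGrad_le`). The second
is summation: replacing `u` by `v` costs `O(r i)` in the gradient on a ball of area `O(r i ²)`. The
squared error is then of order `∑ r i ⁴ ≤ (∑ r i ²)² ≤ (C₁ h)²`. Boundary values at vertices change
by `O(r i ²) = O(h)`.

Second-order control is expressed by Whitney jets (`IsJet`), that is, by inequalities between pairs
of points, which survive cutting off and make sense on the closure of `Ω`. A `W^{2,∞}` function is
such a jet because bounded Lipschitz domains are quasiconvex (`exists_quasiconvex`,
`exists_isJet_of_isW2Inf`).

If `u` vanishes on the boundary, `w` has to lie in `H¹₀`, so `A i` must vanish on the nearby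
boundary (`exists_affine_approx`). When that part of the boundary lies on a line, the Taylor
polynomial of `u` at a boundary point does so, since its tangential derivative is zero. Otherwise
two boundary edges not on a common line force the gradient of `u` to be `O(r)` there
(`exists_norm_gradient_bound`), and `A i = 0` is accurate enough. Membership of `w` in `H¹₀` then
follows from `interp_eq_zero_of_mem_frontier` and `isH10_feInterp`. -/

/-! ### Geometry of Lipschitz domains -/

/-- `PolyPath S x y ℓ`: a polygonal path of length `ℓ` from `x` to `y` whose edges lie in `S`. -/
inductive PolyPath (S : Set Plane) (x : Plane) : Plane → ℝ → Prop
  | refl : PolyPath S x x 0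
  | step {y z : Plane} {ℓ : ℝ} : PolyPath S x y ℓ → segment ℝ y z ⊆ S →
      PolyPath S x z (ℓ + dist y z)

theorem PolyPath.trans {S : Set Plane} {x y z : Plane} {ℓ ℓ' : ℝ} (h : PolyPath S x y ℓ)
    (h' : PolyPath S y z ℓ') : PolyPath S x z (ℓ + ℓ') := by
  induction h' with
  | refl => simpa using h
  | step _ hs ih => rw [← add_assoc]; exact ih.step hs

theorem PolyPath.of_segment {S : Set Plane} {x y : Plane} (h : segment ℝ x y ⊆ S) :
    PolyPath S x y (dist x y) := by
  simpa using (PolyPath.refl (S := S) (x := x)).step h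

theorem PolyPath.dist_le {S : Set Plane} {x y : Plane} {ℓ : ℝ} (h : PolyPath S x y ℓ) :
    dist x y ≤ ℓ := by
  induction h with
  | refl => simp
  | @step y z ℓ _ _ ih => exact (dist_triangle x y z).trans (by linarith)

theorem PolyPath.nonneg {S : Set Plane} {x y : Plane} {ℓ : ℝ} (h : PolyPath S x y ℓ) : 0 ≤ ℓ :=
  dist_nonneg.trans h.dist_le

/-- The unit vector pointing upwards in the coordinates given by `R`. -/
noncomputable def upVec (R : Plane ≃ₗᵢ[ℝ] Plane) : Plane := R.symm (EuclideanSpace.single 1 1)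

theorem norm_upVec (R : Plane ≃ₗᵢ[ℝ] Plane) : ‖upVec R‖ = 1 := by
  simp [upVec]

theorem map_add_upVec_zero (R : Plane ≃ₗᵢ[ℝ] Plane) (x : Plane) (s : ℝ) :
    R (x + s • upVec R) 0 = R x 0 := by
  simp [upVec]

theorem map_add_upVec_one (R : Plane ≃ₗᵢ[ℝ] Plane) (x : Plane) (s : ℝ) :
    R (x + s • upVec R) 1 = R x 1 + s := by
  simp [upVec]

theorem continuous_coord (R : Plane ≃ₗᵢ[ℝ] Plane) (i : Fin 2) : Continuous fun x => R x i :=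
  (EuclideanSpace.proj (𝕜 := ℝ) i).continuous.comp R.continuous

/-- A Lipschitz domain has no slits or punctures: directly below a boundary point, in the local
graph coordinates, there are exterior points arbitrarily close to it. -/
theorem interior_closure_subset {Ω : Set Plane} (ho : IsOpen Ω) (hL : HasLipschitzBoundary Ω) :
    interior (closure Ω) ⊆ Ω := by
  intro x hx
  by_contra hxΩ
  have hfr : x ∈ frontier Ω := by
    rw [ho.frontier_eq]; exact ⟨interior_subset hx, hxΩ⟩
  obtain ⟨R, γ, L, ρ, hρ, hγ, h⟩ := hL x hfr
  have hlow : R x 1 ≤ γ (R x 0) := by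
    by_contra hc
    exact hxΩ ((h x (Metric.mem_ball_self hρ)).2 (not_le.1 hc))
  have hcont : Tendsto (fun t : ℝ => x + (-t) • upVec R) (𝓝[>] 0) (𝓝 x) := by
    have : Continuous (fun t : ℝ => x + (-t) • upVec R) := by fun_prop
    simpa using (this.tendsto 0).mono_left nhdsWithin_le_nhds
  have hev : ∀ᶠ t : ℝ in 𝓝[>] 0, x + (-t) • upVec R ∈ closure Ω ∩ Metric.ball x ρ :=
    hcont.eventually (inter_mem (mem_interior_iff_mem_nhds.1 hx) (Metric.ball_mem_nhds x hρ))
  obtain ⟨t, ht, ht0⟩ := (hev.and self_mem_nhdsWithin).exists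
  set y := x + (-t) • upVec R with hy
  have hopen : IsOpen {z : Plane | R z 1 < γ (R z 0)} :=
    isOpen_lt (continuous_coord R 1) (hγ.continuous.comp (continuous_coord R 0))
  have hyO : y ∈ {z : Plane | R z 1 < γ (R z 0)} ∩ Metric.ball x ρ := by
    refine ⟨?_, ht.2⟩
    simp only [mem_ofPred_eq, hy, map_add_upVec_zero, map_add_upVec_one]
    have : (0 : ℝ) < t := ht0
    linarith
  obtain ⟨z, hz, hzΩ⟩ := mem_closure_iff.1 ht.1 _ (hopen.inter Metric.isOpen_ball) hyO
  have h1 := (h z hz.2).1 hzΩ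
  exact absurd hz.1 (not_lt.2 h1.le)

-- Near a boundary point the path rises vertically by `L * dist y z`, crosses over, and descends.
-- The lift compensates for the largest possible rise of the graph between the two endpoints.
set_option maxHeartbeats 800000 in
theorem exists_polyPath_near {Ω : Set Plane} (ho : IsOpen Ω) (hL : HasLipschitzBoundary Ω)
    {x : Plane} (hx : x ∈ closure Ω) :
    ∃ δ > 0, ∃ C : ℝ, ∀ y ∈ Ω ∩ Metric.ball x δ, ∀ z ∈ Ω ∩ Metric.ball x δ,
      ∃ ℓ ≤ C * dist y z, PolyPath Ω y z ℓ := by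
  by_cases hxΩ : x ∈ Ω
  · obtain ⟨δ, hδ, hsub⟩ := Metric.isOpen_iff.1 ho x hxΩ
    refine ⟨δ, hδ, 1, fun y hy z hz => ⟨dist y z, by simp, PolyPath.of_segment ?_⟩⟩
    exact ((convex_ball x δ).segment_subset hy.2 hz.2).trans hsub
  · have hfr : x ∈ frontier Ω := by
      rw [ho.frontier_eq]; exact ⟨hx, hxΩ⟩
    obtain ⟨R, γ, L, ρ, hρ, hγ, h⟩ := hL x hfr
    have hL0 : (0 : ℝ) ≤ L := L.2
    -- The radius is such that the lifted points, displaced by at most `2 * L * δ`, are still in the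
    -- ball of radius `ρ`. The constant counts the ascent, the descent and the crossing.
    refine ⟨ρ / (1 + 2 * L), by positivity, 2 * L + 1, fun y hy z hz => ?_⟩
    set δ := ρ / (1 + 2 * (L : ℝ)) with hδ
    have hδρ : δ * (1 + 2 * L) = ρ := by rw [hδ]; field_simp
    have hδ0 : 0 < δ := by positivity
    have hyb : dist y x < δ := hy.2
    have hzb : dist z x < δ := hz.2
    have hδle : δ ≤ ρ := by nlinarith
    have hyz : dist y z ≤ 2 * δ := by
      have := dist_triangle_right y z x; linarith
    set s := (L : ℝ) * dist y z with hs
    have hs0 : 0 ≤ s := by positivity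
    have hsδ : s ≤ 2 * L * δ := by
      have := mul_le_mul_of_nonneg_left hyz hL0; linarith
    have hup : ∀ w : Plane, dist w x < δ → w + s • upVec R ∈ Metric.ball x ρ := by
      intro w hw
      rw [Metric.mem_ball, dist_eq_norm]
      have h1 : w + s • upVec R - x = (w - x) + s • upVec R := by abel
      rw [h1]
      refine (norm_add_le _ _).trans_lt ?_
      rw [norm_smul, norm_upVec, ← dist_eq_norm, Real.norm_eq_abs, abs_of_nonneg hs0]
      linarith
    have hyρ : y ∈ Metric.ball x ρ := Metric.ball_subset_ball hδle hy.2
    have hzρ : z ∈ Metric.ball x ρ := Metric.ball_subset_ball hδle hz.2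
    have hvert : ∀ w ∈ Ω, w ∈ Metric.ball x ρ → w + s • upVec R ∈ Metric.ball x ρ →
        segment ℝ w (w + s • upVec R) ⊆ Ω := by
      intro w hw hwρ hwρ' v hv
      have hvρ := (convex_ball x ρ).segment_subset hwρ hwρ' hv
      rw [segment_eq_image'] at hv
      obtain ⟨t, ht, rfl⟩ := hv
      have heq : w + t • (w + s • upVec R - w) = w + (t * s) • upVec R := by
        rw [add_sub_cancel_left, smul_smul]
      simp only [heq] at hvρ ⊢
      rw [h _ hvρ, map_add_upVec_zero, map_add_upVec_one]
      have := (h w hwρ).1 hw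
      have := mul_nonneg ht.1 hs0
      linarith
    have hdist : dist (y + s • upVec R) (z + s • upVec R) = dist y z := dist_add_right _ _ _
    have hupn : ∀ w : Plane, dist w (w + s • upVec R) = s := by
      intro w
      rw [dist_self_add_right, norm_smul, norm_upVec, Real.norm_eq_abs, abs_of_nonneg hs0, mul_one]
    have p1 := (PolyPath.of_segment (hvert y hy.1 hyρ (hup y hyb)))
    have hmid : segment ℝ (y + s • upVec R) (z + s • upVec R) ⊆ Ω := by
      intro v hv
      have hvρ := (convex_ball x ρ).segment_subset (hup y hyb) (hup z hzb) hv
      obtain ⟨a, b, ha, hb, hab, rfl⟩ := hv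
      have heq : a • (y + s • upVec R) + b • (z + s • upVec R) =
          (a • y + b • z) + s • upVec R := by
        have : s • upVec R = a • s • upVec R + b • s • upVec R := by
          rw [← add_smul, hab, one_smul]
        rw [smul_add, smul_add]; nth_rw 3 [this]; abel
      rw [heq] at hvρ ⊢
      rw [h _ hvρ, map_add_upVec_zero, map_add_upVec_one]
      have e0 : R (a • y + b • z) 0 = a * R y 0 + b * R z 0 := by simp
      have e1 : R (a • y + b • z) 1 = a * R y 1 + b * R z 1 := by simp
      have hy1 := (h y hyρ).1 hy.1
      have hz1 := (h z hzρ).1 hz.1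
      have hd : |R y 0 - R z 0| ≤ dist y z := by
        rw [dist_eq_norm, ← R.norm_map, map_sub]
        have := EuclideanSpace.norm_eq (R y - R z)
        have h2 := PiLp.norm_apply_le (R y - R z) 0
        simpa using h2
      have hlip : ∀ p q : ℝ, γ p ≤ γ q + L * |p - q| := by
        intro p q
        have := hγ.dist_le_mul p q
        rw [Real.dist_eq, Real.dist_eq] at this
        linarith [le_abs_self (γ p - γ q)]
      have g1 := hlip (a * R y 0 + b * R z 0) (R y 0)
      have g2 := hlip (a * R y 0 + b * R z 0) (R z 0)
      have a1 : |a * R y 0 + b * R z 0 - R y 0| = b * |R y 0 - R z 0| := by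
        have : a * R y 0 + b * R z 0 - R y 0 = -(b * (R y 0 - R z 0)) := by
          rw [show a = 1 - b by linarith]; ring
        rw [this, abs_neg, abs_mul, abs_of_nonneg hb]
      have a2 : |a * R y 0 + b * R z 0 - R z 0| = a * |R y 0 - R z 0| := by
        have : a * R y 0 + b * R z 0 - R z 0 = a * (R y 0 - R z 0) := by
          rw [show b = 1 - a by linarith]; ring
        rw [this, abs_mul, abs_of_nonneg ha]
      rw [a1] at g1
      rw [a2] at g2
      rw [e0, e1]
      set D := |R y 0 - R z 0|
      set g := γ (a * R y 0 + b * R z 0)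
      have hD : 0 ≤ D := abs_nonneg _
      have hLD : L * D ≤ s := mul_le_mul_of_nonneg_left hd hL0
      have k1 : g < R y 1 + b * s := by
        have := mul_le_mul_of_nonneg_left hLD hb; linarith [mul_left_comm (L : ℝ) b D]
      have k2 : g < R z 1 + a * s := by
        have := mul_le_mul_of_nonneg_left hLD ha; linarith [mul_left_comm (L : ℝ) a D]
      -- The graph can exceed the chord from `y` to `z` by at most `2 * a * b * s ≤ s / 2`, which is
      -- below the lift `s`.
      have hab2 : a * b ≤ 1 / 4 := by nlinarith [sq_nonneg (a - b)]
      have k3 : g < a * (R y 1 + b * s) + b * (R z 1 + a * s) := by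
        rcases ha.eq_or_lt with h0 | h0
        · have hb1 : b = 1 := by linarith
          subst h0; subst hb1; linarith
        · have := mul_lt_mul_of_pos_left k1 h0
          have := mul_le_mul_of_nonneg_left k2.le hb
          have hg : g = a * g + b * g := by rw [← add_mul, hab, one_mul]
          linarith
      have k4 := mul_le_mul_of_nonneg_right hab2 hs0
      have k5 : a * (R y 1 + b * s) + b * (R z 1 + a * s) =
          a * R y 1 + b * R z 1 + 2 * (a * b * s) := by ring
      linarith
    have p2 := PolyPath.of_segment hmid
    have p3 : PolyPath Ω (z + s • upVec R) z (dist (z + s • upVec R) z) := by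
      refine PolyPath.of_segment ?_
      rw [segment_symm]
      exact hvert z hz.1 hzρ (hup z hzb)
    refine ⟨_, ?_, (p1.trans p2).trans p3⟩
    rw [hdist, hupn, dist_comm (z + s • upVec R) z, hupn, hs]
    linarith

/-- The points reachable from `x` and the unreachable ones are both open, since balls are convex. -/
theorem exists_polyPath_of_isConnected {Ω : Set Plane} (ho : IsOpen Ω) (hc : IsConnected Ω)
    {x y : Plane} (hx : x ∈ Ω) (hy : y ∈ Ω) : ∃ ℓ, PolyPath Ω x y ℓ := by
  let A : Set Plane := {z | z ∈ Ω ∧ ∃ ℓ, PolyPath Ω x z ℓ}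
  let B : Set Plane := {z | z ∈ Ω ∧ ¬∃ ℓ, PolyPath Ω x z ℓ}
  have hball : ∀ z ∈ Ω, ∃ ε > 0, ∀ w ∈ Metric.ball z ε, w ∈ Ω ∧
      ((∃ ℓ, PolyPath Ω x z ℓ) ↔ ∃ ℓ, PolyPath Ω x w ℓ) := by
    intro z hz
    obtain ⟨ε, hε, hsub⟩ := Metric.isOpen_iff.1 ho z hz
    refine ⟨ε, hε, fun w hw => ⟨hsub hw, ?_⟩⟩
    have hseg : segment ℝ z w ⊆ Ω :=
      ((convex_ball z ε).segment_subset (Metric.mem_ball_self hε) hw).trans hsub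
    exact ⟨fun ⟨ℓ, h⟩ => ⟨_, h.step hseg⟩, fun ⟨ℓ, h⟩ => ⟨_, h.step (segment_symm ℝ z w ▸ hseg)⟩⟩
  have hA : IsOpen A := by
    rw [Metric.isOpen_iff]
    rintro z ⟨hz, hp⟩
    obtain ⟨ε, hε, h⟩ := hball z hz
    exact ⟨ε, hε, fun w hw => ⟨(h w hw).1, (h w hw).2.1 hp⟩⟩
  have hB : IsOpen B := by
    rw [Metric.isOpen_iff]
    rintro z ⟨hz, hp⟩
    obtain ⟨ε, hε, h⟩ := hball z hz
    exact ⟨ε, hε, fun w hw => ⟨(h w hw).1, fun hw' => hp ((h w hw).2.2 hw')⟩⟩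
  by_contra hno
  obtain ⟨z, -, hzA, hzB⟩ := hc.isPreconnected A B hA hB
    (fun z hz => by by_cases hp : ∃ ℓ, PolyPath Ω x z ℓ; exacts [Or.inl ⟨hz, hp⟩, Or.inr ⟨hz, hp⟩])
    ⟨x, hx, hx, 0, PolyPath.refl⟩ ⟨y, hy, hy, hno⟩
  exact hzB.2 hzA.2

/-- Bounded Lipschitz domains are quasiconvex. -/
theorem exists_quasiconvex {Ω : Set Plane} (hΩ : IsPolygonalDomain Ω) :
    ∃ C : ℝ, 0 < C ∧ ∀ x ∈ Ω, ∀ y ∈ Ω, ∃ ℓ ≤ C * dist x y, PolyPath Ω x y ℓ := by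
  have hcpt : IsCompact (closure Ω) := hΩ.isBounded.isCompact_closure
  choose! δ hδ C hC using fun x (hx : x ∈ closure Ω) =>
    exists_polyPath_near hΩ.isOpen hΩ.lipschitz hx
  -- a uniform local bound
  obtain ⟨δ₀, hδ₀, C₀, hloc⟩ : ∃ δ₀ > 0, ∃ C₀ : ℝ, ∀ y ∈ Ω, ∀ z ∈ Ω, dist y z < δ₀ →
      ∃ ℓ ≤ C₀ * dist y z, PolyPath Ω y z ℓ := by
    obtain ⟨t, htsub, htcov⟩ := hcpt.elim_nhds_subcover (fun x => Metric.ball x (δ x / 2))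
      (fun x hx => Metric.ball_mem_nhds x (half_pos (hδ x hx)))
    obtain ⟨C₀, hC₀⟩ := (t.image C).bddAbove
    obtain ⟨δ₀, hδ₀, hδt⟩ : ∃ δ₀ > 0, ∀ x ∈ t, δ₀ ≤ δ x / 2 := by
      -- The extra element 1 provides a minimum even for an empty subcover.
      have hne : (insert 1 (t.image fun x => δ x / 2)).Nonempty := Finset.insert_nonempty _ _
      refine ⟨(insert 1 (t.image fun x => δ x / 2)).min' hne, ?_, fun x hx => ?_⟩
      · rw [gt_iff_lt, Finset.lt_min'_iff]
        intro b hb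
        rw [Finset.mem_insert, Finset.mem_image] at hb
        rcases hb with rfl | ⟨x, hx, rfl⟩
        · exact one_pos
        · exact half_pos (hδ x (htsub x hx))
      · exact Finset.min'_le _ _ (Finset.mem_insert_of_mem (Finset.mem_image_of_mem _ hx))
    refine ⟨δ₀, hδ₀, C₀, fun y hy z hz hyz => ?_⟩
    obtain ⟨x, hx, hyx⟩ := mem_iUnion₂.1 (htcov (subset_closure hy))
    have h1 : dist y x < δ x / 2 := hyx
    have h2 := hδt x hx
    have h3 := hδ x (htsub x hx)
    obtain ⟨ℓ, hℓ, hp⟩ := hC x (htsub x hx) y ⟨hy, by rw [Metric.mem_ball]; linarith⟩ z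
      ⟨hz, by rw [Metric.mem_ball]; linarith [dist_triangle_left z x y]⟩
    exact ⟨ℓ, hℓ.trans (mul_le_mul_of_nonneg_right
      (hC₀ (Finset.mem_coe.2 (Finset.mem_image_of_mem C hx))) dist_nonneg), hp⟩
  -- a uniform bound for all pairs
  obtain ⟨D, hD⟩ : ∃ D : ℝ, ∀ x ∈ Ω, ∀ y ∈ Ω, ∃ ℓ ≤ D, PolyPath Ω x y ℓ := by
    obtain ⟨t, htsub, htfin, htcov⟩ :=
      Metric.finite_approx_of_totallyBounded (hcpt.totallyBounded.subset subset_closure) δ₀ hδ₀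
    choose! ℓ hℓ using fun (p : Plane × Plane) (hp : p ∈ t ×ˢ t) =>
      exists_polyPath_of_isConnected hΩ.isOpen hΩ.isConnected (htsub hp.1) (htsub hp.2)
    obtain ⟨D, hD⟩ := ((htfin.prod htfin).image ℓ).bddAbove
    refine ⟨2 * (|C₀| * δ₀) + D, fun x hx y hy => ?_⟩
    obtain ⟨p, hp, hxp⟩ := mem_iUnion₂.1 (htcov hx)
    obtain ⟨q, hq, hyq⟩ := mem_iUnion₂.1 (htcov hy)
    have hxp' : dist x p < δ₀ := hxp
    have hyq' : dist q y < δ₀ := by rw [dist_comm]; exact hyq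
    obtain ⟨ℓ₁, hℓ₁, h₁⟩ := hloc x hx p (htsub hp) hxp'
    obtain ⟨ℓ₂, hℓ₂, h₂⟩ := hloc q (htsub hq) y hy hyq'
    refine ⟨_, ?_, (h₁.trans (hℓ (p, q) ⟨hp, hq⟩)).trans h₂⟩
    have k := hD (mem_image_of_mem ℓ (show (p, q) ∈ t ×ˢ t from ⟨hp, hq⟩))
    have k1 : C₀ * dist x p ≤ |C₀| * δ₀ :=
      mul_le_mul (le_abs_self _) hxp'.le dist_nonneg (abs_nonneg _)
    have k2 : C₀ * dist q y ≤ |C₀| * δ₀ :=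
      mul_le_mul (le_abs_self _) hyq'.le dist_nonneg (abs_nonneg _)
    linarith
  -- Pairs closer than `δ₀` use the local bound. For the others the fixed length `D` is at most `|D|
  -- / δ₀` times the distance.
  refine ⟨|C₀| + |D| / δ₀ + 1, by positivity, fun x hx y hy => ?_⟩
  rcases lt_or_ge (dist x y) δ₀ with h | h
  · obtain ⟨ℓ, hℓ, hp⟩ := hloc x hx y hy h
    refine ⟨ℓ, hℓ.trans (mul_le_mul_of_nonneg_right ?_ dist_nonneg), hp⟩
    have : 0 ≤ |D| / δ₀ := by positivity
    linarith [le_abs_self C₀]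
  · obtain ⟨ℓ, hℓ, hp⟩ := hD x hx y hy
    refine ⟨ℓ, hℓ.trans ?_, hp⟩
    calc D ≤ |D| / δ₀ * δ₀ := by rw [div_mul_cancel₀ _ hδ₀.ne']; exact le_abs_self D
      _ ≤ (|C₀| + |D| / δ₀ + 1) * dist x y := by
        refine mul_le_mul ?_ h hδ₀.le (by positivity)
        linarith [abs_nonneg C₀]

/-! ### Mollification -/

section Mollify

variable {F : Type*} [NormedAddCommGroup F] [NormedSpace ℝ F]

/-- Bump functions shrinking to the origin. -/
noncomputable def bumpSeq (n : ℕ) : ContDiffBump (0 : Plane) where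
  rIn := 1 / ((n : ℝ) + 1)
  rOut := 2 / ((n : ℝ) + 1)
  rIn_pos := by positivity
  rIn_lt_rOut := by
    have : (0 : ℝ) < (n : ℝ) + 1 := by positivity
    gcongr
    norm_num

/-- The mollifier `φₙ`. -/
noncomputable def mollifier (n : ℕ) : Plane → ℝ := (bumpSeq n).normed volume

/-- The mollification `φₙ ⋆ w`. -/
noncomputable def mollify (n : ℕ) (w : Plane → F) : Plane → F :=
  convolution (mollifier n) w (ContinuousLinearMap.lsmul ℝ ℝ) volume

theorem tendsto_bumpSeq_rOut : Tendsto (fun n => (bumpSeq n).rOut) atTop (𝓝 0) := by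
  have := (tendsto_one_div_add_atTop_nhds_zero_nat (𝕜 := ℝ)).const_mul 2
  simpa [bumpSeq, div_eq_mul_inv] using this

theorem mollify_apply (n : ℕ) (w : Plane → F) (x : Plane) :
    mollify n w x = ∫ z, mollifier n (x - z) • w z := by
  simp [mollify, convolution_eq_swap]

theorem integrable_mollifier (n : ℕ) : Integrable (mollifier n) :=
  (bumpSeq n).integrable_normed

theorem contDiff_mollifier (n : ℕ) : ContDiff ℝ ∞ (mollifier n) :=
  (bumpSeq n).contDiff_normed

theorem hasCompactSupport_mollifier (n : ℕ) : HasCompactSupport (mollifier n) :=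
  (bumpSeq n).hasCompactSupport_normed

theorem norm_mollify_le (n : ℕ) {w : Plane → F} {M : ℝ} (hM : ∀ᵐ z, ‖w z‖ ≤ M) (x : Plane) :
    ‖mollify n w x‖ ≤ M := by
  rw [mollify_apply]
  have hInt : Integrable fun z => mollifier n (x - z) * M :=
    ((integrable_mollifier n).comp_sub_left x).mul_const M
  refine (norm_integral_le_of_norm_le hInt ?_).trans ?_
  · filter_upwards [hM] with z hz
    have h0 : 0 ≤ mollifier n (x - z) := (bumpSeq n).nonneg_normed _
    rw [norm_smul, Real.norm_eq_abs, abs_of_nonneg h0]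
    exact mul_le_mul_of_nonneg_left hz h0
  · rw [integral_mul_const, integral_sub_left_eq_self (mollifier n) volume x]
    have : ∫ z, mollifier n z = 1 := (bumpSeq n).integral_normed
    rw [this, one_mul]

theorem ae_tendsto_mollify [CompleteSpace F] {w : Plane → F} (hw : LocallyIntegrable w) :
    ∀ᵐ x, Tendsto (fun n => mollify n w x) atTop (𝓝 (w x)) := by
  -- The differentiation theorem needs a bounded ratio of outer to inner radius; here it is exactly
  -- 2.
  refine ContDiffBump.ae_convolution_tendsto_right_of_locallyIntegrable (K := 2)
    tendsto_bumpSeq_rOut (Eventually.of_forall fun n => ?_) hw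
  simp only [bumpSeq]
  exact le_of_eq (by ring)

theorem tendsto_mollify_of_continuousAt [CompleteSpace F] {w : Plane → F}
    (hw : AEStronglyMeasurable w) {x : Plane} (hx : ContinuousAt w x) :
    Tendsto (fun n => mollify n w x) atTop (𝓝 (w x)) :=
  ContDiffBump.convolution_tendsto_right tendsto_bumpSeq_rOut (Eventually.of_forall fun _ => hw)
    (hx.tendsto.comp tendsto_snd) tendsto_const_nhds

theorem contDiff_mollify (n : ℕ) {w : Plane → F} (hw : LocallyIntegrable w) :
    ContDiff ℝ ∞ (mollify n w) :=
  (hasCompactSupport_mollifier n).contDiff_convolution_left _ (contDiff_mollifier n) hw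

theorem mollifier_sub_isTestFunction {Ω : Set Plane} (n : ℕ) {x : Plane}
    (hx : Metric.closedBall x (bumpSeq n).rOut ⊆ Ω) :
    IsTestFunction Ω (fun z => mollifier n (x - z)) := by
  have hsupp : tsupport (fun z => mollifier n (x - z)) ⊆
      Metric.closedBall x (bumpSeq n).rOut := by
    refine closure_minimal (fun z hz => ?_) Metric.isClosed_closedBall
    have : x - z ∈ Function.support ((bumpSeq n).normed volume) := hz
    rw [(bumpSeq n).support_normed_eq, mem_ball_zero_iff, ← dist_eq_norm, dist_comm] at this
    exact this.le
  refine ⟨(contDiff_mollifier n).comp (contDiff_const.sub contDiff_id), ?_, hsupp.trans hx⟩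
  exact HasCompactSupport.of_support_subset_isCompact (isCompact_closedBall x _)
    ((subset_tsupport _).trans hsupp)

/-- The derivative falls on the mollifier, and `z ↦ mollifier n (x - z)` is an admissible test
function once its support ball fits into `Ω`. The sign from the reflection `z ↦ x - z` cancels the
one in the definition of the weak gradient. -/
theorem hasGradientAt_mollify {Ω : Set Plane} (ho : IsOpen Ω) {w : Plane → ℝ} {H : Plane → Plane}
    (hw : IsWeakGradient Ω w H) (hwi : IntegrableOn w Ω) (n : ℕ)
    {x : Plane} (hx : Metric.closedBall x (bumpSeq n).rOut ⊆ Ω) :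
    HasGradientAt (mollify n (Ω.indicator w)) (mollify n (Ω.indicator H) x) x := by
  have hw0 : LocallyIntegrable (Ω.indicator w) :=
    ((integrable_indicator_iff ho.measurableSet).2 hwi).locallyIntegrable
  have hc1 : ContDiff ℝ 1 (mollifier n) := (contDiff_mollifier n).of_le (by simp)
  have hcs' : HasCompactSupport (fderiv ℝ (mollifier n)) :=
    (hasCompactSupport_mollifier n).fderiv (𝕜 := ℝ)
  have hD := (hasCompactSupport_mollifier n).hasFDerivAt_convolution_left
    (ContinuousLinearMap.lsmul ℝ ℝ) hc1 hw0 x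
  rw [hasGradientAt_iff_hasFDerivAt]
  suffices hEq : (InnerProductSpace.toDual ℝ Plane) (mollify n (Ω.indicator H) x) =
      convolution (fderiv ℝ (mollifier n)) (Ω.indicator w)
        (ContinuousLinearMap.precompL Plane (ContinuousLinearMap.lsmul ℝ ℝ)) volume x by
    rw [hEq]; exact hD
  ext v
  have hψ := mollifier_sub_isTestFunction n hx
  have hgrad : ∀ z, gradient (fun z => mollifier n (x - z)) z = -gradient (mollifier n) (x - z) := by
    intro z
    have hd : HasFDerivAt (mollifier n) (fderiv ℝ (mollifier n) (x - z)) (x - z) :=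
      (hc1.differentiable (by simp) (x - z)).hasFDerivAt
    have h2 : HasFDerivAt (fun z => x - z) (-ContinuousLinearMap.id ℝ Plane) z := by
      simpa using (hasFDerivAt_id z).const_sub x
    have h3 := (hd.comp z h2).fderiv
    rw [gradient, show (fun z => mollifier n (x - z)) = mollifier n ∘ (fun z => x - z) from rfl, h3]
    simp [gradient]
  have hconv : Integrable (fun z => (ContinuousLinearMap.precompL Plane
      (ContinuousLinearMap.lsmul ℝ ℝ)) (fderiv ℝ (mollifier n) (x - z)) (Ω.indicator w z)) := by
    have h1 := (hcs'.convolutionExists_left (ContinuousLinearMap.precompL Plane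
      (ContinuousLinearMap.lsmul ℝ ℝ : ℝ →L[ℝ] ℝ →L[ℝ] ℝ)) (hc1.continuous_fderiv (by simp)) hw0) x
    have h2 := h1.integrable.comp_sub_left x
    simpa using h2
  rw [convolution_eq_swap, ContinuousLinearMap.integral_apply hconv]
  have hwk := hw.integral_eq _ hψ
  have hI1 := integrableOn_smul_gradient hw.locallyIntegrableOn hψ
  have hI2 := integrableOn_smul_of_isTestFunction hw.locallyIntegrableOn_grad hψ
  have key := congrArg (inner ℝ v) hwk
  rw [inner_neg_right, ← integral_inner hI1, ← integral_inner hI2] at key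
  have e1 : ∫ z, (ContinuousLinearMap.precompL Plane (ContinuousLinearMap.lsmul ℝ ℝ))
      (fderiv ℝ (mollifier n) (x - z)) (Ω.indicator w z) v =
      -∫ z in Ω, inner ℝ v (w z • gradient (fun z => mollifier n (x - z)) z) := by
    rw [← integral_neg, ← integral_indicator ho.measurableSet]
    refine integral_congr_ae (Eventually.of_forall fun z => ?_)
    by_cases hz : z ∈ Ω
    · simp only [hz, indicator_of_mem, ContinuousLinearMap.precompL_apply,
        ContinuousLinearMap.lsmul_apply, hgrad, smul_neg, inner_neg_right, neg_neg,
        inner_smul_right, smul_eq_mul]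
      rw [real_inner_comm, gradient, InnerProductSpace.toDual_symm_apply, mul_comm]
    · simp [hz]
  have e2 : (InnerProductSpace.toDual ℝ Plane) (mollify n (Ω.indicator H) x) v =
      ∫ z in Ω, inner ℝ v (mollifier n (x - z) • H z) := by
    rw [InnerProductSpace.toDual_apply_apply, real_inner_comm, integral_inner hI2, mollify_apply,
      ← integral_indicator ho.measurableSet]
    congr 1
    refine integral_congr_ae (Eventually.of_forall fun z => ?_)
    by_cases hz : z ∈ Ω <;> simp [hz]
  rw [e1, e2, key, neg_neg]

end Mollify

/-! ### `W^{2,∞}` functions as Whitney jets -/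

/-- `(f, G)` is a first-order Whitney jet on `E`: `f` has the gradient `G`, which is Lipschitz. -/
structure IsJet (E : Set Plane) (f : Plane → ℝ) (G : Plane → Plane) (L : ℝ) : Prop where
  taylor : ∀ x ∈ E, ∀ y ∈ E, |f y - f x - inner ℝ (G x) (y - x)| ≤ L * dist x y ^ 2
  lipschitz : ∀ x ∈ E, ∀ y ∈ E, ‖G y - G x‖ ≤ L * dist x y

theorem norm_le_abs_add_abs (x : Plane) : ‖x‖ ≤ |x 0| + |x 1| := by
  rw [EuclideanSpace.norm_eq, Fin.sum_univ_two, Real.sqrt_le_left (by positivity)]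
  simp only [Real.norm_eq_abs]
  nlinarith [mul_nonneg (abs_nonneg (x 0)) (abs_nonneg (x 1))]

theorem abs_apply_le_norm (x : Plane) (i : Fin 2) : |x i| ≤ ‖x‖ := by
  simpa using PiLp.norm_apply_le x i

theorem semiNormW2Inf_nonneg (Ω : Set Plane) (D2 : Fin 2 → Plane → Plane) :
    0 ≤ semiNormW2Inf Ω D2 :=
  Real.iSup_nonneg fun _ => ENNReal.toReal_nonneg

theorem ae_norm_hess_le {Ω : Set Plane} {u : H1 Ω} {D2 : Fin 2 → Plane → Plane}
    (hu : IsW2Inf u D2) (i : Fin 2) :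
    ∀ᵐ x ∂volume.restrict Ω, ‖D2 i x‖ ≤ 2 * semiNormW2Inf Ω D2 := by
  have hcomp : ∀ j : Fin 2, ∀ᵐ x ∂volume.restrict Ω, |D2 i x j| ≤ semiNormW2Inf Ω D2 := by
    intro j
    have hfin : eLpNorm (fun x => D2 i x j) ∞ (volume.restrict Ω) ≠ ⊤ :=
      ((eLpNorm_mono (f := fun x => D2 i x j) fun x => by
        simpa using abs_apply_le_norm (D2 i x) j).trans_lt (hu.memLp_hess i).2).ne
    have hle : (eLpNorm (fun x => D2 i x j) ∞ (volume.restrict Ω)).toReal ≤ semiNormW2Inf Ω D2 :=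
      le_ciSup (f := fun p : Fin 2 × Fin 2 =>
        (eLpNorm (fun x => D2 p.1 x p.2) ∞ (volume.restrict Ω)).toReal)
        (Set.finite_range _).bddAbove (i, j)
    filter_upwards [ae_le_eLpNormEssSup (f := fun x => D2 i x j) (μ := volume.restrict Ω)]
      with x hx
    refine le_trans ?_ hle
    rw [← eLpNorm_exponent_top] at hx
    have := ENNReal.toReal_mono hfin hx
    simpa using this
  filter_upwards [hcomp 0, hcomp 1] with x h0 h1
  -- The seminorm bounds single entries, so a row of the Hessian, having two of them, costs a factor
  -- 2.
  linarith [norm_le_abs_add_abs (D2 i x)]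

theorem mollify_apply_coord (n : ℕ) {w : Plane → Plane} (hw : LocallyIntegrable w) (x : Plane)
    (i : Fin 2) : mollify n w x i = mollify n (fun z => w z i) x := by
  rw [mollify_apply, mollify_apply]
  have hInt : Integrable fun z => mollifier n (x - z) • w z := by
    have h1 := (((hasCompactSupport_mollifier n).convolutionExists_left
      (ContinuousLinearMap.lsmul ℝ ℝ : ℝ →L[ℝ] Plane →L[ℝ] Plane)
      (contDiff_mollifier n).continuous hw) x).integrable.comp_sub_left x
    simpa using h1
  have := (EuclideanSpace.proj (𝕜 := ℝ) i).integral_comp_comm hInt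
  simpa using this.symm

/-- Uniformity over a compact set lets one index `n` serve a whole segment. -/
theorem eventually_closedBall_rOut_subset {Ω : Set Plane} (ho : IsOpen Ω)
    {S : Set Plane} (hS : IsCompact S) (hSΩ : S ⊆ Ω) :
    ∀ᶠ n in atTop, ∀ x ∈ S, Metric.closedBall x (bumpSeq n).rOut ⊆ Ω := by
  obtain ⟨δ, hδ, hsub⟩ := hS.exists_cthickening_subset_open ho hSΩ
  filter_upwards [tendsto_bumpSeq_rOut.eventually_lt_const hδ] with n hn x hx
  exact ((Metric.closedBall_subset_closedBall hn.le).trans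
    (Metric.closedBall_subset_cthickening hx δ)).trans hsub

/-- A function in `W^{2,∞}(Ω)` has a gradient which is Lipschitz along all segments in `Ω`. -/
theorem exists_gradient_segment {Ω : Set Plane} (ho : IsOpen Ω) (hb : Bornology.IsBounded Ω)
    {u : H1 Ω} {D2 : Fin 2 → Plane → Plane} (hu : IsW2Inf u D2) :
    ∃ G : Plane → Plane, (∀ᵐ x ∂volume.restrict Ω, u.grad x = G x) ∧
      ∀ a b, segment ℝ a b ⊆ Ω → ‖G b - G a‖ ≤ 4 * semiNormW2Inf Ω D2 * dist a b ∧
        |u b - u a - inner ℝ (G a) (b - a)| ≤ 4 * semiNormW2Inf Ω D2 * dist a b ^ 2 := by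
  set M := semiNormW2Inf Ω D2 with hMdef
  have hM0 : 0 ≤ M := semiNormW2Inf_nonneg Ω D2
  have hfin : IsFiniteMeasure (volume.restrict Ω) :=
    ⟨by simpa using hb.measure_lt_top⟩
  have hui : IntegrableOn u Ω := u.memLp.integrable (by norm_num)
  have hgi : IntegrableOn u.grad Ω := u.memLp_grad.integrable (by norm_num)
  have hgi0 : LocallyIntegrable (Ω.indicator u.grad) :=
    ((integrable_indicator_iff ho.measurableSet).2 hgi).locallyIntegrable
  have hgci : ∀ i, IntegrableOn (fun x => u.grad x i) Ω := fun i =>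
    (EuclideanSpace.proj (𝕜 := ℝ) i).integrable_comp hgi
  have hHi : ∀ i, ∀ᵐ z, ‖Ω.indicator (D2 i) z‖ ≤ 2 * M := by
    intro i
    have := (ae_restrict_iff' ho.measurableSet).1 (ae_norm_hess_le hu i)
    filter_upwards [this] with z hz
    by_cases h : z ∈ Ω
    · simpa [h] using hz h
    · simp [h, hM0]
  set g : ℕ → Plane → Plane := fun n => mollify n (Ω.indicator u.grad) with hg
  have hgcoord : ∀ n x i, g n x i = mollify n (Ω.indicator fun x => u.grad x i) x := by
    intro n x i
    rw [hg, mollify_apply_coord n hgi0]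
    congr 1
    ext z
    by_cases h : z ∈ Ω <;> simp [h]
  -- the mollified gradients are uniformly Lipschitz along segments
  have hLip : ∀ a b, segment ℝ a b ⊆ Ω → ∀ᶠ n in atTop, ∀ x ∈ segment ℝ a b,
      ∀ y ∈ segment ℝ a b, ‖g n y - g n x‖ ≤ 4 * M * ‖y - x‖ := by
    intro a b hab
    have hcpt : IsCompact (segment ℝ a b) := by
      rw [← convexHull_pair]; exact (Set.toFinite _).isCompact_convexHull ℝ
    filter_upwards [eventually_closedBall_rOut_subset ho hcpt hab] with n hn x hx y hy
    have hc : ∀ i, |(g n y - g n x) i| ≤ 2 * M * ‖y - x‖ := by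
      intro i
      have := Convex.norm_image_sub_le_of_norm_hasFDerivWithin_le (𝕜 := ℝ)
        (f := mollify n (Ω.indicator fun x => u.grad x i)) (C := 2 * M)
        (fun z hz => (hasGradientAt_iff_hasFDerivAt.1 (hasGradientAt_mollify ho
          (hu.isWeakGradient i) (hgci i) n (hn z hz))).hasFDerivWithinAt)
        (fun z hz => by
          rw [LinearIsometryEquiv.norm_map]
          exact norm_mollify_le n (hHi i) z) (convex_segment a b) hx hy
      rw [Real.norm_eq_abs, ← hgcoord, ← hgcoord] at this
      simpa using this
    linarith [norm_le_abs_add_abs (g n y - g n x), hc 0, hc 1]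
  have hcpt : ∀ a b : Plane, IsCompact (segment ℝ a b) := fun a b => by
    rw [← convexHull_pair]; exact (Set.toFinite _).isCompact_convexHull ℝ
  -- This is the mean value inequality after subtracting the linear map with gradient `g n a`; along
  -- the segment the gradient deviates from it by at most `4 * M * ‖b - a‖`.
  have hTay : ∀ a b, segment ℝ a b ⊆ Ω → ∀ᶠ n in atTop,
      |mollify n (Ω.indicator u) b - mollify n (Ω.indicator u) a - inner ℝ (g n a) (b - a)|
        ≤ 4 * M * ‖b - a‖ ^ 2 := by
    intro a b hab
    filter_upwards [eventually_closedBall_rOut_subset ho (hcpt a b) hab,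
      hLip a b hab] with n hn hl
    have := Convex.norm_image_sub_le_of_norm_hasFDerivWithin_le' (𝕜 := ℝ)
      (f := mollify n (Ω.indicator u)) (C := 4 * M * ‖b - a‖)
      (φ := InnerProductSpace.toDual ℝ Plane (g n a))
      (fun z hz => (hasGradientAt_iff_hasFDerivAt.1 (hasGradientAt_mollify ho
        u.isWeakGradient hui n (hn z hz))).hasFDerivWithinAt)
      (fun z hz => by
        rw [← map_sub, LinearIsometryEquiv.norm_map]
        refine (hl a (left_mem_segment ℝ a b) z hz).trans ?_
        refine mul_le_mul_of_nonneg_left ?_ (by positivity)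
        obtain ⟨t, ht, rfl⟩ := (segment_eq_image' ℝ a b ▸ hz :)
        simp only [add_sub_cancel_left, norm_smul, Real.norm_eq_abs, abs_of_nonneg ht.1]
        exact mul_le_of_le_one_left (norm_nonneg _) ht.2)
      (convex_segment a b) (left_mem_segment ℝ a b) (right_mem_segment ℝ a b)
    rw [Real.norm_eq_abs, InnerProductSpace.toDual_apply_apply] at this
    linarith
  -- the mollified gradients converge everywhere
  have hae := ae_tendsto_mollify hgi0
  have hdense := Measure.dense_of_ae hae
  have hconv : ∀ x ∈ Ω, ∃ l, Tendsto (fun n => g n x) atTop (𝓝 l) := by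
    intro x hx
    refine cauchySeq_tendsto_of_complete (Metric.cauchySeq_iff.2 fun ε hε => ?_)
    obtain ⟨ρ, hρ, hsub⟩ := Metric.isOpen_iff.1 ho x hx
    -- The values at `x` are compared with those at a nearby point `y` where convergence is known.
    -- With this radius the Lipschitz drift between them is at most `ε / 4`; the `+ 1` covers `M =
    -- 0`.
    set η := min ρ (ε / (4 * (4 * M + 1))) with hη
    have hη0 : 0 < η := lt_min hρ (by positivity)
    obtain ⟨y, hy, hyS⟩ := hdense.exists_dist_lt x hη0
    have hyS' : dist x y < η := hyS
    have hyt : Tendsto (fun n => g n y) atTop (𝓝 (Ω.indicator u.grad y)) := hy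
    have hseg : segment ℝ x y ⊆ Ω := ((convex_ball x ρ).segment_subset (Metric.mem_ball_self hρ)
      (by rw [Metric.mem_ball, dist_comm]; exact hyS'.trans_le (min_le_left _ _))).trans hsub
    obtain ⟨N₁, hN₁⟩ := Metric.cauchySeq_iff.1 hyt.cauchySeq (ε / 2) (half_pos hε)
    obtain ⟨N₂, hN₂⟩ := eventually_atTop.1 (hLip x y hseg)
    have hsmall : 4 * M * ‖y - x‖ ≤ ε / 4 := by
      have h1 : ‖y - x‖ ≤ ε / (4 * (4 * M + 1)) := by
        rw [← dist_eq_norm, dist_comm]; exact hyS'.le.trans (min_le_right _ _)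
      calc 4 * M * ‖y - x‖ ≤ (4 * M + 1) * (ε / (4 * (4 * M + 1))) := by
            refine mul_le_mul (by linarith) h1 (norm_nonneg _) (by positivity)
        _ = ε / 4 := by field_simp
    have hclose : ∀ n ≥ N₂, dist (g n x) (g n y) ≤ ε / 4 := fun n hn => by
      rw [dist_comm, dist_eq_norm]
      exact (hN₂ n hn x (left_mem_segment ℝ x y) y (right_mem_segment ℝ x y)).trans hsmall
    refine ⟨max N₁ N₂, fun m hm n hn => ?_⟩
    have h1 := hclose m (le_of_max_le_right hm)
    have h2 := hclose n (le_of_max_le_right hn)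
    have h3 := hN₁ m (le_of_max_le_left hm) n (le_of_max_le_left hn)
    have h4 := dist_triangle4_right (g m x) (g n x) (g m y) (g n y)
    linarith
  choose! G hG using hconv
  refine ⟨G, ?_, fun a b hab => ?_⟩
  · rw [ae_restrict_iff' ho.measurableSet]
    filter_upwards [hae] with x hx hxΩ
    have h1 : Tendsto (fun n => g n x) atTop (𝓝 (u.grad x)) := by simpa [hxΩ] using hx
    exact tendsto_nhds_unique h1 (hG x hxΩ)
  · have ha : a ∈ Ω := hab (left_mem_segment ℝ a b)
    have hb' : b ∈ Ω := hab (right_mem_segment ℝ a b)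
    have hut : ∀ x ∈ Ω, Tendsto (fun n => mollify n (Ω.indicator u) x) atTop (𝓝 (u x)) := by
      intro x hx
      have hcx : ContinuousAt (Ω.indicator u) x := by
        have h1 : ContinuousAt u x := (hu.continuousOn.mono subset_closure).continuousAt
          (ho.mem_nhds hx)
        refine h1.congr ?_
        filter_upwards [ho.mem_nhds hx] with y hy
        simp [hy]
      have := tendsto_mollify_of_continuousAt
        ((integrable_indicator_iff ho.measurableSet).2 hui).aestronglyMeasurable hcx
      simpa [hx] using this
    constructor
    · refine le_of_tendsto ((hG b hb').sub (hG a ha)).norm ?_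
      filter_upwards [hLip a b hab] with n hn
      rw [dist_comm, dist_eq_norm]
      exact hn a (left_mem_segment ℝ a b) b (right_mem_segment ℝ a b)
    · refine le_of_tendsto ((((hut b hb').sub (hut a ha)).sub
        ((hG a ha).inner tendsto_const_nhds)).abs) ?_
      filter_upwards [hTay a b hab] with n hn
      rw [dist_comm, dist_eq_norm]
      exact hn

/-- Adding an edge of length `d` to a path of length `ℓ` adds the remainder on that edge and the
change of base point, `⟨G y - G x, z - y⟩`, which is at most `L * ℓ * d`. The total stays below `L *
(ℓ + d) ^ 2`. -/
theorem PolyPath.taylor {S : Set Plane} {f : Plane → ℝ} {G : Plane → Plane} {L : ℝ} (hL : 0 ≤ L)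
    (hseg : ∀ a b, segment ℝ a b ⊆ S → ‖G b - G a‖ ≤ L * dist a b ∧
        |f b - f a - inner ℝ (G a) (b - a)| ≤ L * dist a b ^ 2) {x y : Plane} {ℓ : ℝ}
    (h : PolyPath S x y ℓ) :
    ‖G y - G x‖ ≤ L * ℓ ∧ |f y - f x - inner ℝ (G x) (y - x)| ≤ L * ℓ ^ 2 := by
  induction h with
  | refl => simp
  | @step y z ℓ hp hs ih =>
    obtain ⟨h1, h2⟩ := hseg y z hs
    have hℓ := hp.nonneg
    constructor
    · have : G z - G x = (G z - G y) + (G y - G x) := by abel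
      rw [this]
      refine (norm_add_le _ _).trans ?_
      linarith [ih.1]
    · have e : f z - f x - inner ℝ (G x) (z - x) = (f z - f y - inner ℝ (G y) (z - y)) +
          (f y - f x - inner ℝ (G x) (y - x)) + inner ℝ (G y - G x) (z - y) := by
        have : z - x = (z - y) + (y - x) := by abel
        rw [this, inner_add_right, inner_sub_left]; ring
      have h3 : |inner ℝ (G y - G x) (z - y)| ≤ L * ℓ * dist y z := by
        refine (abs_real_inner_le_norm _ _).trans ?_
        rw [← dist_eq_norm z y, dist_comm z y]
        exact mul_le_mul_of_nonneg_right ih.1 dist_nonneg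
      rw [e]
      refine (abs_add_three _ _ _).trans ?_
      have h4 : 0 ≤ L * ℓ * dist y z := by positivity
      nlinarith [ih.2]

theorem IsJet.extend_closure {E : Set Plane} {f : Plane → ℝ} {G : Plane → Plane} {L : ℝ}
    (h : IsJet E f G L) (hf : ContinuousOn f (closure E)) (hG : Continuous G) :
    IsJet (closure E) f G L := by
  have hf1 : ContinuousOn (fun p : Plane × Plane => f p.1) (closure (E ×ˢ E)) := by
    rw [closure_prod_eq]
    exact hf.comp continuous_fst.continuousOn fun p hp => hp.1
  have hf2 : ContinuousOn (fun p : Plane × Plane => f p.2) (closure (E ×ˢ E)) := by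
    rw [closure_prod_eq]
    exact hf.comp continuous_snd.continuousOn fun p hp => hp.2
  constructor
  · intro x hx y hy
    refine le_on_closure (s := E ×ˢ E) (x := (x, y))
      (f := fun p : Plane × Plane => |f p.2 - f p.1 - inner ℝ (G p.1) (p.2 - p.1)|)
      (g := fun p : Plane × Plane => L * dist p.1 p.2 ^ 2)
      (fun p hp => h.taylor p.1 hp.1 p.2 hp.2) ?_ (by fun_prop) ?_
    · exact ((hf2.sub hf1).sub (by fun_prop)).abs
    · rw [closure_prod_eq]; exact ⟨hx, hy⟩
  · intro x hx y hy
    refine le_on_closure (s := E ×ˢ E) (x := (x, y))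
      (f := fun p : Plane × Plane => ‖G p.2 - G p.1‖)
      (g := fun p : Plane × Plane => L * dist p.1 p.2)
      (fun p hp => h.lipschitz p.1 hp.1 p.2 hp.2) (by fun_prop) (by fun_prop) ?_
    rw [closure_prod_eq]; exact ⟨hx, hy⟩

/-- A function in `W^{2,∞}(Ω)` is a Whitney jet on the closure of `Ω`. -/
theorem exists_isJet_of_isW2Inf {Ω : Set Plane} (hΩ : IsPolygonalDomain Ω) :
    ∃ C : ℝ, 0 < C ∧ ∀ (u : H1 Ω) (D2 : Fin 2 → Plane → Plane), IsW2Inf u D2 →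
      ∃ G : Plane → Plane, (∀ᵐ x ∂volume.restrict Ω, u.grad x = G x) ∧
        IsJet (closure Ω) u G (C * semiNormW2Inf Ω D2) := by
  obtain ⟨C, hC, hq⟩ := exists_quasiconvex hΩ
  -- Path lengths enter linearly in the gradient bound and quadratically in the Taylor bound, giving
  -- `4 * C` and `4 * C ^ 2`.
  refine ⟨4 * C + 4 * C ^ 2, by positivity, fun u D2 hu => ?_⟩
  obtain ⟨G, hGae, hG⟩ := exists_gradient_segment hΩ.isOpen hΩ.isBounded hu
  set M := semiNormW2Inf Ω D2
  have hM0 : 0 ≤ M := semiNormW2Inf_nonneg Ω D2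
  have hjet : IsJet Ω u G ((4 * C + 4 * C ^ 2) * M) := by
    constructor
    · intro x hx y hy
      obtain ⟨ℓ, hℓ, hp⟩ := hq x hx y hy
      have hℓ2 : ℓ ^ 2 ≤ (C * dist x y) ^ 2 := pow_le_pow_left₀ hp.nonneg hℓ 2
      calc _ ≤ 4 * M * ℓ ^ 2 := (hp.taylor (by positivity) hG).2
        _ ≤ 4 * M * (C * dist x y) ^ 2 := by gcongr
        _ = 4 * C ^ 2 * M * dist x y ^ 2 := by ring
        _ ≤ _ := by gcongr; linarith
    · intro x hx y hy
      obtain ⟨ℓ, hℓ, hp⟩ := hq x hx y hy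
      calc _ ≤ 4 * M * ℓ := (hp.taylor (by positivity) hG).1
        _ ≤ 4 * M * (C * dist x y) := by gcongr
        _ = 4 * C * M * dist x y := by ring
        _ ≤ _ := by gcongr; linarith [sq_nonneg C]
  have hLip : LipschitzOnWith (Real.toNNReal ((4 * C + 4 * C ^ 2) * M)) G Ω :=
    LipschitzOnWith.of_dist_le_mul fun x hx y hy => by
      rw [Real.coe_toNNReal _ (by positivity), dist_comm (G x), dist_eq_norm]
      exact hjet.lipschitz x hx y hy
  -- The extension supplies continuous boundary values of the gradient; the inequalities then pass
  -- to the closure by continuity.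
  obtain ⟨G', hG', heq⟩ := hLip.extend_finite_dimension
  refine ⟨G', ?_, IsJet.extend_closure ?_ hu.continuousOn hG'.continuous⟩
  · rw [ae_restrict_iff' hΩ.isOpen.measurableSet] at hGae ⊢
    filter_upwards [hGae] with x hx hxΩ
    rw [hx hxΩ, heq hxΩ]
  · constructor
    · intro x hx y hy
      rw [← heq hx]; exact hjet.taylor x hx y hy
    · intro x hx y hy
      rw [← heq hx, ← heq hy]; exact hjet.lipschitz x hx y hy

/-! ### Lipschitz functions in `H¹` and `H¹₀` -/

theorem norm_gradient_le_of_lipschitz {v : Plane → ℝ} {K : ℝ≥0} (hv : LipschitzWith K v)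
    (x : Plane) : ‖gradient v x‖ ≤ K := by
  rw [gradient, LinearIsometryEquiv.norm_map]
  exact norm_fderiv_le_of_lipschitz ℝ hv

theorem stronglyMeasurable_gradient (v : Plane → ℝ) : StronglyMeasurable (gradient v) := by
  have h : Measurable (fderiv ℝ v) := measurable_fderiv ℝ v
  exact ((InnerProductSpace.toDual ℝ Plane).symm.continuous.measurable.comp h).stronglyMeasurable

theorem locallyIntegrable_gradient {v : Plane → ℝ} {K : ℝ≥0} (hv : LipschitzWith K v) :
    LocallyIntegrable (gradient v) :=
  (memLp_top_of_bound (stronglyMeasurable_gradient v).aestronglyMeasurable K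
    (Eventually.of_forall fun x => norm_gradient_le_of_lipschitz hv x)).locallyIntegrable le_top

theorem gradient_eq_zero_of_notMem_tsupport {φ : Plane → ℝ} {x : Plane} (hx : x ∉ tsupport φ) :
    gradient φ x = 0 := by
  have : fderiv ℝ φ x = 0 := by
    by_contra h
    exact hx (support_fderiv_subset ℝ h)
  simp [gradient, this]

/-- Test functions vanish outside `Ω`, so both integrals extend to the plane. Pairing with a fixed
vector reduces the identity to integration by parts for line derivatives, which agree with the
gradient almost everywhere by Rademacher's theorem. -/
theorem isWeakGradient_of_lipschitz (Ω : Set Plane) {v : Plane → ℝ} {K : ℝ≥0}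
    (hv : LipschitzWith K v) : IsWeakGradient Ω v (gradient v) where
  locallyIntegrableOn := hv.continuous.locallyIntegrable.locallyIntegrableOn Ω
  locallyIntegrableOn_grad := (locallyIntegrable_gradient hv).locallyIntegrableOn Ω
  integral_eq φ hφ := by
    have hφ' : IsTestFunction univ φ := ⟨hφ.contDiff, hφ.hasCompactSupport, subset_univ _⟩
    have hout : ∀ x, x ∉ Ω → φ x = 0 ∧ gradient φ x = 0 := fun x hx =>
      ⟨image_eq_zero_of_notMem_tsupport fun h => hx (hφ.tsupport_subset h),
        gradient_eq_zero_of_notMem_tsupport fun h => hx (hφ.tsupport_subset h)⟩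
    rw [setIntegral_eq_integral_of_forall_compl_eq_zero fun x hx => by simp [(hout x hx).2],
      setIntegral_eq_integral_of_forall_compl_eq_zero fun x hx => by simp [(hout x hx).1]]
    have hI1 : Integrable fun x => v x • gradient φ x := integrableOn_univ.1
      (integrableOn_smul_gradient (hv.continuous.locallyIntegrable.locallyIntegrableOn univ) hφ')
    have hI2 : Integrable fun x => φ x • gradient v x := integrableOn_univ.1
      (integrableOn_smul_of_isTestFunction
        ((locallyIntegrable_gradient hv).locallyIntegrableOn univ) hφ')
    refine ext_inner_left ℝ fun c => ?_
    rw [inner_neg_right, ← integral_inner hI1, ← integral_inner hI2]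
    obtain ⟨D, hD⟩ := ContDiff.lipschitzWith_of_hasCompactSupport hφ.hasCompactSupport
      hφ.contDiff (by simp)
    have key := hv.integral_lineDeriv_mul_eq (μ := volume) hD hφ.hasCompactSupport c
    have e1 : ∫ x, lineDeriv ℝ v x c * φ x = ∫ x, inner ℝ c (φ x • gradient v x) := by
      refine integral_congr_ae ?_
      filter_upwards [hv.ae_differentiableAt (μ := volume)] with x hx
      rw [hx.lineDeriv_eq_fderiv, inner_smul_right, real_inner_comm, inner_gradient_left, mul_comm]
    have e2 : ∫ x, lineDeriv ℝ φ x (-c) * v x = -∫ x, inner ℝ c (v x • gradient φ x) := by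
      rw [← integral_neg]
      refine integral_congr_ae (Eventually.of_forall fun x => ?_)
      simp only
      rw [(hφ.contDiff.differentiable (by simp) x).lineDeriv_eq_fderiv, inner_smul_right,
        real_inner_comm, inner_gradient_left, map_neg]
      ring
    rw [← e1, key, e2, neg_neg]

/-- The `H¹(Ω)` function given by a Lipschitz function. -/
noncomputable def H1.ofLipschitz {Ω : Set Plane} (ho : IsOpen Ω) (hb : Bornology.IsBounded Ω) {v : Plane → ℝ}
    {K : ℝ≥0} (hv : LipschitzWith K v) : H1 Ω where
  toFun := v
  grad := gradient v
  memLp := by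
    have hfin : IsFiniteMeasure (volume.restrict Ω) := ⟨by simpa using hb.measure_lt_top⟩
    obtain ⟨B, hB⟩ := (hb.isCompact_closure.image hv.continuous).isBounded.exists_norm_le
    refine (MemLp.of_bound (hv.continuous.aestronglyMeasurable.restrict) B ?_)
    exact ae_restrict_of_forall_mem ho.measurableSet fun x hx =>
      hB _ (mem_image_of_mem v (subset_closure hx))
  memLp_grad := by
    have hfin : IsFiniteMeasure (volume.restrict Ω) := ⟨by simpa using hb.measure_lt_top⟩
    exact MemLp.of_bound (stronglyMeasurable_gradient v).aestronglyMeasurable.restrict K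
      (Eventually.of_forall fun x => norm_gradient_le_of_lipschitz hv x)
  isWeakGradient := isWeakGradient_of_lipschitz Ω hv

theorem tendsto_eLpNorm_two_of_bounded {α F : Type*} [MeasurableSpace α] {μ : Measure α}
    [IsFiniteMeasure μ] [NormedAddCommGroup F] {f : ℕ → α → F} {g : α → F} {B : ℝ}
    (hf : ∀ n, AEStronglyMeasurable (f n) μ) (hg : AEStronglyMeasurable g μ)
    (hB : ∀ n, ∀ᵐ x ∂μ, ‖f n x - g x‖ ≤ B)
    (hlim : ∀ᵐ x ∂μ, Tendsto (fun n => f n x) atTop (𝓝 (g x))) :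
    Tendsto (fun n => eLpNorm (fun x => f n x - g x) 2 μ) atTop (𝓝 0) := by
  have h : Tendsto (fun n => ∫⁻ x, ‖f n x - g x‖ₑ ^ (2 : ℝ) ∂μ) atTop (𝓝 (∫⁻ _, 0 ∂μ)) := by
    refine tendsto_lintegral_of_dominated_convergence' (fun _ => ENNReal.ofReal B ^ (2 : ℝ))
      (fun n => ((hf n).sub hg).enorm.pow_const 2) (fun n => ?_) ?_ ?_
    · filter_upwards [hB n] with x hx
      gcongr
      rw [← ofReal_norm]
      exact ENNReal.ofReal_le_ofReal hx
    · simp [ENNReal.mul_eq_top, measure_ne_top]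
    · filter_upwards [hlim] with x hx
      have h1 : Tendsto (fun n => ‖f n x - g x‖ₑ) atTop (𝓝 0) := by
        have := (hx.sub_const (g x)).enorm
        simpa using this
      have := ((ENNReal.continuous_rpow_const (y := 2)).tendsto 0).comp h1
      simpa [Function.comp_def] using this
  have h2 := ((ENNReal.continuous_rpow_const (y := 1 / 2)).tendsto _).comp h
  simp only [lintegral_zero] at h2
  rw [ENNReal.zero_rpow_of_pos (by norm_num)] at h2
  refine h2.congr fun n => ?_
  rw [eLpNorm_eq_lintegral_rpow_enorm_toReal (by norm_num) (by norm_num)]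
  simp

/-- Soft thresholding. -/
noncomputable def softThreshold (δ t : ℝ) : ℝ := t - max (-δ) (min δ t)

/-- Not sharp; what matters is that the constant does not depend on `δ`. -/
theorem lipschitzWith_softThreshold (δ : ℝ) : LipschitzWith 2 (softThreshold δ) := by
  have h1 : LipschitzWith 1 fun t : ℝ => max (-δ) (min δ t) :=
    (LipschitzWith.id.const_min δ).const_max (-δ)
  have := LipschitzWith.id.sub h1
  rwa [one_add_one_eq_two] at this

theorem softThreshold_of_abs_le {δ t : ℝ} (h : |t| ≤ δ) : softThreshold δ t = 0 := by
  rw [abs_le] at h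
  simp [softThreshold, min_eq_right h.2, max_eq_right h.1]

theorem softThreshold_of_le {δ t : ℝ} (h0 : 0 ≤ δ) (h : δ ≤ t) : softThreshold δ t = t - δ := by
  simp [softThreshold, min_eq_left h, max_eq_right (neg_le_self h0)]

theorem softThreshold_of_le_neg {δ t : ℝ} (h0 : 0 ≤ δ) (h : t ≤ -δ) :
    softThreshold δ t = t + δ := by
  simp [softThreshold, min_eq_right (h.trans (neg_le_self h0)), max_eq_left h]

theorem abs_softThreshold_sub_le {δ : ℝ} (h0 : 0 ≤ δ) (t : ℝ) : |softThreshold δ t - t| ≤ δ := by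
  have h1 : softThreshold δ t - t = -max (-δ) (min δ t) := by simp [softThreshold]
  rw [h1, abs_neg, abs_le]
  exact ⟨le_max_left _ _, max_le (by linarith) (min_le_left _ _)⟩

/-- Mollifications of a compactly supported Lipschitz function are test functions which converge
in `H¹`. -/
theorem exists_testFunction_near {Ω : Set Plane} (ho : IsOpen Ω) (hb : Bornology.IsBounded Ω)
    {w : Plane → ℝ} {K : ℝ≥0} (hw : LipschitzWith K w) (hc : HasCompactSupport w)
    (hs : tsupport w ⊆ Ω) {ε : ℝ≥0∞} (hε : 0 < ε) :
    ∃ φ, IsTestFunction Ω φ ∧ eLpNorm (fun x => φ x - w x) 2 (volume.restrict Ω) ≤ ε ∧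
      eLpNorm (fun x => gradient φ x - gradient w x) 2 (volume.restrict Ω) ≤ ε := by
  have hfin : IsFiniteMeasure (volume.restrict Ω) := ⟨by simpa using hb.measure_lt_top⟩
  have hwi : Integrable w := hw.continuous.integrable_of_hasCompactSupport hc
  obtain ⟨B, hB⟩ := hc.exists_bound_of_continuous hw.continuous
  have hgrad : ∀ n, gradient (mollify n w) = mollify n (gradient w) := fun n => by
    ext1 x
    have := hasGradientAt_mollify isOpen_univ (isWeakGradient_of_lipschitz univ hw)
      (integrableOn_univ.2 hwi) n (x := x) (subset_univ _)
    simpa using this.gradient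
  have hB' : ∀ n x, ‖mollify n w x‖ ≤ B := fun n x =>
    norm_mollify_le n (Eventually.of_forall hB) x
  have hG' : ∀ n x, ‖mollify n (gradient w) x‖ ≤ K := fun n x =>
    norm_mollify_le n (Eventually.of_forall fun z => norm_gradient_le_of_lipschitz hw z) x
  have l1 : Tendsto (fun n => eLpNorm (fun x => mollify n w x - w x) 2 (volume.restrict Ω))
      atTop (𝓝 0) := by
    refine tendsto_eLpNorm_two_of_bounded (B := B + B)
      (fun n => (contDiff_mollify n hwi.locallyIntegrable).continuous.aestronglyMeasurable)
      hw.continuous.aestronglyMeasurable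
      (fun n => Eventually.of_forall fun x => (norm_sub_le _ _).trans
        (add_le_add (hB' n x) (hB x))) (ae_restrict_of_ae (ae_tendsto_mollify hwi.locallyIntegrable))
  have l2 : Tendsto (fun n => eLpNorm (fun x => mollify n (gradient w) x - gradient w x) 2
      (volume.restrict Ω)) atTop (𝓝 0) := by
    refine tendsto_eLpNorm_two_of_bounded (B := K + K)
      (fun n => (contDiff_mollify n
        (locallyIntegrable_gradient hw)).continuous.aestronglyMeasurable)
      (stronglyMeasurable_gradient w).aestronglyMeasurable
      (fun n => Eventually.of_forall fun x => (norm_sub_le _ _).trans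
        (add_le_add (hG' n x) (norm_gradient_le_of_lipschitz hw x)))
      (ae_restrict_of_ae (ae_tendsto_mollify (locallyIntegrable_gradient hw)))
  -- Mollification enlarges the support by at most the outer radius of the bump, so for late indices
  -- it stays inside this thickening.
  obtain ⟨δ, hδ, hsub⟩ := hc.isCompact.exists_cthickening_subset_open ho hs
  obtain ⟨n, h1, h2, h3⟩ := ((l1.eventually_le_const hε).and ((l2.eventually_le_const hε).and
    (tendsto_bumpSeq_rOut.eventually_lt_const hδ))).exists
  refine ⟨mollify n w, ?_, h1, by rwa [hgrad]⟩
  have hsupp : Function.support (mollify n w) ⊆ Metric.cthickening δ (tsupport w) := by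
    intro x hx
    by_contra hxn
    apply hx
    rw [mollify_apply]
    refine integral_eq_zero_of_ae (Eventually.of_forall fun z => ?_)
    by_cases hz : z ∈ tsupport w
    · have : mollifier n (x - z) = 0 := by
        by_contra h0
        have h4 : x - z ∈ Function.support ((bumpSeq n).normed volume) := h0
        rw [(bumpSeq n).support_normed_eq, mem_ball_zero_iff, ← dist_eq_norm] at h4
        exact hxn (Metric.mem_cthickening_of_dist_le x z δ _ hz (h4.le.trans h3.le))
      simp [this]
    · simp [image_eq_zero_of_notMem_tsupport hz]
  have hts : tsupport (mollify n w) ⊆ Metric.cthickening δ (tsupport w) :=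
    closure_minimal hsupp Metric.isClosed_cthickening
  exact ⟨contDiff_mollify n hwi.locallyIntegrable,
    HasCompactSupport.of_support_subset_isCompact hc.isCompact.cthickening hsupp, hts.trans hsub⟩

/-- A Lipschitz function which vanishes outside `Ω` belongs to `H¹₀(Ω)`. -/
theorem isH10_of_lipschitz {Ω : Set Plane} (ho : IsOpen Ω) (hb : Bornology.IsBounded Ω)
    (v : H1 Ω) {w : Plane → ℝ} {K : ℝ≥0} (hw : LipschitzWith K w) (hw0 : ∀ x, x ∉ Ω → w x = 0)
    (hvw : ∀ x ∈ Ω, v x = w x) (hgrad : ∀ x ∈ Ω, v.grad x = gradient w x)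
    (hz : ∀ᵐ x ∂volume.restrict Ω, w x = 0 → gradient w x = 0) : IsH10 v := by
  have hfin : IsFiniteMeasure (volume.restrict Ω) := ⟨by simpa using hb.measure_lt_top⟩
  set δ : ℕ → ℝ := fun k => 1 / ((k : ℝ) + 1) with hδ
  have hδ0 : ∀ k, 0 < δ k := fun k => by positivity
  have hδt : Tendsto δ atTop (𝓝 0) := tendsto_one_div_add_atTop_nhds_zero_nat
  -- The support of `W k` lies in `{δ k ≤ |w|}`, a closed set contained in the bounded set `Ω`. So
  -- `W k` has compact support in `Ω` and can be mollified.
  set W : ℕ → Plane → ℝ := fun k x => softThreshold (δ k) (w x) with hW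
  have hWlip : ∀ k, LipschitzWith (2 * K) (W k) := fun k =>
    (lipschitzWith_softThreshold (δ k)).comp hw
  have hWts : ∀ k, tsupport (W k) ⊆ {x | δ k ≤ |w x|} := fun k => by
    refine closure_minimal (fun x hx => ?_) (isClosed_le continuous_const hw.continuous.abs)
    by_contra h
    exact hx (softThreshold_of_abs_le (not_le.1 h).le)
  have hWsub : ∀ k, tsupport (W k) ⊆ Ω := fun k x hx => by
    by_contra hxΩ
    have := hWts k hx
    simp only [mem_ofPred_eq, hw0 x hxΩ, abs_zero] at this
    exact absurd this (not_le.2 (hδ0 k))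
  have hWc : ∀ k, HasCompactSupport (W k) := fun k =>
    Metric.isCompact_of_isClosed_isBounded (isClosed_tsupport _) (hb.subset (hWsub k))
  have hex : ∀ k : ℕ, ∃ φ, IsTestFunction Ω φ ∧
      eLpNorm (fun x => φ x - W k x) 2 (volume.restrict Ω) ≤ ENNReal.ofReal (δ k) ∧
      eLpNorm (fun x => gradient φ x - gradient (W k) x) 2 (volume.restrict Ω)
        ≤ ENNReal.ofReal (δ k) := fun k =>
    exists_testFunction_near ho hb (hWlip k) (hWc k) (hWsub k) (ENNReal.ofReal_pos.2 (hδ0 k))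
  choose φ hφ hφ1 hφ2 using hex
  have hδe : Tendsto (fun k => ENNReal.ofReal (δ k)) atTop (𝓝 0) := by
    simpa using ENNReal.tendsto_ofReal hδt
  have hδ1 : ∀ k, δ k ≤ 1 := fun k => by
    rw [hδ]; simp only
    rw [div_le_one (by positivity)]
    have : (0 : ℝ) ≤ k := Nat.cast_nonneg k
    linarith
  have l1 : Tendsto (fun k => eLpNorm (fun x => W k x - w x) 2 (volume.restrict Ω))
      atTop (𝓝 0) := by
    refine tendsto_eLpNorm_two_of_bounded (B := 1)
      (fun k => (hWlip k).continuous.aestronglyMeasurable) hw.continuous.aestronglyMeasurable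
      (fun k => Eventually.of_forall fun x =>
        (abs_softThreshold_sub_le (hδ0 k).le (w x)).trans (hδ1 k))
      (Eventually.of_forall fun x => ?_)
    rw [tendsto_iff_norm_sub_tendsto_zero]
    exact squeeze_zero (fun k => norm_nonneg _)
      (fun k => abs_softThreshold_sub_le (hδ0 k).le (w x)) hδt
  have l2 : Tendsto (fun k => eLpNorm (fun x => gradient (W k) x - gradient w x) 2
      (volume.restrict Ω)) atTop (𝓝 0) := by
    refine tendsto_eLpNorm_two_of_bounded (B := (2 * K : ℝ≥0) + K)
      (fun k => (stronglyMeasurable_gradient _).aestronglyMeasurable)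
      (stronglyMeasurable_gradient w).aestronglyMeasurable
      (fun k => Eventually.of_forall fun x => (norm_sub_le _ _).trans
        (add_le_add (norm_gradient_le_of_lipschitz (hWlip k) x)
          (norm_gradient_le_of_lipschitz hw x))) ?_
    -- Where `w x ≠ 0`, thresholding is eventually a translation near `x` and keeps the gradient.
    -- Where `w x = 0`, the thresholded gradient is zero, and so is that of `w` by `hz`.
    filter_upwards [hz] with x hx
    refine tendsto_const_nhds.congr' ?_
    rcases lt_trichotomy (w x) 0 with h | h | h
    · filter_upwards [hδt.eventually_lt_const (neg_pos.2 h)] with k hk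
      have : W k =ᶠ[𝓝 x] fun y => w y + δ k := by
        filter_upwards [hw.continuous.continuousAt.eventually_lt_const
          (show w x < -δ k by linarith)] with y hy
        exact softThreshold_of_le_neg (hδ0 k).le hy.le
      rw [gradient, gradient, this.fderiv_eq, fderiv_add_const]
    · rw [hx h]
      filter_upwards with k
      refine (gradient_eq_zero_of_notMem_tsupport fun hxs => ?_).symm
      have := hWts k hxs
      simp only [mem_ofPred_eq, h, abs_zero] at this
      exact absurd this (not_le.2 (hδ0 k))
    · filter_upwards [hδt.eventually_lt_const h] with k hk
      have : W k =ᶠ[𝓝 x] fun y => w y - δ k := by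
        filter_upwards [hw.continuous.continuousAt.eventually_const_lt hk] with y hy
        exact softThreshold_of_le (hδ0 k).le hy.le
      rw [gradient, gradient, this.fderiv_eq, fderiv_sub_const]
  have hcongr1 : ∀ k, eLpNorm (fun x => φ k x - v x) 2 (volume.restrict Ω) ≤
      ENNReal.ofReal (δ k) + eLpNorm (fun x => W k x - w x) 2 (volume.restrict Ω) := fun k => by
    have e : eLpNorm (fun x => φ k x - v x) 2 (volume.restrict Ω) =
        eLpNorm ((fun x => φ k x - W k x) + fun x => W k x - w x) 2 (volume.restrict Ω) :=
      eLpNorm_congr_ae (ae_restrict_of_forall_mem ho.measurableSet fun x hx => by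
        simp [hvw x hx])
    rw [e]
    refine (eLpNorm_add_le ?_ ?_ (by norm_num)).trans (by gcongr; exact hφ1 k)
    · exact ((hφ k).contDiff.continuous.sub (hWlip k).continuous).aestronglyMeasurable
    · exact ((hWlip k).continuous.sub hw.continuous).aestronglyMeasurable
  have hcongr2 : ∀ k, eLpNorm (fun x => gradient (φ k) x - v.grad x) 2 (volume.restrict Ω) ≤
      ENNReal.ofReal (δ k) +
        eLpNorm (fun x => gradient (W k) x - gradient w x) 2 (volume.restrict Ω) := fun k => by
    have e : eLpNorm (fun x => gradient (φ k) x - v.grad x) 2 (volume.restrict Ω) =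
        eLpNorm ((fun x => gradient (φ k) x - gradient (W k) x) +
          fun x => gradient (W k) x - gradient w x) 2 (volume.restrict Ω) :=
      eLpNorm_congr_ae (ae_restrict_of_forall_mem ho.measurableSet fun x hx => by
        simp [hgrad x hx])
    rw [e]
    refine (eLpNorm_add_le ?_ ?_ (by norm_num)).trans (by gcongr; exact hφ2 k)
    · exact ((stronglyMeasurable_gradient _).sub
        (stronglyMeasurable_gradient _)).aestronglyMeasurable
    · exact ((stronglyMeasurable_gradient _).sub
        (stronglyMeasurable_gradient _)).aestronglyMeasurable
  refine ⟨φ, hφ, ?_, ?_⟩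
  · refine tendsto_of_tendsto_of_tendsto_of_le_of_le tendsto_const_nhds ?_
      (fun _ => zero_le) hcongr1
    simpa using hδe.add l1
  · refine tendsto_of_tendsto_of_tendsto_of_le_of_le tendsto_const_nhds ?_
      (fun _ => zero_le) hcongr2
    simpa using hδe.add l2

theorem exists_mem_segment_frontier {Ω : Set Plane} {x y : Plane} (hx : x ∈ Ω) (hy : y ∉ Ω) :
    ∃ z ∈ segment ℝ x y, z ∈ frontier Ω := by
  by_contra! h
  rcases IsPreconnected.subset_or_subset (s := segment ℝ x y) isOpen_interior
    isClosed_closure.isOpen_compl (disjoint_compl_right.mono_left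
      (interior_subset.trans (subset_closure (s := Ω)))) (fun z hz => by
        by_cases hzi : z ∈ interior Ω
        · exact Or.inl hzi
        · exact Or.inr fun hzc => h z hz ⟨hzc, hzi⟩) (convex_segment x y).isPreconnected with h1 | h1
  · exact hy (interior_subset (h1 (right_mem_segment ℝ x y)))
  · exact h1 (left_mem_segment ℝ x y) (subset_closure hx)

/-- Cutting off a Lipschitz function which vanishes on the boundary leaves it Lipschitz. -/
theorem lipschitzWith_indicator {Ω : Set Plane} {v : Plane → ℝ} {K : ℝ≥0}
    (hv : LipschitzWith K v) (h0 : ∀ x ∈ frontier Ω, v x = 0) :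
    LipschitzWith K (Ω.indicator v) := by
  have hmix : ∀ x ∈ Ω, ∀ y, y ∉ Ω → |v x| ≤ K * dist x y := by
    intro x hx y hy
    obtain ⟨z, hz, hzf⟩ := exists_mem_segment_frontier hx hy
    have h1 := hv.dist_le_mul x z
    rw [Real.dist_eq, h0 z hzf, sub_zero] at h1
    refine h1.trans (mul_le_mul_of_nonneg_left ?_ K.2)
    have := dist_add_dist_of_mem_segment hz
    linarith [dist_nonneg (x := z) (y := y)]
  refine LipschitzWith.of_dist_le_mul fun x y => ?_
  by_cases hx : x ∈ Ω <;> by_cases hy : y ∈ Ω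
  · simpa [hx, hy] using hv.dist_le_mul x y
  · simpa [hx, hy, Real.dist_eq] using hmix x hx y hy
  · rw [dist_comm x y]; simpa [hx, hy, Real.dist_eq] using hmix y hy x hx
  · simp [hx, hy]; positivity

/-! ### Barycentric coordinates and nodal interpolation -/

/-- The gradient of an affine function. -/
noncomputable def affGrad (A : Plane →ᵃ[ℝ] ℝ) : Plane :=
  (InnerProductSpace.toDual ℝ Plane).symm (LinearMap.toContinuousLinearMap A.linear)

theorem affine_sub_eq (A : Plane →ᵃ[ℝ] ℝ) (x y : Plane) :
    A y - A x = inner ℝ (affGrad A) (y - x) := by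
  rw [affGrad, InnerProductSpace.toDual_symm_apply]
  simpa using (A.linearMap_vsub y x).symm

theorem continuous_affine (A : Plane →ᵃ[ℝ] ℝ) : Continuous A :=
  A.continuous_of_finiteDimensional

theorem hasGradientAt_affine (A : Plane →ᵃ[ℝ] ℝ) (x : Plane) : HasGradientAt A (affGrad A) x := by
  rw [hasGradientAt_iff_hasFDerivAt]
  have h : (A : Plane → ℝ) = fun y => A 0 + InnerProductSpace.toDual ℝ Plane (affGrad A) y := by
    ext y
    have := affine_sub_eq A 0 y
    rw [sub_zero] at this
    rw [InnerProductSpace.toDual_apply_apply, ← this]; ring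
  rw [h]
  exact (ContinuousLinearMap.hasFDerivAt _).const_add _

theorem affine_eqOn_convexHull {A B : Plane →ᵃ[ℝ] ℝ} {s : Set Plane} (h : ∀ p ∈ s, A p = B p)
    {x : Plane} (hx : x ∈ convexHull ℝ s) : A x = B x := by
  have hconv : Convex ℝ {y | A y = B y} := by
    have : {y | A y = B y} = (fun y => (A - B) y) ⁻¹' {0} := by
      ext y; simp [sub_eq_zero]
    rw [this]
    exact (convex_singleton (0 : ℝ)).affine_preimage (A - B)
  exact convexHull_min (t := {y | A y = B y}) h hconv hx

/-- `K` is the vertex set of a nondegenerate triangle. -/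
def IsTriangle (K : Finset Plane) : Prop :=
  AffineIndependent ℝ ((↑) : K → Plane) ∧ K.card = 3

/-- The vertices of a triangle as an affine basis of the plane. -/
noncomputable def IsTriangle.basis {K : Finset Plane} (hK : IsTriangle K) :
    AffineBasis K ℝ Plane where
  toFun := (↑)
  ind' := hK.1
  tot' := by
    rw [hK.1.affineSpan_eq_top_iff_card_eq_finrank_add_one]
    simp [hK.2]

open Classical in
/-- The barycentric coordinate of the vertex `p` in the triangle `K`. -/
noncomputable def bary (K : Finset Plane) (p : Plane) : Plane →ᵃ[ℝ] ℝ :=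
  if h : IsTriangle K ∧ p ∈ K then h.1.basis.coord ⟨p, h.2⟩ else 0

namespace IsTriangle

theorem bary_eq {K : Finset Plane} (hK : IsTriangle K)
    {p : Plane} (hp : p ∈ K) : bary K p = hK.basis.coord ⟨p, hp⟩ := by
  rw [bary, dif_pos ⟨hK, hp⟩]

theorem bary_self {K : Finset Plane} (hK : IsTriangle K)
    {p : Plane} (hp : p ∈ K) : bary K p p = 1 := by
  rw [hK.bary_eq hp]
  exact hK.basis.coord_apply_eq ⟨p, hp⟩

theorem bary_ne {K : Finset Plane} (hK : IsTriangle K)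
    {p q : Plane} (hp : p ∈ K) (hq : q ∈ K) (hpq : p ≠ q) : bary K p q = 0 := by
  rw [hK.bary_eq hp]
  exact hK.basis.coord_apply_ne (i := ⟨p, hp⟩) (j := ⟨q, hq⟩) fun h => hpq (congrArg Subtype.val h)

theorem sum_bary {K : Finset Plane} (hK : IsTriangle K) (x : Plane) : ∑ p ∈ K, bary K p x = 1 := by
  rw [← Finset.sum_coe_sort, ← hK.basis.sum_coord_apply_eq_one x]
  exact Finset.sum_congr rfl fun p _ => by rw [hK.bary_eq p.2]

theorem sum_bary_smul {K : Finset Plane} (hK : IsTriangle K)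
    (x : Plane) : ∑ p ∈ K, bary K p x • p = x := by
  rw [← Finset.sum_coe_sort]
  conv_rhs => rw [← hK.basis.linear_combination_coord_eq_self x]
  exact Finset.sum_congr rfl fun p _ => by rw [hK.bary_eq p.2]; rfl

theorem mem_tri_iff {K : Finset Plane} (hK : IsTriangle K)
    {x : Plane} : x ∈ tri K ↔ ∀ p ∈ K, 0 ≤ bary K p x := by
  have h : tri K = convexHull ℝ (Set.range hK.basis) := by
    rw [tri]; congr 1; ext p
    exact ⟨fun hp => ⟨⟨p, hp⟩, rfl⟩, fun ⟨q, hq⟩ => hq ▸ q.2⟩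
  rw [h, hK.basis.convexHull_eq_nonneg_coord]
  exact ⟨fun hx p hp => by rw [hK.bary_eq hp]; exact hx ⟨p, hp⟩,
    fun hx p => by rw [← hK.bary_eq p.2]; exact hx p p.2⟩

theorem affine_apply {K : Finset Plane} (hK : IsTriangle K)
    (A : Plane →ᵃ[ℝ] ℝ) (x : Plane) : A x = ∑ p ∈ K, bary K p x * A p := by
  have h : ∀ y, A y = A 0 + inner ℝ (affGrad A) y := fun y => by
    have := affine_sub_eq A 0 y
    rw [sub_zero] at this
    rw [← this]; ring
  have h1 : ∑ p ∈ K, bary K p x * A p =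
      (∑ p ∈ K, bary K p x) * A 0 + inner ℝ (affGrad A) (∑ p ∈ K, bary K p x • p) := by
    rw [inner_sum, Finset.sum_mul, ← Finset.sum_add_distrib]
    refine Finset.sum_congr rfl fun p _ => ?_
    rw [h p, inner_smul_right]; ring
  rw [h1, hK.sum_bary, hK.sum_bary_smul, one_mul, h x]

theorem exists_affine {K : Finset Plane} (hK : IsTriangle K)
    (v : Plane → ℝ) : ∃ A : Plane →ᵃ[ℝ] ℝ, ∀ p ∈ K, A p = v p := by
  refine ⟨∑ p ∈ K, v p • bary K p, fun q hq => ?_⟩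
  have h : ∀ s : Finset Plane, (∑ p ∈ s, v p • bary K p) q = ∑ p ∈ s, v p * bary K p q := by
    classical
    intro s
    induction s using Finset.induction_on with
    | empty => simp
    | insert a s ha ih => rw [Finset.sum_insert ha, Finset.sum_insert ha, ← ih]; simp
  rw [h, Finset.sum_eq_single q]
  · rw [hK.bary_self hq, mul_one]
  · intro p hp hpq
    rw [hK.bary_ne hp hq hpq, mul_zero]
  · exact fun h => absurd hq h

end IsTriangle

theorem isClosed_tri (K : Finset Plane) : IsClosed (tri K) :=
  (K.finite_toSet.isCompact_convexHull ℝ).isClosed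

theorem isTriangle_of_mem_elements {T : Geometry.SimplicialComplex ℝ Plane} {K : Finset Plane}
    (hK : K ∈ elements T) : IsTriangle K :=
  ⟨T.indep hK.1, hK.2⟩

theorem vertex_mem_tri {K : Finset Plane} {p : Plane} (hp : p ∈ K) : p ∈ tri K :=
  subset_convexHull ℝ _ hp

/-! ### Covering properties of triangulations -/

namespace IsTriangulation

theorem finite_elements {Ω : Set Plane}
    {T : Geometry.SimplicialComplex ℝ Plane} (hT : IsTriangulation Ω T) : (elements T).Finite :=
  hT.finite.subset fun _ hK => hK.1

theorem closure_eq {Ω : Set Plane}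
    {T : Geometry.SimplicialComplex ℝ Plane} (hT : IsTriangulation Ω T) :
    closure Ω = ⋃ K ∈ elements T, tri K := by
  rw [← hT.space_eq]
  ext x
  rw [Geometry.SimplicialComplex.mem_space_iff, mem_iUnion₂]
  constructor
  · rintro ⟨s, hs, hx⟩
    obtain ⟨t, ht, hst, hc⟩ := hT.pure s hs
    exact ⟨t, ⟨ht, hc⟩, convexHull_mono (Finset.coe_subset.2 hst) hx⟩
  · rintro ⟨K, hK, hx⟩
    exact ⟨K, hK.1, hx⟩

theorem tri_subset {Ω : Set Plane}
    {T : Geometry.SimplicialComplex ℝ Plane} (hT : IsTriangulation Ω T)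
    {K : Finset Plane} (hK : K ∈ elements T) : tri K ⊆ closure Ω := by
  rw [hT.closure_eq]; exact subset_biUnion_of_mem hK

theorem exists_mem_tri {Ω : Set Plane}
    {T : Geometry.SimplicialComplex ℝ Plane} (hT : IsTriangulation Ω T)
    {x : Plane} (hx : x ∈ closure Ω) : ∃ K ∈ elements T, x ∈ tri K := by
  rw [hT.closure_eq] at hx
  exact mem_iUnion₂.1 hx |>.imp fun K h => ⟨h.1, h.2⟩

theorem exists_element_of_vertex {Ω : Set Plane}
    {T : Geometry.SimplicialComplex ℝ Plane} (hT : IsTriangulation Ω T)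
    {p : Plane} (hp : p ∈ T.vertices) : ∃ K ∈ elements T, p ∈ K := by
  obtain ⟨t, ht, hst, hc⟩ := hT.pure {p} hp
  exact ⟨t, ⟨ht, hc⟩, hst (Finset.mem_singleton_self p)⟩

/-- Elements are convex, so their finitely many frontiers are null sets. -/
theorem ae_mem_interior_tri {Ω : Set Plane}
    {T : Geometry.SimplicialComplex ℝ Plane} (hT : IsTriangulation Ω T) :
    ∀ᵐ x ∂volume.restrict Ω, ∃ K ∈ elements T, x ∈ interior (tri K) := by
  have h0 : ∀ K ∈ elements T, ∀ᵐ x, x ∉ frontier (tri K) := fun K _ =>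
    measure_eq_zero_iff_ae_notMem.1 ((convex_convexHull ℝ (K : Set Plane)).addHaar_frontier volume)
  have h1 : ∀ᵐ x, ∀ K ∈ elements T, x ∉ frontier (tri K) :=
    (ae_ball_iff hT.finite_elements.countable).2 h0
  refine ae_restrict_of_ae_restrict_of_subset subset_closure ?_
  rw [ae_restrict_iff' isClosed_closure.measurableSet]
  filter_upwards [h1] with x hx hxc
  obtain ⟨K, hK, hxK⟩ := hT.exists_mem_tri hxc
  refine ⟨K, hK, ?_⟩
  by_contra hi
  exact hx K hK ⟨subset_closure hxK, hi⟩

end IsTriangulation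

theorem mem_vertices_of_mem_element {T : Geometry.SimplicialComplex ℝ Plane} {K : Finset Plane}
    (hK : K ∈ elements T) {p : Plane} (hp : p ∈ K) : p ∈ T.vertices :=
  T.down_closed hK.1 (Finset.singleton_subset_iff.2 hp) (Finset.singleton_nonempty p)

open Classical in
/-- The piecewise affine nodal interpolant of `v`. -/
noncomputable def interp (T : Geometry.SimplicialComplex ℝ Plane) (v : Plane → ℝ) (x : Plane) : ℝ :=
  if h : ∃ K ∈ elements T, x ∈ tri K then ∑ p ∈ h.choose, bary h.choose p x * v p else 0

/-- The element chosen in the definition is immaterial. By conformity two elements meet in the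
convex hull of their common vertices, where affine functions with the same vertex values coincide.
-/
theorem interp_eq {T : Geometry.SimplicialComplex ℝ Plane} {v : Plane → ℝ} {K : Finset Plane}
    (hK : K ∈ elements T) {A : Plane →ᵃ[ℝ] ℝ} (hA : ∀ p ∈ K, A p = v p) {x : Plane}
    (hx : x ∈ tri K) : interp T v x = A x := by
  have h : ∃ K ∈ elements T, x ∈ tri K := ⟨K, hK, hx⟩
  rw [interp, dif_pos h]
  set K' := h.choose
  have hK' : K' ∈ elements T := h.choose_spec.1
  have hx' : x ∈ tri K' := h.choose_spec.2
  obtain ⟨B, hB⟩ := (isTriangle_of_mem_elements hK').exists_affine v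
  have e : ∑ p ∈ K', bary K' p x * v p = B x := by
    rw [(isTriangle_of_mem_elements hK').affine_apply B x]
    exact Finset.sum_congr rfl fun p hp => by rw [hB p hp]
  rw [e]
  exact affine_eqOn_convexHull (fun p hp => by rw [hA p hp.2, hB p hp.1])
    (T.inter_subset_convexHull hK'.1 hK.1 ⟨hx', hx⟩)

/-! ### Global Lipschitz continuity of the nodal interpolant -/

/-- Lipschitz bounds on finitely many closed sets add up along a segment they cover. -/
theorem abs_sub_le_of_segment_subset {f : Plane → ℝ} {L : ℝ} (s : Finset (Set Plane))
    (hc : ∀ K ∈ s, IsClosed K) (hf : ∀ K ∈ s, ∀ p ∈ K, ∀ q ∈ K, |f q - f p| ≤ L * dist p q)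
    {x y : Plane} (hxy : segment ℝ x y ⊆ ⋃ K ∈ s, K) : |f y - f x| ≤ L * dist x y := by
  classical
  induction hn : s.card generalizing s x with
  | zero =>
    have := hxy (left_mem_segment ℝ x y)
    rw [Finset.card_eq_zero.1 hn] at this
    simp at this
  | succ n ih =>
    obtain ⟨K, hK, hxK⟩ := mem_iUnion₂.1 (hxy (left_mem_segment ℝ x y))
    have hcont : Continuous fun t : ℝ => AffineMap.lineMap (k := ℝ) x y t :=
      AffineMap.lineMap_continuous
    have hcpt : IsCompact (Icc (0 : ℝ) 1 ∩ (fun t : ℝ => AffineMap.lineMap x y t) ⁻¹' K) :=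
      isCompact_Icc.inter_right ((hc K hK).preimage hcont)
    -- Jump to the last point of the segment in `K`. Beyond it the other sets suffice, and being
    -- closed they cover that point as well, so `K` can be dropped.
    obtain ⟨t, ⟨ht, htK⟩, hmax⟩ := hcpt.exists_isGreatest ⟨0, by simp, by simpa using hxK⟩
    set z : Plane := AffineMap.lineMap x y t with hz
    have hxz : |f z - f x| ≤ L * dist x z := hf K hK x hxK z htK
    rcases ht.2.eq_or_lt with h1 | h1
    · have : z = y := by rw [hz, h1]; simp
      rwa [this] at hxz
    have hcl : IsClosed (⋃ K' ∈ s.erase K, K') :=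
      (s.erase K).finite_toSet.isClosed_biUnion fun K' hK' => hc K' (Finset.mem_of_mem_erase hK')
    have hin : ∀ r ∈ Ioc t 1, AffineMap.lineMap x y r ∈ ⋃ K' ∈ s.erase K, K' := by
      intro r hr
      have hr01 : r ∈ Icc (0 : ℝ) 1 := ⟨ht.1.trans hr.1.le, hr.2⟩
      obtain ⟨K', hK', hrK⟩ := mem_iUnion₂.1 (hxy (segment_eq_image_lineMap ℝ x y ▸
        mem_image_of_mem _ hr01))
      refine mem_iUnion₂.2 ⟨K', Finset.mem_erase.2 ⟨?_, hK'⟩, hrK⟩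
      rintro rfl
      exact absurd (hmax ⟨hr01, hrK⟩) (not_le.2 hr.1)
    have hin' : ∀ r ∈ Icc t 1, AffineMap.lineMap x y r ∈ ⋃ K' ∈ s.erase K, K' := by
      intro r hr
      rw [← closure_Ioc h1.ne] at hr
      exact closure_minimal (s := Ioc t 1)
        (t := (fun r : ℝ => AffineMap.lineMap x y r) ⁻¹' ⋃ K' ∈ s.erase K, K') hin
        (hcl.preimage hcont) hr
    have hseg : segment ℝ z y ⊆ ⋃ K' ∈ s.erase K, K' := by
      intro w hw
      rw [segment_eq_image_lineMap] at hw
      obtain ⟨r, hr, rfl⟩ := hw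
      have e : AffineMap.lineMap z y r = AffineMap.lineMap x y (t + r * (1 - t)) := by
        rw [hz]; simp only [AffineMap.lineMap_apply_module']
        module
      rw [e]
      refine hin' _ ⟨?_, ?_⟩
      · nlinarith [hr.1]
      · nlinarith [hr.2]
    have hzy := ih (s.erase K) (fun K' hK' => hc K' (Finset.mem_of_mem_erase hK'))
      (fun K' hK' => hf K' (Finset.mem_of_mem_erase hK')) hseg
      (by rw [Finset.card_erase_of_mem hK, hn]; rfl)
    have hd : dist x z + dist z y = dist x y := by
      refine dist_add_dist_of_mem_segment ?_
      rw [segment_eq_image_lineMap]; exact ⟨t, ht, rfl⟩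
    have : f y - f x = (f y - f z) + (f z - f x) := by ring
    rw [this, ← hd]
    exact (abs_add_le _ _).trans (by linarith)

theorem continuousOn_interp {Ω : Set Plane} {T : Geometry.SimplicialComplex ℝ Plane}
    (hT : IsTriangulation Ω T) (v : Plane → ℝ) : ContinuousOn (interp T v) (closure Ω) := by
  rw [hT.closure_eq, biUnion_eq_iUnion]
  have : Finite (elements T) := hT.finite_elements
  refine (locallyFinite_of_finite _).continuousOn_iUnion (fun K => isClosed_tri K.1) fun K => ?_
  obtain ⟨A, hA⟩ := (isTriangle_of_mem_elements K.2).exists_affine v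
  exact (continuous_affine A).continuousOn.congr fun x hx => interp_eq K.2 hA hx

theorem PolyPath.abs_sub_le {S : Set Plane} {f : Plane → ℝ} {L : ℝ}
    (hseg : ∀ a b, segment ℝ a b ⊆ S → |f b - f a| ≤ L * dist a b) {x y : Plane} {ℓ : ℝ}
    (h : PolyPath S x y ℓ) : |f y - f x| ≤ L * ℓ := by
  induction h with
  | refl => simp
  | @step y z ℓ hp hs ih =>
    have : f z - f x = (f z - f y) + (f y - f x) := by ring
    rw [this]
    exact (abs_add_le _ _).trans (by linarith [hseg y z hs])

/-- The nodal interpolant extends to a Lipschitz function. -/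
theorem exists_lipschitz_interp {Ω : Set Plane} (hΩ : IsPolygonalDomain Ω)
    {T : Geometry.SimplicialComplex ℝ Plane} (hT : IsTriangulation Ω T) (v : Plane → ℝ) :
    ∃ (w : Plane → ℝ) (K : ℝ≥0), LipschitzWith K w ∧ EqOn w (interp T v) (closure Ω) := by
  classical
  choose! A hA using fun K (hK : K ∈ elements T) =>
    (isTriangle_of_mem_elements hK).exists_affine v
  -- This bound depends on the triangulation; only the existence of some Lipschitz constant is used
  -- later.
  obtain ⟨L, hL⟩ := (hT.finite_elements.image fun K => ‖affGrad (A K)‖).bddAbove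
  have hL' : ∀ K ∈ elements T, ∀ p ∈ tri K, ∀ q ∈ tri K,
      |interp T v q - interp T v p| ≤ max L 0 * dist p q := by
    intro K hK p hp q hq
    rw [interp_eq hK (hA K hK) hp, interp_eq hK (hA K hK) hq, affine_sub_eq]
    refine (abs_real_inner_le_norm _ _).trans ?_
    rw [← dist_eq_norm, dist_comm q p]
    exact mul_le_mul_of_nonneg_right ((hL (mem_image_of_mem _ hK)).trans (le_max_left _ _))
      dist_nonneg
  have hseg : ∀ a b, segment ℝ a b ⊆ Ω →
      |interp T v b - interp T v a| ≤ max L 0 * dist a b := by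
    intro a b hab
    refine abs_sub_le_of_segment_subset (hT.finite_elements.toFinset.image tri) ?_ ?_ ?_
    · intro S hS
      obtain ⟨K, -, rfl⟩ := Finset.mem_image.1 hS
      exact isClosed_tri K
    · intro S hS
      obtain ⟨K, hK, rfl⟩ := Finset.mem_image.1 hS
      exact hL' K (hT.finite_elements.mem_toFinset.1 hK)
    · intro z hz
      obtain ⟨K, hK, hzK⟩ := hT.exists_mem_tri (subset_closure (hab hz))
      exact mem_iUnion₂.2 ⟨tri K, Finset.mem_image_of_mem _ (hT.finite_elements.mem_toFinset.2 hK),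
        hzK⟩
  obtain ⟨C, hC, hq⟩ := exists_quasiconvex hΩ
  have hLip : LipschitzOnWith (Real.toNNReal (max L 0 * C)) (interp T v) Ω :=
    LipschitzOnWith.of_dist_le_mul fun x hx y hy => by
      obtain ⟨ℓ, hℓ, hp⟩ := hq x hx y hy
      rw [Real.coe_toNNReal _ (by positivity), dist_comm (interp T v x), Real.dist_eq, mul_assoc]
      exact (hp.abs_sub_le hseg).trans (mul_le_mul_of_nonneg_left hℓ (le_max_right _ _))
  obtain ⟨w, hw, heq⟩ := hLip.extend_real
  refine ⟨w, _, hw, ?_⟩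
  exact (EqOn.of_subset_closure heq (continuousOn_interp hT v) hw.continuous.continuousOn
    subset_closure subset_rfl).symm

/-- The nodal interpolant as an `H¹` function. -/
theorem exists_feInterp {Ω : Set Plane} (hΩ : IsPolygonalDomain Ω)
    {T : Geometry.SimplicialComplex ℝ Plane} (hT : IsTriangulation Ω T) (v : Plane → ℝ) :
    ∃ w : H1 Ω, IsFEFunction T w ∧ (∀ p ∈ T.vertices, w p = v p) ∧
      (∀ x ∈ closure Ω, w x = interp T v x) ∧ (∃ K : ℝ≥0, LipschitzWith K w) ∧
      w.grad = gradient w ∧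
      ∀ K ∈ elements T, ∀ A : Plane →ᵃ[ℝ] ℝ, (∀ p ∈ K, A p = v p) →
        (∀ x ∈ tri K, w x = A x) ∧ ∀ x ∈ interior (tri K), w.grad x = affGrad A := by
  obtain ⟨w, L, hw, heq⟩ := exists_lipschitz_interp hΩ hT v
  have hval : ∀ K ∈ elements T, ∀ A : Plane →ᵃ[ℝ] ℝ, (∀ p ∈ K, A p = v p) →
      ∀ x ∈ tri K, w x = A x := fun K hK A hA x hx => by
    rw [heq (hT.tri_subset hK hx), interp_eq hK hA hx]
  refine ⟨H1.ofLipschitz hΩ.isOpen hΩ.isBounded hw, ⟨hw.continuous.continuousOn, ?_⟩, ?_, heq,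
    ⟨L, hw⟩, rfl, fun K hK A hA => ⟨hval K hK A hA, fun x hx => ?_⟩⟩
  · intro K hK
    obtain ⟨A, hA⟩ := (isTriangle_of_mem_elements hK).exists_affine v
    exact ⟨A, hval K hK A hA⟩
  · intro p hp
    obtain ⟨K, hK, hpK⟩ := hT.exists_element_of_vertex hp
    obtain ⟨A, hA⟩ := (isTriangle_of_mem_elements hK).exists_affine v
    exact (hval K hK A hA p (vertex_mem_tri hpK)).trans (hA p hpK)
  · have hev : w =ᶠ[𝓝 x] A := by
      filter_upwards [mem_interior_iff_mem_nhds.1 hx] with y hy using hval K hK A hA y hy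
    have h2 : gradient w x = gradient A x := by
      rw [gradient, gradient, hev.fderiv_eq]
    exact h2.trans (hasGradientAt_affine A x).gradient

/-! ### Boundary values of the interpolant -/

/-- The open star of an interior vertex lies in the domain. -/
theorem mem_of_bary_pos {Ω : Set Plane} (hΩ : IsPolygonalDomain Ω)
    {T : Geometry.SimplicialComplex ℝ Plane} (hT : IsTriangulation Ω T) {K : Finset Plane}
    (hK : K ∈ elements T) {p x : Plane} (hp : p ∈ K) (hpΩ : p ∈ Ω) (hx : x ∈ tri K)
    (hpos : 0 < bary K p x) : x ∈ Ω := by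
  classical
  have hKt := isTriangle_of_mem_elements hK
  -- The point `x` is contracted towards `p` until it lands in `Ω`, where a whole neighbourhood is
  -- covered by elements. Those elements will be shown to have `p` as a vertex.
  obtain ⟨t, ⟨ht0, ht1⟩, hy⟩ : ∃ t : ℝ, t ∈ Ioo (0 : ℝ) 1 ∧ AffineMap.lineMap p x t ∈ Ω := by
    have hc : Tendsto (fun t : ℝ => AffineMap.lineMap (k := ℝ) p x t) (𝓝[>] 0) (𝓝 p) := by
      have h1 : Continuous fun t : ℝ => AffineMap.lineMap (k := ℝ) p x t :=
        AffineMap.lineMap_continuous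
      simpa using (h1.tendsto 0).mono_left nhdsWithin_le_nhds
    have hev := hc.eventually (hΩ.isOpen.mem_nhds hpΩ)
    obtain ⟨t, ht, ht'⟩ := (hev.and (Ioo_mem_nhdsGT (zero_lt_one' ℝ))).exists
    exact ⟨t, ht', ht⟩
  set y : Plane := AffineMap.lineMap p x t with hydef
  have hline : ∀ (A : Plane →ᵃ[ℝ] ℝ) (z : Plane),
      A (AffineMap.lineMap p z t) = (1 - t) * A p + t * A z := by
    intro A z
    rw [AffineMap.apply_lineMap, AffineMap.lineMap_apply_module]; simp
  have hyK : y ∈ tri K := (convex_convexHull ℝ (K : Set Plane)).lineMap_mem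
    (vertex_mem_tri hp) hx ⟨ht0.le, ht1.le⟩
  -- every element containing `y` contains `x`, and has `p` as a vertex
  have hstar : ∀ K' ∈ elements T, y ∈ tri K' → p ∈ K' ∧ 0 < bary K' p x := by
    intro K' hK' hyK'
    have hKt' := isTriangle_of_mem_elements hK'
    have hyI := T.inter_subset_convexHull hK.1 hK'.1 ⟨hyK, hyK'⟩
    have hzero : ∀ q ∈ K, q ∉ K' → bary K q y = 0 := by
      intro q hq hq'
      have := affine_eqOn_convexHull (A := bary K q) (B := 0) (s := (K ∩ K' : Set Plane))
        (fun r hr => by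
          rw [hKt.bary_ne hq hr.1 (fun h => hq' (h ▸ hr.2))]; rfl) hyI
      simpa using this
    have hpK' : p ∈ K' := by
      by_contra hn
      have h1 := hzero p hp hn
      rw [hydef, hline, hKt.bary_self hp] at h1
      nlinarith
    refine ⟨hpK', ?_⟩
    have hxI : x ∈ convexHull ℝ (K ∩ K' : Set Plane) := by
      have hx0 : ∀ q ∈ K, q ∉ K' → bary K q x = 0 := by
        intro q hq hq'
        have h1 := hzero q hq hq'
        have hqp : q ≠ p := fun h => hq' (h ▸ hpK')
        rw [hydef, hline, hKt.bary_ne hq hp hqp] at h1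
        have : t * bary K q x = 0 := by linarith
        exact (mul_eq_zero.1 this).resolve_left ht0.ne'
      have hsub : ∀ q ∈ K, q ∉ K.filter (· ∈ K') → bary K q x = 0 := fun q hq hq' =>
        hx0 q hq fun h => hq' (Finset.mem_filter.2 ⟨hq, h⟩)
      have e1 : ∑ q ∈ K.filter (· ∈ K'), bary K q x = 1 := by
        rw [Finset.sum_subset (Finset.filter_subset _ _) hsub, hKt.sum_bary]
      have e2 : ∑ q ∈ K.filter (· ∈ K'), bary K q x • q = x := by
        rw [Finset.sum_subset (Finset.filter_subset _ _) fun q hq hq' => by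
          rw [hsub q hq hq', zero_smul], hKt.sum_bary_smul]
      rw [← e2]
      refine (convex_convexHull ℝ _).sum_mem (fun q hq => ?_) e1 fun q hq => ?_
      · exact hKt.mem_tri_iff.1 hx q (Finset.mem_filter.1 hq).1
      · exact subset_convexHull ℝ _ ⟨(Finset.mem_filter.1 hq).1, (Finset.mem_filter.1 hq).2⟩
    have e : bary K' p x = bary K p x := by
      refine affine_eqOn_convexHull (s := (K ∩ K' : Set Plane)) (fun r hr => ?_) hxI
      by_cases hrp : p = r
      · rw [← hrp, hKt'.bary_self hpK', hKt.bary_self hp]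
      · rw [hKt'.bary_ne hpK' hr.2 hrp, hKt.bary_ne hp hr.1 hrp]
    rw [e]; exact hpos
  have hcz : Continuous fun z : Plane => AffineMap.lineMap (k := ℝ) p z t := by
    simp only [AffineMap.lineMap_apply_module']
    fun_prop
  -- The same homothety with centre `p`, read backwards, transports the covering from near `y` to
  -- near `x`: coordinates other than that of `p` are multiplied by a positive factor, and the one
  -- of `p` is positive near `x`.
  refine interior_closure_subset hΩ.isOpen hΩ.lipschitz (mem_interior_iff_mem_nhds.2 ?_)
  have ev1 : ∀ᶠ z in 𝓝 x, ∀ K' ∈ elements T,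
      (AffineMap.lineMap (k := ℝ) p z t ∈ tri K' → y ∈ tri K') ∧
      (y ∈ tri K' → 0 < bary K' p z) := by
    refine (eventually_all_finite hT.finite_elements).2 fun K' hK' => ?_
    by_cases hyK' : y ∈ tri K'
    · filter_upwards [(continuous_affine (bary K' p)).continuousAt.eventually_const_lt
        (hstar K' hK' hyK').2] with z hz
      exact ⟨fun _ => hyK', fun _ => hz⟩
    · filter_upwards [hcz.continuousAt.eventually ((isClosed_tri K').isOpen_compl.mem_nhds hyK')]
        with z hz
      exact ⟨fun h => absurd h hz, fun h => absurd h hyK'⟩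
  filter_upwards [ev1, hcz.continuousAt.eventually (hΩ.isOpen.mem_nhds hy)] with z hz hzΩ
  obtain ⟨K', hK', hzK'⟩ := hT.exists_mem_tri (subset_closure hzΩ)
  have hKt' := isTriangle_of_mem_elements hK'
  have hyK' := (hz K' hK').1 hzK'
  have hpK' := (hstar K' hK' hyK').1
  refine hT.tri_subset hK' (hKt'.mem_tri_iff.2 fun q hq => ?_)
  by_cases hqp : q = p
  · rw [hqp]; exact ((hz K' hK').2 hyK').le
  · have h1 := hKt'.mem_tri_iff.1 hzK' q hq
    rw [hline, hKt'.bary_ne hq hpK' hqp] at h1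
    have h2 : 0 ≤ t * bary K' q z := by linarith
    exact nonneg_of_mul_nonneg_right h2 ht0

/-- The interpolant of nodal values vanishing at boundary vertices vanishes on the boundary. -/
theorem interp_eq_zero_of_mem_frontier {Ω : Set Plane} (hΩ : IsPolygonalDomain Ω)
    {T : Geometry.SimplicialComplex ℝ Plane} (hT : IsTriangulation Ω T) {v : Plane → ℝ}
    (hv : ∀ p ∈ T.vertices, p ∈ frontier Ω → v p = 0) {x : Plane} (hx : x ∈ frontier Ω) :
    interp T v x = 0 := by
  obtain ⟨K, hK, hxK⟩ := hT.exists_mem_tri hx.1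
  have hKt := isTriangle_of_mem_elements hK
  obtain ⟨A, hA⟩ := hKt.exists_affine v
  rw [interp_eq hK hA hxK, hKt.affine_apply A x]
  refine Finset.sum_eq_zero fun p hp => ?_
  rcases (hKt.mem_tri_iff.1 hxK p hp).eq_or_lt with h | h
  · rw [← h, zero_mul]
  -- A vertex with positive weight at a boundary point cannot be interior, since its open star lies
  -- in `Ω`.
  · have hpf : p ∈ frontier Ω := by
      rw [hΩ.isOpen.frontier_eq] at hx ⊢
      exact ⟨hT.tri_subset hK (vertex_mem_tri hp), fun hpΩ =>
        hx.2 (mem_of_bary_pos hΩ hT hK hp hpΩ hxK h)⟩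
    rw [hA p hp, hv p (mem_vertices_of_mem_element hK hp) hpf, mul_zero]

/-- A finite element interpolant which vanishes on the boundary belongs to `H¹₀(Ω)`. -/
theorem isH10_feInterp {Ω : Set Plane} (hΩ : IsPolygonalDomain Ω)
    {T : Geometry.SimplicialComplex ℝ Plane} (hT : IsTriangulation Ω T) {w : H1 Ω}
    (hFE : IsFEFunction T w) (hlip : ∃ K : ℝ≥0, LipschitzWith K w) (hgrad : w.grad = gradient w)
    (h0 : ∀ x ∈ frontier Ω, w x = 0) : IsH10 w := by
  obtain ⟨L, hL⟩ := hlip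
  have hind : ∀ x ∈ Ω, Ω.indicator w =ᶠ[𝓝 x] w := fun x hx => by
    filter_upwards [hΩ.isOpen.mem_nhds hx] with y hy
    simp [hy]
  have hg : ∀ x ∈ Ω, gradient (Ω.indicator w) x = gradient w x := fun x hx => by
    rw [gradient, gradient, (hind x hx).fderiv_eq]
  refine isH10_of_lipschitz hΩ.isOpen hΩ.isBounded w (lipschitzWith_indicator hL h0)
    (fun x hx => by simp [hx]) (fun x hx => by simp [hx]) (fun x hx => by rw [hg x hx, hgrad]) ?_
  choose! A hA using hFE.affine
  -- An affine function with nonzero gradient vanishes only on a line or nowhere, hence on a null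
  -- set. This gives the vanishing of the gradient almost everywhere on the zero set.
  have hnull : ∀ᵐ x, ∀ K ∈ elements T, A K x = 0 → affGrad (A K) = 0 := by
    refine (ae_ball_iff hT.finite_elements.countable).2 fun K hK => ?_
    by_cases hz : affGrad (A K) = 0
    · simp [hz]
    · let S : AffineSubspace ℝ Plane := (AffineSubspace.mk' (0 : ℝ) ⊥).comap (A K)
      have hS : ∀ x, x ∈ S ↔ A K x = 0 := fun x => by
        simp [S, AffineSubspace.mem_comap, AffineSubspace.mem_mk']
      have hne : S ≠ ⊤ := by
        intro hT
        have hall : ∀ x, A K x = 0 := fun x => (hS x).1 (hT ▸ AffineSubspace.mem_top ℝ Plane x)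
        have := affine_sub_eq (A K) 0 (affGrad (A K))
        rw [hall, hall, sub_zero, sub_zero] at this
        exact hz (inner_self_eq_zero.1 this.symm)
      have h1 := measure_eq_zero_iff_ae_notMem.1 (Measure.addHaar_affineSubspace volume S hne)
      filter_upwards [h1] with x hx hx0
      exact absurd ((hS x).2 hx0) hx
  filter_upwards [hT.ae_mem_interior_tri, ae_restrict_of_ae hnull,
    ae_restrict_mem hΩ.isOpen.measurableSet] with x hxK hxn hxΩ hx0
  obtain ⟨K, hK, hxi⟩ := hxK
  have hwx : w x = 0 := by simpa [hxΩ] using hx0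
  rw [hg x hxΩ]
  have hev : w =ᶠ[𝓝 x] A K := by
    filter_upwards [mem_interior_iff_mem_nhds.1 hxi] with y hy using hA K hK y hy
  have h2 : gradient w x = gradient (A K) x := by
    rw [gradient, gradient, hev.fderiv_eq]
  rw [h2, (hasGradientAt_affine (A K) x).gradient]
  exact hxn K hK (by rw [← hA K hK x (interior_subset hxi), hwx])

/-! ### The maximum angle condition -/

/-- The Gram determinant of three vectors in the plane vanishes. -/
theorem gram_identity (d a b : Plane) :
    ‖d‖ ^ 2 * (‖a‖ ^ 2 * ‖b‖ ^ 2 - inner ℝ a b ^ 2) =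
      inner ℝ d a ^ 2 * ‖b‖ ^ 2 + inner ℝ d b ^ 2 * ‖a‖ ^ 2 -
        2 * inner ℝ a b * inner ℝ d a * inner ℝ d b := by
  simp only [← real_inner_self_eq_norm_sq, PiLp.inner_apply, Fin.sum_univ_two, RCLike.inner_apply,
    conj_trivial]
  ring

/-- Two components control a vector up to the sine of the angle between the directions, the Gram
factor being the squared product of norms and sine. -/
theorem norm_sq_mul_gram_le {d a b : Plane} {e : ℝ} (ha : |inner ℝ d a| ≤ e * ‖a‖)
    (hb : |inner ℝ d b| ≤ e * ‖b‖) :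
    ‖d‖ ^ 2 * (‖a‖ ^ 2 * ‖b‖ ^ 2 - inner ℝ a b ^ 2) ≤ 4 * e ^ 2 * (‖a‖ ^ 2 * ‖b‖ ^ 2) := by
  rw [gram_identity]
  have h1 : inner ℝ d a ^ 2 ≤ (e * ‖a‖) ^ 2 := sq_le_sq' (abs_le.1 ha).1 (abs_le.1 ha).2
  have h2 : inner ℝ d b ^ 2 ≤ (e * ‖b‖) ^ 2 := sq_le_sq' (abs_le.1 hb).1 (abs_le.1 hb).2
  have h3 : -(2 * inner ℝ a b * inner ℝ d a * inner ℝ d b) ≤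
      2 * (‖a‖ * ‖b‖) * ((e * ‖a‖) * (e * ‖b‖)) := by
    refine (neg_le_abs _).trans ?_
    rw [abs_mul, abs_mul, abs_mul, abs_two, mul_assoc]
    have h4 : |inner ℝ d a| * |inner ℝ d b| ≤ (e * ‖a‖) * (e * ‖b‖) :=
      mul_le_mul ha hb (abs_nonneg _) ((abs_nonneg _).trans ha)
    have h5 := abs_real_inner_le_norm a b
    exact mul_le_mul (by linarith) h4 (by positivity) (by positivity)
  have h6 := mul_le_mul_of_nonneg_right h1 (sq_nonneg ‖b‖)
  have h7 := mul_le_mul_of_nonneg_right h2 (sq_nonneg ‖a‖)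
  nlinarith

/-- The supremum is over a finite set, hence attained, and three angles sum to `π`. -/
theorem exists_angle_eq_maxAngle {K : Finset Plane} (hK : K.card = 3) :
    ∃ p ∈ K, ∃ q ∈ K, ∃ r ∈ K, p ≠ q ∧ q ≠ r ∧ p ≠ r ∧
      EuclideanGeometry.angle p q r = maxAngle K ∧ Real.pi / 3 ≤ maxAngle K := by
  classical
  obtain ⟨a, b, c, hab, hac, hbc, rfl⟩ := Finset.card_eq_three.1 hK
  set K : Finset Plane := {a, b, c} with hKdef
  set S : Set ℝ := {θ | ∃ p ∈ K, ∃ q ∈ K, ∃ r ∈ K, p ≠ q ∧ q ≠ r ∧ p ≠ r ∧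
    θ = EuclideanGeometry.angle p q r} with hS
  have hfin : S.Finite := by
    refine ((K ×ˢ K ×ˢ K).image fun t => EuclideanGeometry.angle t.1 t.2.1 t.2.2).finite_toSet.subset ?_
    rintro θ ⟨p, hp, q, hq, r, hr, -, -, -, rfl⟩
    exact Finset.mem_coe.2 (Finset.mem_image.2 ⟨(p, q, r), by simp [hp, hq, hr], rfl⟩)
  have ha : a ∈ K := by simp [hKdef]
  have hb : b ∈ K := by simp [hKdef]
  have hc : c ∈ K := by simp [hKdef]
  have m1 : EuclideanGeometry.angle a b c ∈ S := ⟨a, ha, b, hb, c, hc, hab, hbc, hac, rfl⟩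
  have m2 : EuclideanGeometry.angle b c a ∈ S :=
    ⟨b, hb, c, hc, a, ha, hbc, hac.symm, hab.symm, rfl⟩
  have m3 : EuclideanGeometry.angle c a b ∈ S :=
    ⟨c, hc, a, ha, b, hb, hac.symm, hab, hbc.symm, rfl⟩
  have hmem : maxAngle K ∈ S := Set.Nonempty.csSup_mem ⟨_, m1⟩ hfin
  obtain ⟨p, hp, q, hq, r, hr, h1, h2, h3, h4⟩ := hmem
  refine ⟨p, hp, q, hq, r, hr, h1, h2, h3, h4.symm, ?_⟩
  have hsum := EuclideanGeometry.angle_add_angle_add_angle_eq_pi (p₁ := a) (p₂ := b) c hab.symm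
  have l1 := le_csSup hfin.bddAbove m1
  have l2 := le_csSup hfin.bddAbove m2
  have l3 := le_csSup hfin.bddAbove m3
  have : maxAngle K = sSup S := rfl
  linarith

/-- Under the maximum angle condition a vector is controlled by its components along the edges. -/
theorem exists_maxAngle_bound {α₀ : ℝ} (hα₀ : α₀ < Real.pi) :
    ∃ c : ℝ, 0 < c ∧ ∀ K : Finset Plane, K.card = 3 → maxAngle K ≤ α₀ → ∀ (d : Plane) (e : ℝ),
      0 ≤ e → (∀ p ∈ K, ∀ q ∈ K, |inner ℝ d (q - p)| ≤ e * dist p q) → ‖d‖ ≤ c * e := by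
  have hpi := Real.pi_pos
  set α := max α₀ (Real.pi / 3) with hα
  have hαpi : α < Real.pi := max_lt hα₀ (by linarith)
  have hα3 : Real.pi / 3 ≤ α := le_max_right _ _
  -- The largest angle lies between `π / 3` and `α < π`. On this interval the sine is smallest at an
  -- endpoint, so at the vertex of the largest angle the two edges are uniformly transversal.
  set s := min (Real.sin (Real.pi / 3)) (Real.sin α) with hs
  have hs0 : 0 < s := lt_min (Real.sin_pos_of_pos_of_lt_pi (by linarith) (by linarith))
    (Real.sin_pos_of_pos_of_lt_pi (by linarith) hαpi)
  have hsin : ∀ θ, Real.pi / 3 ≤ θ → θ ≤ α → s ≤ Real.sin θ := by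
    intro θ h1 h2
    rcases le_total θ (Real.pi / 2) with h | h
    · exact (min_le_left _ _).trans
        (Real.sin_le_sin_of_le_of_le_pi_div_two (by linarith) h h1)
    · refine (min_le_right _ _).trans ?_
      rw [← Real.sin_pi_sub α, ← Real.sin_pi_sub θ]
      exact Real.sin_le_sin_of_le_of_le_pi_div_two (by linarith) (by linarith) (by linarith)
  refine ⟨2 / s, by positivity, fun K hK hmax d e he hd => ?_⟩
  obtain ⟨p, hp, q, hq, r, hr, hpq, hqr, -, hθ, hθ3⟩ := exists_angle_eq_maxAngle hK
  have hss := hsin _ hθ3 (hmax.trans (le_max_left _ _))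
  have ha : |inner ℝ d (p - q)| ≤ e * ‖p - q‖ := by
    rw [← dist_eq_norm, dist_comm]; exact hd q hq p hp
  have hb : |inner ℝ d (r - q)| ≤ e * ‖r - q‖ := by
    rw [← dist_eq_norm, dist_comm]; exact hd q hq r hr
  have key := norm_sq_mul_gram_le ha hb
  have hcos : inner ℝ (p - q) (r - q) = ‖p - q‖ * ‖r - q‖ * Real.cos (maxAngle K) := by
    rw [← hθ, EuclideanGeometry.angle]
    have := InnerProductGeometry.cos_angle_mul_norm_mul_norm (p -ᵥ q) (r -ᵥ q)
    rw [vsub_eq_sub, vsub_eq_sub] at this ⊢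
    linarith
  have hN : 0 < ‖p - q‖ ^ 2 * ‖r - q‖ ^ 2 := by
    have h1 := norm_pos_iff.2 (sub_ne_zero.2 hpq)
    have h2 := norm_pos_iff.2 (sub_ne_zero.2 hqr.symm)
    positivity
  rw [hcos] at key
  have h1 : ‖d‖ ^ 2 * Real.sin (maxAngle K) ^ 2 ≤ 4 * e ^ 2 := by
    refine le_of_mul_le_mul_right ?_ hN
    rw [Real.sin_sq]
    linarith
  have h2 : (‖d‖ * s) ^ 2 ≤ (2 * e) ^ 2 := by
    have : (‖d‖ * s) ^ 2 ≤ ‖d‖ ^ 2 * Real.sin (maxAngle K) ^ 2 := by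
      rw [mul_pow]; gcongr
    linarith
  have h3 := abs_le_of_sq_le_sq' h2 (by positivity)
  rw [div_mul_eq_mul_div, le_div_iff₀ hs0]
  exact h3.2

/-- Interpolation error of a jet on a triangle satisfying the maximum angle condition. -/
theorem norm_sub_affGrad_le {α₀ c : ℝ} (hc : ∀ K : Finset Plane, K.card = 3 → maxAngle K ≤ α₀ →
      ∀ (d : Plane) (e : ℝ), 0 ≤ e → (∀ p ∈ K, ∀ q ∈ K, |inner ℝ d (q - p)| ≤ e * dist p q) →
      ‖d‖ ≤ c * e) {E : Set Plane} {v : Plane → ℝ} {G : Plane → Plane} {L h : ℝ} (hL : 0 ≤ L)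
    (hv : IsJet E v G L) {K : Finset Plane} (hK : K.card = 3) (hmax : maxAngle K ≤ α₀)
    (hKE : tri K ⊆ E) (hh : ∀ x ∈ tri K, ∀ y ∈ tri K, dist x y ≤ h) {A : Plane →ᵃ[ℝ] ℝ}
    (hA : ∀ p ∈ K, A p = v p) {x : Plane} (hx : x ∈ tri K) :
    ‖G x - affGrad A‖ ≤ c * (2 * L * h) := by
  have h0 : 0 ≤ h := dist_nonneg.trans (hh x hx x hx)
  rw [norm_sub_rev]
  refine hc K hK hmax _ _ (by positivity) fun p hp q hq => ?_
  have hpt := vertex_mem_tri hp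
  have hqt := vertex_mem_tri hq
  -- Along an edge the interpolant has the exact increment of `v`. What remains is the Taylor
  -- remainder at `p` and the variation of `G` between `x` and `p`, each at most `L * h * dist p q`.
  have e1 : inner ℝ (affGrad A - G x) (q - p) =
      (v q - v p - inner ℝ (G p) (q - p)) + inner ℝ (G p - G x) (q - p) := by
    rw [inner_sub_left, ← affine_sub_eq, hA p hp, hA q hq, inner_sub_left]; ring
  have b1 := hv.taylor p (hKE hpt) q (hKE hqt)
  have b2 : |inner ℝ (G p - G x) (q - p)| ≤ L * h * dist p q := by
    refine (abs_real_inner_le_norm _ _).trans ?_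
    rw [← dist_eq_norm q p, dist_comm q p]
    refine mul_le_mul_of_nonneg_right ((hv.lipschitz x (hKE hx) p (hKE hpt)).trans ?_) dist_nonneg
    exact mul_le_mul_of_nonneg_left (hh x hx p hpt) hL
  have b3 : L * dist p q ^ 2 ≤ L * h * dist p q := by
    rw [sq, ← mul_assoc]
    exact mul_le_mul_of_nonneg_right (mul_le_mul_of_nonneg_left (hh p hpt q hqt) hL) dist_nonneg
  rw [e1]
  exact (abs_add_le _ _).trans (by linarith)

/-! ### Cutoff functions -/

/-- `(η, E)` is a cutoff function with its gradient: `η = 1` on the ball of radius `r` about `c`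
and `η = 0` outside the ball of radius `2 * r`. -/
structure IsCutoff (η : Plane → ℝ) (E : Plane → Plane) (c : Plane) (r κ : ℝ) : Prop where
  abs_le_one : ∀ x, |η x| ≤ 1
  eq_one : ∀ x, dist x c ≤ r → η x = 1
  eq_zero : ∀ x, 2 * r ≤ dist x c → η x = 0
  grad_eq_zero : ∀ x, 2 * r ≤ dist x c → E x = 0
  norm_grad_le : ∀ x, ‖E x‖ ≤ κ / r
  abs_sub_le : ∀ x y, |η y - η x| ≤ κ / r * dist x y
  isJet : IsJet univ η E (κ / r ^ 2)

theorem isJet_of_lipschitz_gradient {f : Plane → ℝ} (hf : Differentiable ℝ f) {L : ℝ≥0}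
    (hL : LipschitzWith L (gradient f)) : IsJet univ f (gradient f) L where
  lipschitz x _ y _ := by
    have := hL.dist_le_mul y x
    rwa [dist_eq_norm, dist_comm y x] at this
  taylor x _ y _ := by
    have := Convex.norm_image_sub_le_of_norm_hasFDerivWithin_le' (𝕜 := ℝ)
      (f := f) (C := L * ‖y - x‖) (φ := InnerProductSpace.toDual ℝ Plane (gradient f x))
      (f' := fun z => InnerProductSpace.toDual ℝ Plane (gradient f z)) (s := segment ℝ x y)
      (fun z hz => (hasGradientAt_iff_hasFDerivAt.1 (hf z).hasGradientAt).hasFDerivWithinAt)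
      (fun z hz => by
        rw [← map_sub, LinearIsometryEquiv.norm_map]
        have h1 := hL.dist_le_mul z x
        rw [dist_eq_norm, dist_eq_norm] at h1
        refine h1.trans (mul_le_mul_of_nonneg_left ?_ L.2)
        obtain ⟨t, ht, rfl⟩ := (segment_eq_image' ℝ x y ▸ hz :)
        simp only [add_sub_cancel_left, norm_smul, Real.norm_eq_abs, abs_of_nonneg ht.1]
        exact mul_le_of_le_one_left (norm_nonneg _) ht.2)
      (convex_segment x y) (left_mem_segment ℝ x y) (right_mem_segment ℝ x y)
    rw [Real.norm_eq_abs, InnerProductSpace.toDual_apply_apply] at this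
    rw [dist_comm, dist_eq_norm]
    linarith

/-- One fixed bump is translated and dilated; each derivative brings a factor `r⁻¹`. -/
theorem exists_isCutoff : ∃ κ : ℝ, 0 < κ ∧ ∀ (c : Plane) (r : ℝ), 0 < r →
    ∃ η E, IsCutoff η E c r κ := by
  let b : ContDiffBump (0 : Plane) := ⟨1, 2, one_pos, one_lt_two⟩
  have hb : ContDiff ℝ ∞ b := b.contDiff
  obtain ⟨K₁, hK₁⟩ := ContDiff.lipschitzWith_of_hasCompactSupport b.hasCompactSupport hb (by simp)
  have hgs : ContDiff ℝ ∞ (fderiv ℝ b) := hb.fderiv_right (by simp)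
  obtain ⟨K₂, hK₂⟩ := ContDiff.lipschitzWith_of_hasCompactSupport
    (b.hasCompactSupport.fderiv (𝕜 := ℝ)) hgs (by simp)
  have hK₂' : LipschitzWith K₂ (gradient b) := by
    have := (InnerProductSpace.toDual ℝ Plane).symm.lipschitz.comp hK₂
    rw [one_mul] at this
    exact this
  have hjet := isJet_of_lipschitz_gradient (hb.differentiable (by simp)) hK₂'
  have hzero : ∀ z : Plane, 2 ≤ ‖z‖ → b z = 0 := fun z hz =>
    b.zero_of_le_dist (by simpa using hz)
  -- The minimum argument includes the boundary circle `‖z‖ = 2`, where the bump need not vanish in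
  -- a full neighbourhood.
  have hgzero : ∀ z : Plane, 2 ≤ ‖z‖ → gradient b z = 0 := fun z hz => by
    have hmin : IsLocalMin b z := Eventually.of_forall fun y => by
      rw [hzero z hz]; exact b.nonneg
    rw [gradient, hmin.fderiv_eq_zero, map_zero]
  set κ : ℝ := K₁ + K₂ + 1 with hκ
  have hK₁κ : (K₁ : ℝ) ≤ κ := by
    have : (0 : ℝ) ≤ K₂ := K₂.2
    linarith
  have hK₂κ : (K₂ : ℝ) ≤ κ := by
    have : (0 : ℝ) ≤ K₁ := K₁.2
    linarith
  have hκ0 : 0 < κ := by positivity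
  refine ⟨κ, hκ0, fun c r hr => ⟨fun x => b (r⁻¹ • (x - c)),
    fun x => r⁻¹ • gradient b (r⁻¹ • (x - c)), ?_⟩⟩
  have hscale : ∀ x : Plane, ‖r⁻¹ • (x - c)‖ = dist x c / r := fun x => by
    rw [norm_smul, dist_eq_norm, Real.norm_eq_abs, abs_of_pos (inv_pos.2 hr), inv_mul_eq_div]
  have hd : ∀ x y : Plane, dist (r⁻¹ • (x - c)) (r⁻¹ • (y - c)) = dist x y / r := fun x y => by
    rw [dist_eq_norm, ← smul_sub, sub_sub_sub_cancel_right, norm_smul, Real.norm_eq_abs,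
      abs_of_pos (inv_pos.2 hr), inv_mul_eq_div, dist_eq_norm]
  have hout : ∀ x, 2 * r ≤ dist x c → 2 ≤ ‖r⁻¹ • (x - c)‖ := fun x hx => by
    rwa [hscale, le_div_iff₀ hr]
  refine ⟨fun x => ?_, fun x hx => ?_, fun x hx => hzero _ (hout x hx), fun x hx => ?_, fun x => ?_,
    fun x y => ?_, fun x _ y _ => ?_, fun x _ y _ => ?_⟩
  · rw [abs_of_nonneg b.nonneg]; exact b.le_one
  · refine b.one_of_mem_closedBall ?_
    rw [mem_closedBall_zero_iff, hscale]
    exact (div_le_one hr).2 hx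
  · simp only [hgzero _ (hout x hx), smul_zero]
  · rw [norm_smul, Real.norm_eq_abs, abs_of_pos (inv_pos.2 hr), inv_mul_eq_div]
    gcongr
    exact (norm_gradient_le_of_lipschitz hK₁ _).trans hK₁κ
  · have := hK₁.dist_le_mul (r⁻¹ • (y - c)) (r⁻¹ • (x - c))
    rw [hd, Real.dist_eq, dist_comm y x] at this
    refine this.trans ?_
    rw [div_mul_eq_mul_div, mul_div_assoc]
    exact mul_le_mul_of_nonneg_right hK₁κ (by positivity)
  · have := hjet.taylor (r⁻¹ • (x - c)) trivial (r⁻¹ • (y - c)) trivial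
    rw [hd, ← smul_sub, sub_sub_sub_cancel_right, inner_smul_right] at this
    rw [inner_smul_left]
    simp only [conj_trivial]
    refine this.trans ?_
    rw [div_pow, div_mul_eq_mul_div, ← mul_div_assoc]
    gcongr
  · have := hjet.lipschitz (r⁻¹ • (x - c)) trivial (r⁻¹ • (y - c)) trivial
    rw [hd] at this
    rw [← smul_sub, norm_smul, Real.norm_eq_abs, abs_of_pos (inv_pos.2 hr)]
    calc r⁻¹ * _ ≤ r⁻¹ * (K₂ * (dist x y / r)) := by gcongr
      _ = K₂ / r ^ 2 * dist x y := by field_simp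
      _ ≤ _ := by gcongr

theorem IsJet.abs_sub_le {E : Set Plane} {f : Plane → ℝ} {G : Plane → Plane} {L : ℝ}
    (h : IsJet E f G L) {x y : Plane} (hx : x ∈ E) (hy : y ∈ E) :
    |f y - f x| ≤ (‖G x‖ + L * dist x y) * dist x y := by
  have h1 := h.taylor x hx y hy
  have h2 := abs_real_inner_le_norm (G x) (y - x)
  rw [← dist_eq_norm y x, dist_comm y x] at h2
  have : f y - f x = (f y - f x - inner ℝ (G x) (y - x)) + inner ℝ (G x) (y - x) := by ring
  rw [this]
  refine (abs_add_le _ _).trans ?_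
  nlinarith

theorem IsJet.mono {E : Set Plane} {f : Plane → ℝ} {G : Plane → Plane} {L L' : ℝ}
    (h : IsJet E f G L) (hL : L ≤ L') : IsJet E f G L' :=
  ⟨fun x hx y hy => (h.taylor x hx y hy).trans (mul_le_mul_of_nonneg_right hL (sq_nonneg _)),
    fun x hx y hy => (h.lipschitz x hx y hy).trans (mul_le_mul_of_nonneg_right hL dist_nonneg)⟩

theorem IsJet.sub {E : Set Plane} {f g : Plane → ℝ} {G H : Plane → Plane} {L M : ℝ}
    (hf : IsJet E f G L) (hg : IsJet E g H M) :
    IsJet E (fun x => f x - g x) (fun x => G x - H x) (L + M) := by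
  refine ⟨fun x hx y hy => ?_, fun x hx y hy => ?_⟩
  · have e : f y - g y - (f x - g x) - inner ℝ (G x - H x) (y - x) =
        (f y - f x - inner ℝ (G x) (y - x)) - (g y - g x - inner ℝ (H x) (y - x)) := by
      rw [inner_sub_left]; ring
    rw [e]
    refine (abs_sub _ _).trans ?_
    linarith [hf.taylor x hx y hy, hg.taylor x hx y hy]
  · have e : G y - H y - (G x - H x) = (G y - G x) - (H y - H x) := by abel
    rw [e]
    refine (norm_sub_le _ _).trans ?_
    linarith [hf.lipschitz x hx y hy, hg.lipschitz x hx y hy]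

theorem IsJet.sub_affine {E : Set Plane} {f : Plane → ℝ} {G : Plane → Plane} {L : ℝ}
    (hf : IsJet E f G L) (A : Plane →ᵃ[ℝ] ℝ) :
    IsJet E (fun x => f x - A x) (fun x => G x - affGrad A) L := by
  have hA : IsJet E A (fun _ => affGrad A) 0 :=
    ⟨fun x _ y _ => by rw [affine_sub_eq]; simp, fun x _ y _ => by simp⟩
  simpa using hf.sub hA

/-- The product of a cutoff function with a jet which is small on the support of the cutoff. -/
theorem IsCutoff.isJet_mul {η : Plane → ℝ} {H : Plane → Plane} {c : Plane} {r κ : ℝ} (hr : 0 < r)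
    (hκ : 0 < κ) (hη : IsCutoff η H c r κ) {E : Set Plane} {w : Plane → ℝ} {F : Plane → Plane}
    {B : ℝ} (hw : IsJet E w F B) (hwB : ∀ x ∈ E, dist x c < 2 * r → |w x| ≤ B * r ^ 2)
    (hFB : ∀ x ∈ E, dist x c < 2 * r → ‖F x‖ ≤ B * r) (hB : 0 ≤ B) :
    IsJet E (fun x => η x * w x) (fun x => η x • F x + w x • H x) ((1 + 7 * κ) * B) := by
  -- bounds when exactly one of the two points lies in the support
  have hone : ∀ x ∈ E, ∀ y, dist x c < 2 * r → 2 * r ≤ dist y c →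
      |η x * w x| ≤ κ * B * dist x y ^ 2 ∧ ‖η x • F x + w x • H x‖ ≤ 2 * κ * B * dist x y := by
    intro x hx y hxc hyc
    -- The cutoff is expanded about the outer point, where it and its gradient vanish. This avoids
    -- following a segment, which may leave `E`.
    have h1 := hη.isJet.taylor y trivial x trivial
    rw [hη.eq_zero y hyc, hη.grad_eq_zero y hyc, inner_zero_left, sub_zero, sub_zero,
      dist_comm y x] at h1
    have h2 := hη.abs_sub_le y x
    rw [hη.eq_zero y hyc, sub_zero, dist_comm y x] at h2
    have h3 := hη.isJet.lipschitz y trivial x trivial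
    rw [hη.grad_eq_zero y hyc, sub_zero, dist_comm y x] at h3
    have hd : 0 ≤ dist x y := dist_nonneg
    constructor
    · rw [abs_mul]
      calc |η x| * |w x| ≤ (κ / r ^ 2 * dist x y ^ 2) * (B * r ^ 2) :=
            mul_le_mul h1 (hwB x hx hxc) (abs_nonneg _) (by positivity)
        _ = κ * B * dist x y ^ 2 := by field_simp
    · refine (norm_add_le _ _).trans ?_
      rw [norm_smul, norm_smul, Real.norm_eq_abs, Real.norm_eq_abs]
      have k1 : |η x| * ‖F x‖ ≤ κ * B * dist x y := by
        calc |η x| * ‖F x‖ ≤ (κ / r * dist x y) * (B * r) :=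
              mul_le_mul h2 (hFB x hx hxc) (norm_nonneg _) (by positivity)
          _ = _ := by field_simp
      have k2 : |w x| * ‖H x‖ ≤ κ * B * dist x y := by
        calc |w x| * ‖H x‖ ≤ (B * r ^ 2) * (κ / r ^ 2 * dist x y) :=
              mul_le_mul (hwB x hx hxc) h3 (norm_nonneg _) (by positivity)
          _ = _ := by field_simp
      linarith
  -- increments of `w` on the support
  have hinc : ∀ x ∈ E, ∀ y ∈ E, dist x c < 2 * r → dist y c < 2 * r →
      |w y - w x| ≤ 5 * B * r * dist x y := by
    intro x hx y hy hxc hyc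
    refine (hw.abs_sub_le hx hy).trans (mul_le_mul_of_nonneg_right ?_ dist_nonneg)
    have h1 : dist x y ≤ 4 * r := by linarith [dist_triangle_right x y c]
    have h2 := mul_le_mul_of_nonneg_left h1 hB
    linarith [hFB x hx hxc]
  -- In every term the powers of `r` cancel: a factor `r ^ 2` or `r` from `w` and `F` meets `r⁻²` or
  -- `r⁻¹` from the cutoff. The coefficient 7 is `1 + 1 + 5` from the gradient increment with both
  -- points in the support; the other cases need less.
  refine ⟨fun x hx y hy => ?_, fun x hx y hy => ?_⟩
  · have hd : 0 ≤ dist x y := dist_nonneg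
    have hBd : 0 ≤ B * dist x y ^ 2 := by positivity
    have hκBd : 0 ≤ κ * (B * dist x y ^ 2) := by positivity
    rcases lt_or_ge (dist x c) (2 * r) with hxc | hxc <;>
      rcases lt_or_ge (dist y c) (2 * r) with hyc | hyc
    · have e : η y * w y - η x * w x - inner ℝ (η x • F x + w x • H x) (y - x) =
          η x * (w y - w x - inner ℝ (F x) (y - x)) +
            w x * (η y - η x - inner ℝ (H x) (y - x)) + (η y - η x) * (w y - w x) := by
        rw [inner_add_left, inner_smul_left, inner_smul_left]
        simp only [conj_trivial]; ring
      rw [e]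
      refine (abs_add_three _ _ _).trans ?_
      rw [abs_mul, abs_mul, abs_mul]
      have k1 : |η x| * |w y - w x - inner ℝ (F x) (y - x)| ≤ 1 * (B * dist x y ^ 2) :=
        mul_le_mul (hη.abs_le_one x) (hw.taylor x hx y hy) (abs_nonneg _) zero_le_one
      have k2 : |w x| * |η y - η x - inner ℝ (H x) (y - x)| ≤ κ * (B * dist x y ^ 2) := by
        calc _ ≤ (B * r ^ 2) * (κ / r ^ 2 * dist x y ^ 2) := mul_le_mul (hwB x hx hxc)
              (hη.isJet.taylor x trivial y trivial) (abs_nonneg _) (by positivity)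
          _ = _ := by field_simp
      have k3 : |η y - η x| * |w y - w x| ≤ 5 * (κ * (B * dist x y ^ 2)) := by
        calc _ ≤ (κ / r * dist x y) * (5 * B * r * dist x y) := mul_le_mul (hη.abs_sub_le x y)
              (hinc x hx y hy hxc hyc) (abs_nonneg _) (by positivity)
          _ = _ := by field_simp
      linarith
    · obtain ⟨h1, h2⟩ := hone x hx y hxc hyc
      rw [hη.eq_zero y hyc, zero_mul, zero_sub, ← neg_add', abs_neg]
      refine (abs_add_le _ _).trans ?_
      have h3 := (abs_real_inner_le_norm (η x • F x + w x • H x) (y - x)).trans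
        (mul_le_mul_of_nonneg_right h2 (norm_nonneg _))
      rw [← dist_eq_norm y x, dist_comm y x] at h3
      nlinarith
    · obtain ⟨h1, h2⟩ := hone y hy x hyc hxc
      rw [hη.eq_zero x hxc, hη.grad_eq_zero x hxc, zero_smul, smul_zero, add_zero, inner_zero_left,
        zero_mul, sub_zero, sub_zero]
      rw [dist_comm y x] at h1
      linarith
    · rw [hη.eq_zero x hxc, hη.grad_eq_zero x hxc, hη.eq_zero y hyc]
      simp only [zero_smul, smul_zero, add_zero, inner_zero_left, zero_mul, sub_zero, abs_zero]
      positivity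
  · have hd : 0 ≤ dist x y := dist_nonneg
    have hBd : 0 ≤ B * dist x y := by positivity
    have hκBd : 0 ≤ κ * (B * dist x y) := by positivity
    rcases lt_or_ge (dist x c) (2 * r) with hxc | hxc <;>
      rcases lt_or_ge (dist y c) (2 * r) with hyc | hyc
    · have e : η y • F y + w y • H y - (η x • F x + w x • H x) =
          (η y • (F y - F x) + (η y - η x) • F x) +
            (w y • (H y - H x) + (w y - w x) • H x) := by module
      rw [e]
      have k1 : ‖η y • (F y - F x)‖ ≤ 1 * (B * dist x y) := by
        rw [norm_smul]
        exact mul_le_mul (hη.abs_le_one y) (hw.lipschitz x hx y hy) (norm_nonneg _) zero_le_one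
      have k2 : ‖(η y - η x) • F x‖ ≤ κ * (B * dist x y) := by
        rw [norm_smul]
        calc _ ≤ (κ / r * dist x y) * (B * r) := mul_le_mul (hη.abs_sub_le x y)
              (hFB x hx hxc) (norm_nonneg _) (by positivity)
          _ = _ := by field_simp
      have k3 : ‖w y • (H y - H x)‖ ≤ κ * (B * dist x y) := by
        rw [norm_smul]
        calc _ ≤ (B * r ^ 2) * (κ / r ^ 2 * dist x y) := mul_le_mul (hwB y hy hyc)
              (hη.isJet.lipschitz x trivial y trivial) (norm_nonneg _) (by positivity)
          _ = _ := by field_simp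
      have k4 : ‖(w y - w x) • H x‖ ≤ 5 * (κ * (B * dist x y)) := by
        rw [norm_smul]
        calc _ ≤ (5 * B * r * dist x y) * (κ / r) := mul_le_mul (hinc x hx y hy hxc hyc)
              (hη.norm_grad_le x) (norm_nonneg _) (by positivity)
          _ = _ := by field_simp
      refine (norm_add_le _ _).trans ((add_le_add (norm_add_le _ _) (norm_add_le _ _)).trans ?_)
      linarith
    · obtain ⟨h1, h2⟩ := hone x hx y hxc hyc
      rw [hη.eq_zero y hyc, hη.grad_eq_zero y hyc, zero_smul, smul_zero, add_zero, zero_sub,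
        norm_neg]
      linarith
    · obtain ⟨h1, h2⟩ := hone y hy x hyc hxc
      rw [hη.eq_zero x hxc, hη.grad_eq_zero x hxc, zero_smul, smul_zero, add_zero, sub_zero]
      rw [dist_comm y x] at h2
      linarith
    · rw [hη.eq_zero x hxc, hη.grad_eq_zero x hxc, hη.eq_zero y hyc, hη.grad_eq_zero y hyc]
      simp only [zero_smul, smul_zero, add_zero, sub_zero, norm_zero]
      positivity

theorem sum_ite_mem_le_one {ι : Type*} [Fintype ι] {S : ι → Set Plane} (hS : Pairwise fun i j =>
    Disjoint (S i) (S j)) (x : Plane) [∀ i, Decidable (x ∈ S i)] :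
    ∑ i, (if x ∈ S i then (1 : ℝ) else 0) ≤ 1 := by
  rw [Finset.sum_boole]
  have : (Finset.univ.filter fun i => x ∈ S i).card ≤ 1 := by
    refine Finset.card_le_one.2 fun i hi j hj => ?_
    by_contra hij
    exact Set.disjoint_left.1 (hS hij) (Finset.mem_filter.1 hi).2 (Finset.mem_filter.1 hj).2
  exact_mod_cast this

/-- The sum of jets with disjoint supports. -/
theorem IsJet.sum {ι : Type*} [Fintype ι] {S : ι → Set Plane}
    (hS : Pairwise fun i j => Disjoint (S i) (S j)) {E : Set Plane} {f : ι → Plane → ℝ}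
    {G : ι → Plane → Plane} {L : ℝ} (hL : 0 ≤ L) (h : ∀ i, IsJet E (f i) (G i) L)
    (hf : ∀ i, ∀ x, x ∉ S i → f i x = 0) (hG : ∀ i, ∀ x, x ∉ S i → G i x = 0) :
    IsJet E (fun x => ∑ i, f i x) (fun x => ∑ i, G i x) (2 * L) := by
  classical
  -- For a given pair of points at most two summands matter: one whose support contains `x` and one
  -- whose support contains `y`. This is the factor 2.
  have key : ∀ (x y : Plane) (b : ℝ), 0 ≤ b → ∀ t : ι → ℝ, (∀ i, t i ≤ b) →
      (∀ i, x ∉ S i → y ∉ S i → t i ≤ 0) → ∑ i, t i ≤ 2 * b := by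
    intro x y b hb t ht1 ht2
    have h1 : ∀ i ∈ Finset.univ, t i ≤ b * ((if x ∈ S i then (1 : ℝ) else 0) +
        (if y ∈ S i then (1 : ℝ) else 0)) := by
      intro i _
      by_cases hx : x ∈ S i <;> by_cases hy : y ∈ S i <;> simp [hx, hy]
      · linarith [ht1 i]
      · exact ht1 i
      · exact ht1 i
      · exact ht2 i hx hy
    refine (Finset.sum_le_sum h1).trans ?_
    rw [← Finset.mul_sum, Finset.sum_add_distrib]
    have := sum_ite_mem_le_one hS x
    have := sum_ite_mem_le_one hS y
    nlinarith
  refine ⟨fun x hx y hy => ?_, fun x hx y hy => ?_⟩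
  · have e : ∑ i, f i y - ∑ i, f i x - inner ℝ (∑ i, G i x) (y - x) =
        ∑ i, (f i y - f i x - inner ℝ (G i x) (y - x)) := by
      rw [sum_inner, Finset.sum_sub_distrib, Finset.sum_sub_distrib]
    rw [e, mul_assoc]
    refine (Finset.abs_sum_le_sum_abs _ _).trans (key x y _ (by positivity) _
      (fun i => (h i).taylor x hx y hy) fun i hxi hyi => ?_)
    simp [hf i x hxi, hf i y hyi, hG i x hxi]
  · rw [← Finset.sum_sub_distrib, mul_assoc]
    refine (norm_sum_le _ _).trans (key x y _ (by positivity) _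
      (fun i => (h i).lipschitz x hx y hy) fun i hxi hyi => ?_)
    simp [hG i x hxi, hG i y hyi]

/-! ### Affine approximations respecting homogeneous boundary values -/

/-- The affine function with value `a` at `x` and gradient `g`. -/
noncomputable def affineOf (a : ℝ) (g x : Plane) : Plane →ᵃ[ℝ] ℝ :=
  ((InnerProductSpace.toDual ℝ Plane g : Plane →L[ℝ] ℝ) : Plane →ₗ[ℝ] ℝ).toAffineMap +
    AffineMap.const ℝ Plane (a - inner ℝ g x)

theorem affineOf_apply (a : ℝ) (g x y : Plane) : affineOf a g x y = a + inner ℝ g (y - x) := by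
  have : affineOf a g x y = inner ℝ g y + (a - inner ℝ g x) := rfl
  rw [this, inner_sub_right]; ring

theorem affGrad_affineOf (a : ℝ) (g x : Plane) : affGrad (affineOf a g x) = g := by
  refine ext_inner_right ℝ fun z => ?_
  have := affine_sub_eq (affineOf a g x) x (x + z)
  rw [affineOf_apply, affineOf_apply] at this
  simp only [add_sub_cancel_left, sub_self, inner_zero_right, add_zero] at this
  exact this.symm

/-! ### Parallelism and polygonal boundaries -/

/-- The cross product in the plane. -/
def cross (a b : Plane) : ℝ := a 0 * b 1 - a 1 * b 0

theorem cross_sq (a b : Plane) : cross a b ^ 2 = ‖a‖ ^ 2 * ‖b‖ ^ 2 - inner ℝ a b ^ 2 := by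
  simp only [← real_inner_self_eq_norm_sq, PiLp.inner_apply, Fin.sum_univ_two, RCLike.inner_apply,
    conj_trivial, cross]
  ring

theorem abs_cross_le (a b : Plane) : |cross a b| ≤ ‖a‖ * ‖b‖ := by
  refine abs_le_of_sq_le_sq ?_ (by positivity)
  rw [cross_sq, mul_pow]
  linarith [sq_nonneg (inner ℝ a b)]

theorem cross_sub_right (a b c : Plane) : cross a (b - c) = cross a b - cross a c := by
  simp [cross]; ring

theorem cross_add_smul (a b c : Plane) (t : ℝ) : cross a (b + t • c) = cross a b + t * cross a c := by
  simp [cross]; ring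

/-- A vector `w` parallel to `d` inherits orthogonality to `g`. -/
theorem inner_eq_zero_of_cross_eq_zero {g d w : Plane} (hd : d ≠ 0) (h : cross d w = 0)
    (hg : inner ℝ g d = 0) : inner ℝ g w = 0 := by
  have h1 := gram_identity w d g
  have h2 := cross_sq d w
  rw [h] at h2
  have h3 : inner ℝ g w ^ 2 * ‖d‖ ^ 2 = 0 := by
    rw [real_inner_comm] at hg
    rw [hg, real_inner_comm d w, real_inner_comm g w] at h1
    nlinarith
  have h4 : ‖d‖ ^ 2 ≠ 0 := by simpa using hd
  exact pow_eq_zero_iff (two_ne_zero) |>.1 ((mul_eq_zero.1 h3).resolve_right h4)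

theorem cross_eq_of_mem_segment {d a b x : Plane} (h : cross d (b - a) = 0)
    (hx : x ∈ segment ℝ a b) : cross d x = cross d a := by
  rw [segment_eq_image'] at hx
  obtain ⟨t, -, rfl⟩ := hx
  rw [cross_add_smul, h, mul_zero, add_zero]

/-- A boundary point of a polygonal domain lies on a nondegenerate boundary segment. -/
theorem exists_nondegenerate_segment {Ω : Set Plane} (hΩ : IsPolygonalDomain Ω)
    {S : Finset (Plane × Plane)} (hS : frontier Ω = ⋃ e ∈ S, segment ℝ e.1 e.2) {x : Plane}
    (hx : x ∈ frontier Ω) : ∃ e ∈ S, e.1 ≠ e.2 ∧ x ∈ segment ℝ e.1 e.2 := by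
  classical
  by_contra! hno
  -- If `x` were covered by degenerate segments only, the rest of the boundary would lie in this
  -- closed set missing `x`, and `x` would be an isolated boundary point.
  have hcl : IsClosed ((⋃ e ∈ S.filter fun e => e.1 ≠ e.2, segment ℝ e.1 e.2) ∪
      ((S.image Prod.fst).erase x : Set Plane)) := by
    refine IsClosed.union ?_ (Finset.finite_toSet _).isClosed
    refine isClosed_biUnion_finset fun e _ => ?_
    rw [← convexHull_pair]
    exact ((Set.toFinite _).isCompact_convexHull ℝ).isClosed
  have hxn : x ∈ ((⋃ e ∈ S.filter fun e => e.1 ≠ e.2, segment ℝ e.1 e.2) ∪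
      ((S.image Prod.fst).erase x : Set Plane))ᶜ := by
    rintro (h | h)
    · obtain ⟨e, he, hxe⟩ := mem_iUnion₂.1 h
      exact hno e (Finset.mem_filter.1 he).1 (Finset.mem_filter.1 he).2 hxe
    · simp at h
  obtain ⟨ε, hε, hball⟩ := Metric.isOpen_iff.1 hcl.isOpen_compl x hxn
  have honly : ∀ y ∈ Metric.ball x ε, y ∈ frontier Ω → y = x := by
    intro y hy hyf
    by_contra hyx
    refine hball hy ?_
    rw [hS] at hyf
    obtain ⟨e, he, hye⟩ := mem_iUnion₂.1 hyf
    by_cases hee : e.1 = e.2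
    · refine Or.inr ?_
      rw [← hee, segment_same, mem_singleton_iff] at hye
      simp only [Finset.coe_erase, Set.mem_sdiff, Finset.mem_coe, mem_singleton_iff]
      exact ⟨Finset.mem_image.2 ⟨e, he, hye.symm⟩, hyx⟩
    · exact Or.inl (mem_iUnion₂.2 ⟨e, Finset.mem_filter.2 ⟨he, hee⟩, hye⟩)
  have hxΩ : x ∉ Ω := by
    rw [hΩ.isOpen.frontier_eq] at hx; exact hx.2
  obtain ⟨y, hyΩ, hyx⟩ := Metric.mem_closure_iff.1 hx.1 ε hε
  have hyb : y ∈ Metric.ball x ε := by rw [Metric.mem_ball, dist_comm]; exact hyx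
  have hlt : line[ℝ, x, y] ≠ ⊤ := by
    intro htop
    have h1 : Module.finrank ℝ (line[ℝ, x, y]).direction ≤ 1 := by
      rw [direction_affineSpan]
      exact (collinear_iff_finrank_le_one).1 (collinear_pair ℝ x y)
    rw [htop, AffineSubspace.direction_top, finrank_top] at h1
    simp at h1
  have hdense : Dense {z : Plane | z ∉ (line[ℝ, x, y] : Set Plane)} :=
    Measure.dense_of_ae (measure_eq_zero_iff_ae_notMem.1
      (Measure.addHaar_affineSubspace volume _ hlt))
  -- A segment from `y` inside the ball can leave `Ω` only through `x`, hence only along the line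
  -- `xy`. So `Ω` is dense in the ball, and a Lipschitz domain then contains `x`.
  have hin : Metric.ball x ε ∩ {z : Plane | z ∉ (line[ℝ, x, y] : Set Plane)} ⊆ Ω := by
    rintro z ⟨hzb, hzl⟩
    by_contra hzΩ
    obtain ⟨w, hw, hwf⟩ := exists_mem_segment_frontier hyΩ hzΩ
    have hwx := honly w ((convex_ball x ε).segment_subset hyb hzb hw) hwf
    subst hwx
    apply hzl
    have hne : w ≠ y := fun h => hxΩ (h ▸ hyΩ)
    rw [segment_eq_image_lineMap] at hw
    obtain ⟨t, ht, hwt⟩ := hw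
    have ht0 : t ≠ 0 := by
      rintro rfl
      exact hne (by rw [← hwt]; simp)
    have hz : z = AffineMap.lineMap w y (1 - t⁻¹) := by
      have : w - y = t • (z - y) := by rw [← hwt]; simp [AffineMap.lineMap_apply_module']
      have h2 : z - y = t⁻¹ • (w - y) := by rw [this, smul_smul, inv_mul_cancel₀ ht0, one_smul]
      rw [AffineMap.lineMap_apply_module']
      have h3 : z = y + t⁻¹ • (w - y) := by rw [← h2]; abel
      rw [h3]; module
    rw [hz]
    exact AffineMap.lineMap_mem_affineSpan_pair _ _ _
  refine hxΩ (interior_closure_subset hΩ.isOpen hΩ.lipschitz (mem_interior.2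
    ⟨Metric.ball x ε, ?_, Metric.isOpen_ball, Metric.mem_ball_self hε⟩))
  exact (hdense.open_subset_closure_inter Metric.isOpen_ball).trans (closure_mono hin)

/-- If all edges were parallel, the boundary would lie on finitely many parallel lines. A ray in
their direction from a point of `Ω` off these lines would never meet the boundary, contradicting
boundedness. -/
theorem exists_cross_ne_zero {Ω : Set Plane} (hΩ : IsPolygonalDomain Ω)
    {S : Finset (Plane × Plane)} (hS : frontier Ω = ⋃ e ∈ S, segment ℝ e.1 e.2) :
    ∃ e ∈ S, ∃ e' ∈ S, cross (e.2 - e.1) (e'.2 - e'.1) ≠ 0 := by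
  by_contra! hno
  obtain ⟨z₀, hz₀⟩ := hΩ.isConnected.nonempty
  obtain ⟨R, hR⟩ := hΩ.isBounded.exists_norm_le
  -- rays leave the domain
  have hray : ∀ z ∈ Ω, ∀ d : Plane, d ≠ 0 → ∃ t : ℝ, z + t • d ∈ frontier Ω := by
    intro z hz d hd
    have hd' : 0 < ‖d‖ := norm_pos_iff.2 hd
    -- The displacement has length `2 * R + 1`, more than the distance of any two points of `Ω`.
    set t : ℝ := (2 * R + 1) / ‖d‖ with ht
    have hR0 : 0 ≤ R := (norm_nonneg _).trans (hR z hz)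
    have hout : z + t • d ∉ Ω := by
      intro h
      have h1 := hR _ h
      have h2 := hR z hz
      have h3 : ‖t • d‖ = 2 * R + 1 := by
        rw [norm_smul, Real.norm_eq_abs, abs_of_nonneg (by positivity), ht]
        field_simp
      have h4 : t • d = (z + t • d) - z := by abel
      have h5 := norm_sub_le (z + t • d) z
      rw [← h4, h3] at h5
      linarith
    obtain ⟨w, hw, hwf⟩ := exists_mem_segment_frontier hz hout
    rw [segment_eq_image'] at hw
    obtain ⟨s, -, rfl⟩ := hw
    refine ⟨s * t, ?_⟩
    simpa [smul_smul] using hwf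
  have hd1 : (EuclideanSpace.single 0 1 : Plane) ≠ 0 := by
    intro h
    have := congrArg (fun v : Plane => v 0) h
    simp at this
  obtain ⟨t₀, ht₀⟩ := hray z₀ hz₀ _ hd1
  obtain ⟨e, he, hne, -⟩ := exists_nondegenerate_segment hΩ hS ht₀
  set d := e.2 - e.1 with hd
  have hd0 : d ≠ 0 := sub_ne_zero.2 hne.symm
  have hfr : ∀ y ∈ frontier Ω, ∃ e' ∈ S, cross d y = cross d e'.1 := by
    intro y hy
    rw [hS] at hy
    obtain ⟨e', he', hye⟩ := mem_iUnion₂.1 hy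
    exact ⟨e', he', cross_eq_of_mem_segment (hno e he e' he') hye⟩
  -- The normal direction to `d`: moving along it changes the level `cross d ·` at a nonzero rate,
  -- so only finitely many shifts hit the levels of the edges.
  set n : Plane := !₂[-d 1, d 0] with hn
  have hdn : cross d n ≠ 0 := by
    have h1 : cross d n = d 0 ^ 2 + d 1 ^ 2 := by simp [cross, hn]; ring
    have h2 : ‖d‖ ^ 2 = d 0 ^ 2 + d 1 ^ 2 := by
      rw [EuclideanSpace.norm_sq_eq, Fin.sum_univ_two]; simp
    rw [h1, ← h2]
    simpa using hd0
  obtain ⟨s, hs, hsV⟩ : ∃ s : ℝ, z₀ + s • n ∈ Ω ∧ ∀ e' ∈ S, cross d (z₀ + s • n) ≠ cross d e'.1 := by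
    have hc : Continuous fun s : ℝ => z₀ + s • n := by fun_prop
    have hopen := hΩ.isOpen.preimage hc
    obtain ⟨δ, hδ, hsub⟩ := Metric.isOpen_iff.1 hopen 0 (by simpa using hz₀)
    have hinf : (Metric.ball (0 : ℝ) δ).Infinite := by
      rw [Real.ball_eq_Ioo]; exact Ioo_infinite (by linarith)
    obtain ⟨s, hs, hsn⟩ := hinf.exists_notMem_finite
      ((S.image fun e' => (cross d e'.1 - cross d z₀) / cross d n).finite_toSet)
    refine ⟨s, hsub hs, fun e' he' h => hsn (Finset.mem_coe.2 (Finset.mem_image.2 ⟨e', he', ?_⟩))⟩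
    rw [cross_add_smul] at h
    rw [← h]; field_simp; ring
  obtain ⟨t, ht⟩ := hray _ hs d hd0
  obtain ⟨e', he', h⟩ := hfr _ ht
  refine hsV e' he' ?_
  rw [← h, cross_add_smul d (z₀ + s • n)]
  have : cross d d = 0 := by simp [cross]; ring
  rw [this, mul_zero, add_zero]

/-- Tangential derivatives vanish along boundary segments on which the function vanishes. -/
theorem IsJet.inner_eq_zero {E : Set Plane} {f : Plane → ℝ} {G : Plane → Plane} {L : ℝ}
    (h : IsJet E f G L) {a b x : Plane} (hab : segment ℝ a b ⊆ E)
    (h0 : ∀ y ∈ segment ℝ a b, f y = 0) (hx : x ∈ segment ℝ a b) :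
    inner ℝ (G x) (b - a) = 0 := by
  obtain ⟨t, ht, rfl⟩ := (segment_eq_image' ℝ a b ▸ hx :)
  simp only at *
  set x := a + t • (b - a) with hxdef
  have key : ∀ s ∈ Icc (0 : ℝ) 1, s ≠ t →
      |inner ℝ (G x) (b - a)| ≤ L * |s - t| * ‖b - a‖ ^ 2 := by
    intro s hs hst
    have hy : a + s • (b - a) ∈ segment ℝ a b := by
      rw [segment_eq_image']; exact ⟨s, hs, rfl⟩
    have h1 := h.taylor x (hab hx) _ (hab hy)
    have e1 : a + s • (b - a) - x = (s - t) • (b - a) := by rw [hxdef]; module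
    rw [h0 _ hy, h0 _ hx, dist_comm, dist_eq_norm, e1, inner_smul_right, norm_smul, sub_zero,
      zero_sub, abs_neg, abs_mul, Real.norm_eq_abs, mul_pow] at h1
    have hp : 0 < |s - t| := abs_pos.2 (sub_ne_zero.2 hst)
    refine le_of_mul_le_mul_left ?_ hp
    nlinarith
  by_contra hne
  have hq : 0 < |inner ℝ (G x) (b - a)| := abs_pos.2 hne
  set q := |inner ℝ (G x) (b - a)|
  set N := L * ‖b - a‖ ^ 2 with hN
  -- At most `1 / 2`, so that `t + δ` or `t - δ` stays in the unit interval; and small enough that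
  -- the Taylor remainder cannot account for half of `q`.
  set δ := min (1 / 2) (q / (2 * (|N| + 1))) with hδ
  have hδ0 : 0 < δ := lt_min (by norm_num) (by positivity)
  have hδ2 : δ ≤ 1 / 2 := min_le_left _ _
  have hbound : ∀ s ∈ Icc (0 : ℝ) 1, |s - t| = δ → False := by
    intro s hs hst
    have h1 := key s hs (fun h => by rw [h, sub_self, abs_zero] at hst; exact hδ0.ne hst)
    rw [hst] at h1
    have h2 : δ * (|N| + 1) ≤ q / 2 := by
      have := mul_le_mul_of_nonneg_right (min_le_right (1 / 2) (q / (2 * (|N| + 1))))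
        (show (0 : ℝ) ≤ |N| + 1 by positivity)
      refine this.trans (le_of_eq ?_)
      field_simp
    have h3 : L * δ * ‖b - a‖ ^ 2 = δ * N := by rw [hN]; ring
    have h4 : δ * N ≤ δ * (|N| + 1) :=
      mul_le_mul_of_nonneg_left (by linarith [le_abs_self N]) hδ0.le
    linarith
  rcases le_total t (1 / 2) with h1 | h1
  · refine hbound (t + δ) ⟨by linarith [ht.1], by linarith⟩ ?_
    rw [add_sub_cancel_left, abs_of_pos hδ0]
  · refine hbound (t - δ) ⟨by linarith, by linarith [ht.2]⟩ ?_
    rw [sub_sub_cancel_left, abs_neg, abs_of_pos hδ0]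

/-- Turns the finitely many pairs of boundary edges into uniform constants, ignoring the pairs for
which the quantity degenerates. -/
theorem exists_pos_lower_bound {ι : Type*} (s : Finset ι) (f : ι → ℝ) :
    ∃ m > 0, ∀ i ∈ s, 0 < f i → m ≤ f i := by
  classical
  induction s using Finset.induction_on with
  | empty => exact ⟨1, one_pos, by simp⟩
  | insert a s _ ih =>
    obtain ⟨m, hm, h⟩ := ih
    by_cases ha : 0 < f a
    · refine ⟨min m (f a), lt_min hm ha, fun i hi hfi => ?_⟩
      rcases Finset.mem_insert.1 hi with rfl | hi
      · exact min_le_right _ _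
      · exact (min_le_left _ _).trans (h i hi hfi)
    · refine ⟨m, hm, fun i hi hfi => ?_⟩
      rcases Finset.mem_insert.1 hi with rfl | hi
      · exact absurd hfi ha
      · exact h i hi hfi

/-- Gradients of functions vanishing on the boundary are small near pairs of boundary segments
which do not lie on a line. -/
theorem exists_norm_gradient_bound {Ω : Set Plane} (hΩ : IsPolygonalDomain Ω)
    {S : Finset (Plane × Plane)} (hS : frontier Ω = ⋃ e ∈ S, segment ℝ e.1 e.2) :
    ∃ C : ℝ, 0 < C ∧ ∀ (u : Plane → ℝ) (G : Plane → Plane) (L : ℝ), 0 ≤ L →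
      IsJet (closure Ω) u G L → (∀ x ∈ frontier Ω, u x = 0) →
      ∀ e ∈ S, ∀ e' ∈ S, ∀ x ∈ segment ℝ e.1 e.2, ∀ y ∈ segment ℝ e'.1 e'.2,
        cross (e.2 - e.1) (y - x) ≠ 0 → ‖G x‖ ≤ C * L * dist x y := by
  have hseg : ∀ e ∈ S, segment ℝ e.1 e.2 ⊆ frontier Ω := fun e he => by
    rw [hS]; exact subset_biUnion_of_mem (u := fun e : Plane × Plane => segment ℝ e.1 e.2) he
  -- transversal pairs
  obtain ⟨c, hc, htrans⟩ : ∃ c : ℝ, 0 < c ∧ ∀ (u : Plane → ℝ) (G : Plane → Plane) (L : ℝ), 0 ≤ L →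
      IsJet (closure Ω) u G L → (∀ x ∈ frontier Ω, u x = 0) →
      ∀ e ∈ S, ∀ e' ∈ S, ∀ x ∈ segment ℝ e.1 e.2, ∀ y ∈ segment ℝ e'.1 e'.2,
        cross (e.2 - e.1) (e'.2 - e'.1) ≠ 0 → ‖G x‖ ≤ c * L * dist x y := by
    -- The smallest squared sine between nonparallel edges. The gradient at `x` is orthogonal to its
    -- own edge and, up to `L * dist x y`, to the other one.
    obtain ⟨m, hm, hmS⟩ := exists_pos_lower_bound (S ×ˢ S) fun p =>
      cross (p.1.2 - p.1.1) (p.2.2 - p.2.1) ^ 2 /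
        (‖p.1.2 - p.1.1‖ ^ 2 * ‖p.2.2 - p.2.1‖ ^ 2)
    refine ⟨2 / √m, by positivity, fun u G L hL hu h0 e he e' he' x hx y hy hne => ?_⟩
    set d := e.2 - e.1
    set d' := e'.2 - e'.1
    have hd : d ≠ 0 := by
      intro h; rw [h] at hne; simp [cross] at hne
    have hd' : d' ≠ 0 := by
      intro h; rw [h] at hne; simp [cross] at hne
    have hN : 0 < ‖d‖ ^ 2 * ‖d'‖ ^ 2 := by
      have := norm_pos_iff.2 hd
      have := norm_pos_iff.2 hd'
      positivity
    have hlow := hmS (e, e') (Finset.mem_product.2 ⟨he, he'⟩) (div_pos (by positivity) hN)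
    rw [le_div_iff₀ hN] at hlow
    have hx0 : inner ℝ (G x) d = 0 := hu.inner_eq_zero ((hseg e he).trans frontier_subset_closure)
      (fun y hy => h0 y (hseg e he hy)) hx
    have hy0 : inner ℝ (G y) d' = 0 :=
      hu.inner_eq_zero ((hseg e' he').trans frontier_subset_closure)
        (fun y hy => h0 y (hseg e' he' hy)) hy
    have h1 : |inner ℝ (G x) d| ≤ L * dist x y * ‖d‖ := by
      rw [hx0, abs_zero]; positivity
    have h2 : |inner ℝ (G x) d'| ≤ L * dist x y * ‖d'‖ := by
      have e1 : inner ℝ (G x) d' = inner ℝ (G x - G y) d' := by rw [inner_sub_left, hy0, sub_zero]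
      rw [e1]
      refine (abs_real_inner_le_norm _ _).trans (mul_le_mul_of_nonneg_right ?_ (norm_nonneg _))
      have := hu.lipschitz y (frontier_subset_closure (hseg e' he' hy)) x
        (frontier_subset_closure (hseg e he hx))
      rwa [dist_comm y x] at this
    have key := norm_sq_mul_gram_le h1 h2
    rw [← cross_sq] at key
    have h3 : ‖G x‖ ^ 2 * m ≤ 4 * (L * dist x y) ^ 2 := by
      refine le_of_mul_le_mul_right ?_ hN
      calc ‖G x‖ ^ 2 * m * (‖d‖ ^ 2 * ‖d'‖ ^ 2) = ‖G x‖ ^ 2 * (m * (‖d‖ ^ 2 * ‖d'‖ ^ 2)) := by ring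
        _ ≤ ‖G x‖ ^ 2 * cross d d' ^ 2 := mul_le_mul_of_nonneg_left hlow (sq_nonneg _)
        _ ≤ _ := key
    have h4 : (‖G x‖ * √m) ^ 2 ≤ (2 * (L * dist x y)) ^ 2 := by
      rw [mul_pow, Real.sq_sqrt hm.le]; linarith
    have h5 := (abs_le_of_sq_le_sq' h4 (by positivity)).2
    rw [mul_assoc, div_mul_eq_mul_div, le_div_iff₀ (Real.sqrt_pos.2 hm)]
    exact h5
  -- a global bound
  obtain ⟨c', hc', hglob⟩ : ∃ c' : ℝ, 0 < c' ∧ ∀ (u : Plane → ℝ) (G : Plane → Plane) (L : ℝ),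
      0 ≤ L → IsJet (closure Ω) u G L → (∀ x ∈ frontier Ω, u x = 0) →
      ∀ x ∈ closure Ω, ‖G x‖ ≤ c' * L := by
    -- Two nonparallel edges bound the gradient at one boundary point; its Lipschitz continuity
    -- carries the bound over the bounded domain.
    obtain ⟨e, he, e', he', hne⟩ := exists_cross_ne_zero hΩ hS
    refine ⟨c * dist e.1 e'.1 + Metric.diam (closure Ω) + 1,
      by have := Metric.diam_nonneg (s := closure Ω); positivity,
      fun u G L hL hu h0 x hx => ?_⟩
    have h1 := htrans u G L hL hu h0 e he e' he' e.1 (left_mem_segment ℝ _ _) e'.1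
      (left_mem_segment ℝ _ _) hne
    have he1 : e.1 ∈ closure Ω :=
      frontier_subset_closure (hseg e he (left_mem_segment ℝ _ _))
    have h2 := hu.lipschitz e.1 he1 x hx
    have h3 := mul_le_mul_of_nonneg_left
      (Metric.dist_le_diam_of_mem hΩ.isBounded.closure he1 hx) hL
    have h4 : G x = (G x - G e.1) + G e.1 := by abel
    rw [h4]
    refine (norm_add_le _ _).trans ?_
    nlinarith
  -- Edges on distinct parallel lines are at least `δ` apart, so the global bound is already
  -- proportional to `dist x y`.
  obtain ⟨δ, hδ, hδS⟩ := exists_pos_lower_bound (S ×ˢ S) fun p =>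
      |cross (p.1.2 - p.1.1) (p.2.1 - p.1.1)| / ‖p.1.2 - p.1.1‖
  refine ⟨c + c' / δ, by positivity, fun u G L hL hu h0 e he e' he' x hx y hy hne => ?_⟩
  have hdist : 0 ≤ dist x y := dist_nonneg
  by_cases hpar : cross (e.2 - e.1) (e'.2 - e'.1) = 0
  · have hself : cross (e.2 - e.1) (e.2 - e.1) = 0 := by simp [cross]; ring
    have e1 : cross (e.2 - e.1) (y - x) = cross (e.2 - e.1) (e'.1 - e.1) := by
      rw [cross_sub_right, cross_sub_right, cross_eq_of_mem_segment hpar hy,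
        cross_eq_of_mem_segment hself hx]
    have hd : e.2 - e.1 ≠ 0 := by
      intro h; rw [h] at hne; simp [cross] at hne
    have hd' := norm_pos_iff.2 hd
    have hlow := hδS (e, e') (Finset.mem_product.2 ⟨he, he'⟩)
      (div_pos (by rw [← e1]; exact abs_pos.2 hne) hd')
    have hxy : δ ≤ dist x y := by
      refine hlow.trans ?_
      rw [div_le_iff₀ hd']
      simp only
      rw [← e1, dist_comm, dist_eq_norm, mul_comm]
      exact abs_cross_le _ _
    calc ‖G x‖ ≤ c' * L := hglob u G L hL hu h0 x (frontier_subset_closure (hseg e he hx))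
      _ = c' / δ * L * δ := by field_simp
      _ ≤ c' / δ * L * dist x y := by gcongr
      _ ≤ (c + c' / δ) * L * dist x y := by gcongr; linarith
  · calc ‖G x‖ ≤ c * L * dist x y := htrans u G L hL hu h0 e he e' he' x hx y hy hpar
      _ ≤ (c + c' / δ) * L * dist x y := by
        have : 0 ≤ c' / δ := by positivity
        gcongr; linarith

theorem IsJet.taylor_affineOf {E : Set Plane} {f : Plane → ℝ} {G : Plane → Plane} {L : ℝ}
    (hL : 0 ≤ L) (h : IsJet E f G L) {x y : Plane} {ρ : ℝ} (hx : x ∈ E) (hy : y ∈ E)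
    (hxy : dist x y ≤ ρ) : |f y - affineOf (f x) (G x) x y| ≤ L * ρ ^ 2 ∧
      ‖G y - affGrad (affineOf (f x) (G x) x)‖ ≤ L * ρ := by
  rw [affGrad_affineOf, affineOf_apply, ← sub_sub]
  exact ⟨(h.taylor x hx y hy).trans (by gcongr), (h.lipschitz x hx y hy).trans (by gcongr)⟩

/-- Local approximation by affine functions, with homogeneous boundary values if `u` has them. -/
theorem exists_affine_approx {Ω : Set Plane} (hΩ : IsPolygonalDomain Ω) :
    ∃ C : ℝ, 1 ≤ C ∧ ∀ (u : Plane → ℝ) (G : Plane → Plane) (L : ℝ), 0 ≤ L →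
      IsJet (closure Ω) u G L → ∀ x ∈ closure Ω, ∀ r : ℝ, 0 < r → ∃ A : Plane →ᵃ[ℝ] ℝ,
        (∀ y ∈ closure Ω, dist y x < 2 * r → |u y - A y| ≤ C * L * r ^ 2 ∧
          ‖G y - affGrad A‖ ≤ C * L * r) ∧
        ((∀ y ∈ frontier Ω, u y = 0) → ∀ y ∈ frontier Ω, dist y x < 2 * r → A y = 0) := by
  obtain ⟨S, hS⟩ := hΩ.polygonal
  obtain ⟨c, hc, hbound⟩ := exists_norm_gradient_bound hΩ hS
  -- Points of the ball are at most `4 * r` apart; with `‖G z‖ ≤ 4 * c * L * r` the worst estimate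
  -- is `(4 * c + 4) * 4`.
  refine ⟨16 * c + 16, by linarith, fun u G L hL hu x hx r hr => ?_⟩
  have hcL : 0 ≤ c * L := by positivity
  -- Taylor polynomials at nearby points
  have htay : ∀ z ∈ closure Ω, dist z x < 2 * r → ∀ y ∈ closure Ω, dist y x < 2 * r →
      |u y - affineOf (u z) (G z) z y| ≤ (16 * c + 16) * L * r ^ 2 ∧
        ‖G y - affGrad (affineOf (u z) (G z) z)‖ ≤ (16 * c + 16) * L * r := by
    intro z hz hzx y hy hyx
    have hd : dist z y ≤ 4 * r := by linarith [dist_triangle_right z y x]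
    obtain ⟨h1, h2⟩ := hu.taylor_affineOf hL hz hy hd
    have k1 : 0 ≤ c * L * r ^ 2 := by positivity
    have k2 : 0 ≤ c * L * r := by positivity
    have k3 : 0 ≤ L * r := by positivity
    exact ⟨h1.trans (by nlinarith), h2.trans (by nlinarith)⟩
  by_cases h0 : ∀ y ∈ frontier Ω, u y = 0
  swap
  · exact ⟨affineOf (u x) (G x) x, htay x hx (by simpa using hr), fun h => absurd h h0⟩
  by_cases hne : ∃ z ∈ frontier Ω, dist z x < 2 * r
  swap
  · exact ⟨affineOf (u x) (G x) x, htay x hx (by simpa using hr),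
      fun _ y hy hyx => absurd ⟨y, hy, hyx⟩ hne⟩
  obtain ⟨z, hz, hzx⟩ := hne
  have hzc := frontier_subset_closure hz
  obtain ⟨e, he, hee, hze⟩ := exists_nondegenerate_segment hΩ hS hz
  have hseg : segment ℝ e.1 e.2 ⊆ frontier Ω := by
    rw [hS]; exact subset_biUnion_of_mem (u := fun e : Plane × Plane => segment ℝ e.1 e.2) he
  by_cases hline : ∀ y ∈ frontier Ω, dist y x < 2 * r → cross (e.2 - e.1) (y - z) = 0
  -- The nearby boundary lies on the line of one edge, along which the Taylor polynomial at `z` is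
  -- constantly zero.
  · refine ⟨affineOf (u z) (G z) z, htay z hzc hzx, fun _ y hy hyx => ?_⟩
    rw [affineOf_apply, h0 z hz, zero_add]
    exact inner_eq_zero_of_cross_eq_zero (sub_ne_zero.2 hee.symm) (hline y hy hyx)
      (hu.inner_eq_zero (hseg.trans frontier_subset_closure) (fun y hy => h0 y (hseg hy)) hze)
  · push Not at hline
    obtain ⟨y, hy, hyx, hcr⟩ := hline
    obtain ⟨e', he', hye⟩ : ∃ e' ∈ S, y ∈ segment ℝ e'.1 e'.2 := by
      rw [hS] at hy
      obtain ⟨e', he', hye⟩ := mem_iUnion₂.1 hy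
      exact ⟨e', he', hye⟩
    have hG := hbound u G L hL hu h0 e he e' he' z hze y hye hcr
    have hzy : dist z y ≤ 4 * r := by linarith [dist_triangle_right z y x]
    have hG' : ‖G z‖ ≤ 4 * (c * L * r) :=
      hG.trans ((mul_le_mul_of_nonneg_left hzy hcL).trans (by linarith))
    -- Near a corner the zero function suffices: the gradient is `O(L * r)`, and integrating from
    -- the zero at `z` makes `u` of size `O(L * r ^ 2)`.
    refine ⟨affineOf 0 0 x, fun w hw hwx => ?_, fun _ y _ _ => by simp [affineOf_apply]⟩
    rw [affGrad_affineOf, affineOf_apply, inner_zero_left, add_zero, sub_zero, sub_zero]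
    have hzw : dist z w ≤ 4 * r := by linarith [dist_triangle_right z w x]
    have hLzw := mul_le_mul_of_nonneg_left hzw hL
    constructor
    · have h1 := hu.abs_sub_le hzc hw
      rw [h0 z hz, sub_zero] at h1
      refine h1.trans ?_
      calc (‖G z‖ + L * dist z w) * dist z w ≤ (4 * (c * L * r) + L * (4 * r)) * (4 * r) := by
            gcongr
        _ = _ := by ring
    · have h2 := hu.lipschitz z hzc w hw
      have h3 : G w = (G w - G z) + G z := by abel
      rw [h3]
      refine (norm_add_le _ _).trans ?_
      have k2 : 0 ≤ c * L * r := by positivity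
      have k3 : 0 ≤ L * r := by positivity
      nlinarith

/-! ### Galerkin orthogonality -/

theorem integrable_inner_of_memLp {α : Type*} [MeasurableSpace α] {μ : Measure α}
    {f g : α → Plane} (hf : MemLp f 2 μ) (hg : MemLp g 2 μ) :
    Integrable (fun x => inner ℝ (f x) (g x)) μ := by
  have h1 : Integrable (fun x => ‖f x‖ ^ 2) μ := hf.integrable_norm_pow (p := 2) two_ne_zero
  have h2 : Integrable (fun x => ‖g x‖ ^ 2) μ := hg.integrable_norm_pow (p := 2) two_ne_zero
  refine (h1.add h2).mono' (hf.1.inner hg.1) (Eventually.of_forall fun x => ?_)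
  have h3 := abs_real_inner_le_norm (f x) (g x)
  simp only [Real.norm_eq_abs, Pi.add_apply]
  nlinarith [sq_nonneg (‖f x‖ - ‖g x‖), sq_nonneg (‖f x‖), sq_nonneg (‖g x‖)]

/-- Pythagoras: at the level of gradients `u - w` is the sum of `u - U` and `z`, which are
orthogonal by `h`. -/
theorem semiDistH1_le_of_orthogonal {Ω : Set Plane} {u U w z : H1 Ω}
    (hz : ∀ x, U.grad x = w.grad x + z.grad x) (h : bilin u z = bilin U z) :
    semiDistH1 u U ≤ semiDistH1 u w := by
  refine Real.sqrt_le_sqrt ?_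
  have ha : MemLp (fun x => u.grad x - U.grad x) 2 (volume.restrict Ω) :=
    u.memLp_grad.sub U.memLp_grad
  have hI1 : Integrable (fun x => ‖u.grad x - U.grad x‖ ^ 2) (volume.restrict Ω) :=
    ha.integrable_norm_pow (p := 2) two_ne_zero
  have hI2 : Integrable (fun x => ‖z.grad x‖ ^ 2) (volume.restrict Ω) :=
    z.memLp_grad.integrable_norm_pow (p := 2) two_ne_zero
  have hI3 := integrable_inner_of_memLp ha z.memLp_grad
  have horth : ∫ x in Ω, inner ℝ (u.grad x - U.grad x) (z.grad x) = 0 := by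
    simp only [inner_sub_left]
    rw [integral_sub (integrable_inner_of_memLp u.memLp_grad z.memLp_grad)
      (integrable_inner_of_memLp U.memLp_grad z.memLp_grad)]
    exact sub_eq_zero.2 h
  have e : ∀ x, ‖u.grad x - w.grad x‖ ^ 2 = ‖u.grad x - U.grad x‖ ^ 2 +
      2 * inner ℝ (u.grad x - U.grad x) (z.grad x) + ‖z.grad x‖ ^ 2 := fun x => by
    rw [← norm_add_sq_real, hz x]
    congr 2
    abel
  simp only [e]
  have hI4 : Integrable (fun x => ‖u.grad x - U.grad x‖ ^ 2 +
      2 * inner ℝ (u.grad x - U.grad x) (z.grad x)) (volume.restrict Ω) := hI1.add (hI3.const_mul 2)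
  rw [integral_add hI4 hI2, integral_add hI1 (hI3.const_mul 2),
    integral_const_mul, horth, mul_zero, add_zero]
  have : 0 ≤ ∫ x in Ω, ‖z.grad x‖ ^ 2 := integral_nonneg fun x => sq_nonneg _
  linarith

/-- The negative of an `H¹` function. -/
def H1.negate {Ω : Set Plane} (v : H1 Ω) : H1 Ω where
  toFun := fun x => -v x
  grad := fun x => -v.grad x
  memLp := v.memLp.neg
  memLp_grad := v.memLp_grad.neg
  isWeakGradient :=
    { locallyIntegrableOn := v.isWeakGradient.locallyIntegrableOn.neg
      locallyIntegrableOn_grad := v.isWeakGradient.locallyIntegrableOn_grad.neg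
      integral_eq := fun φ hφ => by
        simp only [neg_smul, smul_neg, integral_neg]
        rw [v.isWeakGradient.integral_eq φ hφ] }

theorem IsTestFunction.sub {Ω : Set Plane} {φ ψ : Plane → ℝ} (hφ : IsTestFunction Ω φ)
    (hψ : IsTestFunction Ω ψ) : IsTestFunction Ω fun x => φ x - ψ x := by
  have hts : tsupport (fun x => φ x - ψ x) ⊆ tsupport φ ∪ tsupport ψ :=
    closure_minimal (fun x hx => by
      by_contra hn
      rw [mem_union, not_or] at hn
      exact hx (by simp [image_eq_zero_of_notMem_tsupport hn.1,
        image_eq_zero_of_notMem_tsupport hn.2])) ((isClosed_tsupport _).union (isClosed_tsupport _))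
  exact ⟨hφ.contDiff.sub hψ.contDiff,
    (hφ.hasCompactSupport.isCompact.union hψ.hasCompactSupport.isCompact).of_isClosed_subset
      (isClosed_tsupport _) hts, hts.trans (union_subset hφ.tsupport_subset hψ.tsupport_subset)⟩

theorem IsH10.add_negate {Ω : Set Plane} {v w : H1 Ω} (hv : IsH10 v) (hw : IsH10 w) :
    IsH10 (v + w.negate) := by
  obtain ⟨φ, hφ, hφ1, hφ2⟩ := hv
  obtain ⟨ψ, hψ, hψ1, hψ2⟩ := hw
  refine ⟨fun n x => φ n x - ψ n x, fun n => (hφ n).sub (hψ n), ?_, ?_⟩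
  · refine tendsto_of_tendsto_of_tendsto_of_le_of_le tendsto_const_nhds
      (by simpa using hφ1.add hψ1) (fun _ => zero_le) fun n => ?_
    have e : (fun x => φ n x - ψ n x - (v + w.negate) x) =
        (fun x => φ n x - v x) - fun x => ψ n x - w x := by
      ext x
      have : (v + w.negate) x = v x + -w x := rfl
      simp only [this, Pi.sub_apply]; ring
    simp only [e]
    exact eLpNorm_sub_le ((hφ n).contDiff.continuous.aestronglyMeasurable.sub v.memLp.1)
      ((hψ n).contDiff.continuous.aestronglyMeasurable.sub w.memLp.1) (by norm_num)
  · refine tendsto_of_tendsto_of_tendsto_of_le_of_le tendsto_const_nhds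
      (by simpa using hφ2.add hψ2) (fun _ => zero_le) fun n => ?_
    have e : (fun x => gradient (fun x => φ n x - ψ n x) x - (v + w.negate).grad x) =
        (fun x => gradient (φ n) x - v.grad x) - fun x => gradient (ψ n) x - w.grad x := by
      ext1 x
      have h1 : (v + w.negate).grad x = v.grad x + -w.grad x := rfl
      have h2 : gradient (fun x => φ n x - ψ n x) x = gradient (φ n) x - gradient (ψ n) x := by
        simp only [gradient]
        rw [← map_sub, fderiv_fun_sub ((hφ n).contDiff.differentiable (by simp) x)
          ((hψ n).contDiff.differentiable (by simp) x)]
      simp only [h1, h2, Pi.sub_apply]; abel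
    simp only [e]
    exact eLpNorm_sub_le
      ((stronglyMeasurable_gradient _).aestronglyMeasurable.sub v.memLp_grad.1)
      ((stronglyMeasurable_gradient _).aestronglyMeasurable.sub w.memLp_grad.1) (by norm_num)

theorem IsFEFunction.add_negate {Ω : Set Plane} {T : Geometry.SimplicialComplex ℝ Plane}
    {v w : H1 Ω} (hv : IsFEFunction T v) (hw : IsFEFunction T w) :
    IsFEFunction T (v + w.negate) where
  continuousOn := hv.continuousOn.add hw.continuousOn.neg
  affine K hK := by
    obtain ⟨A, hA⟩ := hv.affine K hK
    obtain ⟨B, hB⟩ := hw.affine K hK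
    refine ⟨A - B, fun x hx => ?_⟩
    have : (v + w.negate) x = v x + -w x := rfl
    rw [this, hA x hx, hB x hx]
    simp [sub_eq_add_neg]

/-! ### Clusters -/

theorem dist_le_meshSize {Ω : Set Plane} {T : Geometry.SimplicialComplex ℝ Plane}
    (hT : IsTriangulation Ω T) {K : Finset Plane} (hK : K ∈ elements T) {x y : Plane}
    (hx : x ∈ tri K) (hy : y ∈ tri K) : dist x y ≤ meshSize T := by
  have hb : Bornology.IsBounded (tri K) := (K.finite_toSet.isCompact_convexHull ℝ).isBounded
  exact (Metric.dist_le_diam_of_mem hb hx hy).trans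
    (le_csSup (hT.finite_elements.image _).bddAbove (mem_image_of_mem _ hK))

theorem meshSize_nonneg (T : Geometry.SimplicialComplex ℝ Plane) : 0 ≤ meshSize T :=
  Real.sSup_nonneg (by rintro _ ⟨K, -, rfl⟩; exact Metric.diam_nonneg)

theorem IsCluster.region_subset {Ω : Set Plane} {T : Geometry.SimplicialComplex ℝ Plane}
    (hT : IsTriangulation Ω T) {α₀ : ℝ} {𝒞 : Set (Finset Plane)} (h : IsCluster T α₀ 𝒞) :
    region 𝒞 ⊆ closure Ω :=
  iUnion₂_subset fun _ hK => hT.tri_subset (h.subset hK)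

/-- Any vertex of a bad element can be the centre; the other vertices make the diameter positive. -/
theorem IsCluster.exists_center {Ω : Set Plane} (hb : Bornology.IsBounded Ω)
    {T : Geometry.SimplicialComplex ℝ Plane} (hT : IsTriangulation Ω T) {α₀ : ℝ}
    {𝒞 : Set (Finset Plane)} (h : IsCluster T α₀ 𝒞) :
    ∃ c ∈ region 𝒞, 0 < clusterDiam 𝒞 ∧ ∀ x ∈ region 𝒞, dist x c ≤ clusterDiam 𝒞 := by
  have hbd : Bornology.IsBounded (region 𝒞) := hb.closure.subset (h.region_subset hT)
  obtain ⟨K, hK, -⟩ := h.exists_bad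
  obtain ⟨p, hp, q, hq, hpq⟩ : ∃ p ∈ K, ∃ q ∈ K, p ≠ q :=
    Finset.one_lt_card.1 (by rw [(h.subset hK).2]; norm_num)
  have hmem : ∀ p ∈ K, p ∈ region 𝒞 := fun p hp => mem_iUnion₂.2 ⟨K, hK, vertex_mem_tri hp⟩
  refine ⟨p, hmem p hp, ?_, fun x hx => Metric.dist_le_diam_of_mem hbd hx (hmem p hp)⟩
  exact (dist_pos.2 hpq).trans_le (Metric.dist_le_diam_of_mem hbd (hmem p hp) (hmem q hq))

/-- Integration of the pointwise error bound. -/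
theorem setIntegral_norm_sq_le {Ω : Set Plane} (hb : Bornology.IsBounded Ω) {N : ℕ} {e : Plane → ℝ}
    {c : Fin N → Plane} {r : Fin N → ℝ} (hr : ∀ i, 0 < r i) {a b R : ℝ}
    (hR : ∑ i, r i ^ 2 ≤ R)
    (he : ∀ᵐ x ∂volume.restrict Ω, e x ^ 2 ≤ 2 * a ^ 2 + 2 * b ^ 2 *
      ∑ i, r i ^ 2 * (Metric.ball (c i) (2 * r i)).indicator 1 x) :
    ∫ x in Ω, e x ^ 2 ≤ 2 * a ^ 2 * volume.real Ω + 8 * Real.pi * b ^ 2 * R ^ 2 := by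
  have hfin : IsFiniteMeasure (volume.restrict Ω) := ⟨by simpa using hb.measure_lt_top⟩
  have hI : ∀ i, Integrable (fun x => r i ^ 2 * (Metric.ball (c i) (2 * r i)).indicator 1 x)
      (volume.restrict Ω) := fun i =>
    (((integrable_const (1 : ℝ)).indicator measurableSet_ball).const_mul _)
  have hball : ∀ i, ∫ x in Ω, (Metric.ball (c i) (2 * r i)).indicator (1 : Plane → ℝ) x ≤
      4 * Real.pi * r i ^ 2 := fun i => by
    rw [integral_indicator_one measurableSet_ball]
    have h1 : volume.real (Metric.ball (c i) (2 * r i)) = 4 * Real.pi * r i ^ 2 := by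
      rw [Measure.real, EuclideanSpace.volume_ball_fin_two, ENNReal.toReal_mul, ENNReal.toReal_pow,
        ENNReal.toReal_ofReal (by linarith [hr i]), ENNReal.toReal_ofReal Real.pi_pos.le]
      ring
    rw [← h1]
    exact ENNReal.toReal_mono measure_ball_lt_top.ne (Measure.restrict_apply_le _ _)
  have hIs : Integrable (fun x => 2 * b ^ 2 * ∑ i, r i ^ 2 *
      (Metric.ball (c i) (2 * r i)).indicator 1 x) (volume.restrict Ω) :=
    (integrable_finsetSum _ fun i _ => hI i).const_mul _
  have hIt : Integrable (fun x => 2 * a ^ 2 + 2 * b ^ 2 * ∑ i, r i ^ 2 *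
      (Metric.ball (c i) (2 * r i)).indicator 1 x) (volume.restrict Ω) :=
    (integrable_const _).add hIs
  refine (integral_mono_of_nonneg (Eventually.of_forall fun x => sq_nonneg _) hIt he).trans ?_
  rw [integral_add (integrable_const _) hIs, integral_const, smul_eq_mul,
    measureReal_restrict_apply_univ, integral_const_mul, integral_finsetSum _ fun i _ => hI i]
  simp only [integral_const_mul]
  have h0 : 0 ≤ ∑ i, r i ^ 2 := Finset.sum_nonneg fun i _ => sq_nonneg _
  -- Each ball contributes `r i ^ 4` up to a constant. Bounding one factor `r i ^ 2` by the whole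
  -- sum yields the square of `∑ r i ^ 2`.
  have h1 : ∑ i, r i ^ 2 * ∫ x in Ω, (Metric.ball (c i) (2 * r i)).indicator (1 : Plane → ℝ) x ≤
      4 * Real.pi * R ^ 2 := by
    calc _ ≤ ∑ i, r i ^ 2 * (4 * Real.pi * ∑ j, r j ^ 2) := by
          refine Finset.sum_le_sum fun i _ => mul_le_mul_of_nonneg_left ((hball i).trans ?_)
            (sq_nonneg _)
          have := Finset.single_le_sum (f := fun j => r j ^ 2) (fun j _ => sq_nonneg (r j))
            (Finset.mem_univ i)
          exact mul_le_mul_of_nonneg_left this (by positivity)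
      _ = 4 * Real.pi * (∑ j, r j ^ 2) ^ 2 := by rw [← Finset.sum_mul]; ring
      _ ≤ _ := by gcongr
  have h2 := mul_le_mul_of_nonneg_left h1 (show 0 ≤ 2 * b ^ 2 by positivity)
  linarith

/-! ### The approximant and its error -/

set_option maxHeartbeats 800000 in
/-- The finite element approximation of a `W^{2,∞}` function on a clustered triangulation: the
nodal interpolant of `u`, modified to be affine on each cluster. -/
theorem exists_feApprox {Ω : Set Plane} (hΩ : IsPolygonalDomain Ω) {α₀ : ℝ} (hα₀ : α₀ < Real.pi)
    (C₁ : ℝ) :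
    ∃ C : ℝ, 0 ≤ C ∧ ∀ (T : Geometry.SimplicialComplex ℝ Plane), IsTriangulation Ω T →
      ∀ (N : ℕ) (𝒞 : Fin N → Set (Finset Plane)), IsClusterFamily T α₀ C₁ 𝒞 →
      ∀ (u : H1 Ω) (D2 : Fin 2 → Plane → Plane), IsW2Inf u D2 →
      ∃ w : H1 Ω, IsFEFunction T w ∧
        (∀ p ∈ T.vertices, p ∈ frontier Ω → |w p - u p| ≤ C * semiNormW2Inf Ω D2 * meshSize T) ∧
        (∀ p ∈ T.vertices, p ∈ frontier Ω →
          (∀ i, ∀ x ∈ region (𝒞 i), 2 * clusterDiam (𝒞 i) ≤ dist p x) → w p = u p) ∧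
        ((∀ x ∈ frontier Ω, u x = 0) → IsH10 w) ∧
        semiDistH1 u w ≤ C * semiNormW2Inf Ω D2 * meshSize T := by
  obtain ⟨Cj, hCj, hjet⟩ := exists_isJet_of_isW2Inf hΩ
  obtain ⟨ca, hca, hangle⟩ := exists_maxAngle_bound hα₀
  obtain ⟨κ, hκ, hcut⟩ := exists_isCutoff
  obtain ⟨Ca, hCa, happ⟩ := exists_affine_approx hΩ
  -- Relative to the seminorm of `u`, `k₁` is the jet constant of the modified function and `k₂ * r
  -- i` bounds the gradient of the correction. `Q` collects both contributions to the squared error.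
  set k₁ : ℝ := (1 + 2 * ((1 + 7 * κ) * Ca)) * Cj with hk₁
  set k₂ : ℝ := (1 + κ) * Ca * Cj with hk₂
  set V : ℝ := volume.real Ω with hV
  have hV0 : 0 ≤ V := measureReal_nonneg
  set Q : ℝ := 2 * (ca * (2 * k₁)) ^ 2 * V + 8 * Real.pi * k₂ ^ 2 * C₁ ^ 2 with hQ
  have hQ0 : 0 ≤ Q := by have := Real.pi_pos; positivity
  -- The first term serves the energy error, the second the nodal boundary error. The absolute value
  -- keeps the constant nonnegative for every `C₁`.
  refine ⟨√Q + Ca * Cj * |C₁|, by positivity, fun T hT N 𝒞 h𝒞 u D2 hu => ?_⟩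
  obtain ⟨G, hGae, hG⟩ := hjet u D2 hu
  set M := semiNormW2Inf Ω D2 with hM
  have hM0 : 0 ≤ M := semiNormW2Inf_nonneg Ω D2
  set h := meshSize T with hh
  have hh0 : 0 ≤ h := meshSize_nonneg T
  set L := Cj * M with hL
  have hL0 : 0 ≤ L := by positivity
  set B := Ca * L with hB
  have hB0 : 0 ≤ B := by positivity
  have hLB : L ≤ B := le_mul_of_one_le_left hL0 hCa
  choose c hc hr hcr using fun i => (h𝒞.isCluster i).exists_center hΩ.isBounded hT
  set r : Fin N → ℝ := fun i => clusterDiam (𝒞 i) with hrdef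
  have hr : ∀ i, 0 < r i := hr
  have hcΩ : ∀ i, c i ∈ closure Ω := fun i => (h𝒞.isCluster i).region_subset hT (hc i)
  choose A hA hA0 using fun i => happ u G L hL0 hG (c i) (hcΩ i) (r i) (hr i)
  choose η H hη using fun i => hcut (c i) (r i) (hr i)
  have hsep : ∀ i j, i ≠ j → ∀ x ∈ region (𝒞 i), 2 * r j ≤ dist x (c j) := by
    intro i j hij x hx
    have h1 : 2 * (r i + r j) ≤ dist x (c j) := h𝒞.separated i j hij x hx (c j) (hc j)
    linarith [hr i]
  have hdisj : Pairwise fun i j =>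
      Disjoint (Metric.ball (c i) (2 * r i)) (Metric.ball (c j) (2 * r j)) := by
    intro i j hij
    refine Metric.ball_disjoint_ball ?_
    have h1 : 2 * (r i + r j) ≤ dist (c i) (c j) :=
      h𝒞.separated i j hij (c i) (hc i) (c j) (hc j)
    linarith
  -- the correction near the clusters
  set f : Fin N → Plane → ℝ := fun i x => η i x * (u x - A i x) with hf
  set F : Fin N → Plane → Plane :=
    fun i x => η i x • (G x - affGrad (A i)) + (u x - A i x) • H i x with hF
  have hfjet : ∀ i, IsJet (closure Ω) (f i) (F i) ((1 + 7 * κ) * B) := fun i =>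
    (hη i).isJet_mul (hr i) hκ ((hG.sub_affine (A i)).mono hLB) (fun x hx hxc => (hA i x hx hxc).1)
      (fun x hx hxc => (hA i x hx hxc).2) hB0
  have hf0 : ∀ i x, x ∉ Metric.ball (c i) (2 * r i) → f i x = 0 := fun i x hx => by
    have := (hη i).eq_zero x (not_lt.1 hx)
    simp [hf, this]
  have hF0 : ∀ i x, x ∉ Metric.ball (c i) (2 * r i) → F i x = 0 := fun i x hx => by
    simp [hF, (hη i).eq_zero x (not_lt.1 hx), (hη i).grad_eq_zero x (not_lt.1 hx)]
  have hsum := IsJet.sum hdisj (by positivity) hfjet hf0 hF0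
  set v : Plane → ℝ := fun x => u x - ∑ i, f i x with hv
  have hvjet := hG.sub hsum
  have hfB : ∀ i, ∀ x ∈ closure Ω, |f i x| ≤ B * r i ^ 2 := by
    intro i x hx
    by_cases hxc : x ∈ Metric.ball (c i) (2 * r i)
    · have h1 := mul_le_mul ((hη i).abs_le_one x) (hA i x hx hxc).1 (abs_nonneg _) zero_le_one
      rw [one_mul, ← abs_mul] at h1
      exact h1
    · rw [hf0 i x hxc, abs_zero]; positivity
  have hFB : ∀ i, ∀ x ∈ closure Ω, ‖F i x‖ ≤ (1 + κ) * B * r i := by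
    intro i x hx
    by_cases hxc : x ∈ Metric.ball (c i) (2 * r i)
    · obtain ⟨h1, h2⟩ := hA i x hx hxc
      refine (norm_add_le _ _).trans ?_
      rw [norm_smul, norm_smul]
      have k1 := mul_le_mul ((hη i).abs_le_one x) h2 (norm_nonneg _) zero_le_one
      have k2 := mul_le_mul h1 ((hη i).norm_grad_le x) (norm_nonneg _)
        (mul_nonneg hB0 (sq_nonneg (r i)))
      have k3 : Ca * L * r i ^ 2 * (κ / r i) = κ * B * r i := by
        have := (hr i).ne'
        rw [hB]; field_simp
      rw [k3] at k2
      rw [one_mul] at k1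
      simp only [Real.norm_eq_abs]
      linarith
    · rw [hF0 i x hxc, norm_zero]
      have := hr i
      positivity
  have hsum_eq : ∀ i x, x ∈ Metric.ball (c i) (2 * r i) →
      ∑ j, f j x = f i x ∧ ∑ j, F j x = F i x := by
    intro i x hx
    have hj : ∀ j, j ≠ i → x ∉ Metric.ball (c j) (2 * r j) := fun j hj hxj =>
      Set.disjoint_left.1 (hdisj hj) hxj hx
    exact ⟨Finset.sum_eq_single i (fun j _ hji => hf0 j x (hj j hji)) (by simp),
      Finset.sum_eq_single i (fun j _ hji => hF0 j x (hj j hji)) (by simp)⟩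
  have hsum_zero : ∀ x, (∀ i, x ∉ Metric.ball (c i) (2 * r i)) →
      ∑ j, f j x = 0 ∧ ∑ j, F j x = 0 := fun x hx =>
    ⟨Finset.sum_eq_zero fun j _ => hf0 j x (hx j), Finset.sum_eq_zero fun j _ => hF0 j x (hx j)⟩
  have hR : ∑ i, r i ^ 2 ≤ C₁ * h := h𝒞.sum_le
  have hri : ∀ i, r i ^ 2 ≤ C₁ * h := fun i =>
    (Finset.single_le_sum (f := fun j => r j ^ 2) (fun j _ => sq_nonneg (r j))
      (Finset.mem_univ i)).trans hR
  -- on clusters the modified function is affine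
  have hvA : ∀ i, ∀ x ∈ region (𝒞 i), v x = A i x := by
    intro i x hx
    have hx1 : dist x (c i) ≤ r i := hcr i x hx
    have hxb : x ∈ Metric.ball (c i) (2 * r i) := by
      rw [Metric.mem_ball]; linarith [hr i]
    have e : v x = u x - ∑ j, f j x := rfl
    have e' : f i x = η i x * (u x - A i x) := rfl
    rw [e, (hsum_eq i x hxb).1, e', (hη i).eq_one x hx1]
    ring
  obtain ⟨w, hwFE, hwv, hwI, hwlip, hwgrad, hwA⟩ := exists_feInterp hΩ hT v
  refine ⟨w, hwFE, fun p hp hpf => ?_, fun p hp hpf hpd => ?_, fun h0 => ?_, ?_⟩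
  · rw [hwv p hp]
    have hpc : p ∈ closure Ω := frontier_subset_closure hpf
    have e : v p - u p = -∑ i, f i p := by simp [hv]
    rw [e, abs_neg]
    by_cases hex : ∃ i, p ∈ Metric.ball (c i) (2 * r i)
    · obtain ⟨i, hi⟩ := hex
      rw [(hsum_eq i p hi).1]
      calc |f i p| ≤ B * r i ^ 2 := hfB i p hpc
        _ ≤ B * (C₁ * h) := mul_le_mul_of_nonneg_left (hri i) hB0
        _ ≤ B * (|C₁| * h) := by gcongr; exact le_abs_self C₁
        _ = Ca * Cj * |C₁| * M * h := by rw [hB, hL]; ring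
        _ ≤ _ := by gcongr; linarith [Real.sqrt_nonneg Q]
    · rw [(hsum_zero p fun i hi => hex ⟨i, hi⟩).1, abs_zero]
      positivity
  · rw [hwv p hp]
    have hout : ∀ i, p ∉ Metric.ball (c i) (2 * r i) := fun i hi =>
      absurd (hpd i (c i) (hc i)) (not_le.2 hi)
    simp only [hv, (hsum_zero p hout).1, sub_zero]
  · refine isH10_feInterp hΩ hT hwFE hwlip hwgrad fun x hx => ?_
    rw [hwI x (frontier_subset_closure hx)]
    refine interp_eq_zero_of_mem_frontier hΩ hT (fun p _ hpf => ?_) hx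
    by_cases hex : ∃ i, p ∈ Metric.ball (c i) (2 * r i)
    · obtain ⟨i, hi⟩ := hex
      have e : v p = u p - ∑ j, f j p := rfl
      have e' : f i p = η i p * (u p - A i p) := rfl
      rw [e, (hsum_eq i p hi).1, e', hA0 i h0 p hpf hi, h0 p hpf]
      simp
    · simp only [hv, (hsum_zero p fun i hi => hex ⟨i, hi⟩).1, h0 p hpf, sub_zero]
  · set a := ca * (2 * (k₁ * M) * h) with ha
    set b := (1 + κ) * B with hb
    have ha0 : 0 ≤ a := by positivity
    have hb0 : 0 ≤ b := by positivity
    have hLk : L + 2 * ((1 + 7 * κ) * B) = k₁ * M := by rw [hk₁, hB, hL]; ring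
    rw [hLk] at hvjet
    have hpt : ∀ᵐ x ∂volume.restrict Ω, ‖u.grad x - w.grad x‖ ^ 2 ≤ 2 * a ^ 2 + 2 * b ^ 2 *
        ∑ i, r i ^ 2 * (Metric.ball (c i) (2 * r i)).indicator 1 x := by
      filter_upwards [hGae, hT.ae_mem_interior_tri] with x hxG hxK
      obtain ⟨K, hK, hxi⟩ := hxK
      have hxt : x ∈ tri K := interior_subset hxi
      have hxc : x ∈ closure Ω := hT.tri_subset hK hxt
      obtain ⟨A', hA'⟩ := (isTriangle_of_mem_elements hK).exists_affine v
      have hwx := (hwA K hK A' hA').2 x hxi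
      have hSnn : 0 ≤ ∑ i, r i ^ 2 * (Metric.ball (c i) (2 * r i)).indicator (1 : Plane → ℝ) x :=
        Finset.sum_nonneg fun i _ => mul_nonneg (sq_nonneg _)
          (indicator_nonneg (fun _ _ => zero_le_one) x)
      have hSge : ∀ i, x ∈ Metric.ball (c i) (2 * r i) → r i ^ 2 ≤
          ∑ i, r i ^ 2 * (Metric.ball (c i) (2 * r i)).indicator (1 : Plane → ℝ) x := by
        intro i hi
        have h1 := Finset.single_le_sum (f := fun i => r i ^ 2 *
          (Metric.ball (c i) (2 * r i)).indicator (1 : Plane → ℝ) x)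
          (fun i _ => mul_nonneg (sq_nonneg _) (indicator_nonneg (fun _ _ => zero_le_one) x))
          (Finset.mem_univ i)
        simpa [indicator_of_mem hi] using h1
      rw [hxG]
      by_cases hbad : α₀ < maxAngle K
      · obtain ⟨i, hKi⟩ := h𝒞.cover K ⟨hK, hbad⟩
        have hreg : ∀ y ∈ tri K, y ∈ region (𝒞 i) := fun y hy => mem_iUnion₂.2 ⟨K, hKi, hy⟩
        -- On a bad element the interpolant is `A i` itself, so no angle condition is needed and the
        -- error is that of the affine approximation, `O(r i)`.
        have hwx' := (hwA K hK (A i) fun p hp =>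
          (hvA i p (hreg p (vertex_mem_tri hp))).symm).2 x hxi
        have hxb : x ∈ Metric.ball (c i) (2 * r i) := by
          have := hcr i x (hreg x hxt)
          rw [Metric.mem_ball]; linarith [hr i]
        rw [hwx']
        have h1 : ‖G x - affGrad (A i)‖ ≤ b * r i := by
          refine (hA i x hxc hxb).2.trans (mul_le_mul_of_nonneg_right ?_ (hr i).le)
          exact le_mul_of_one_le_left hB0 (by linarith)
        have h2 : ‖G x - affGrad (A i)‖ ^ 2 ≤ (b * r i) ^ 2 :=
          pow_le_pow_left₀ (norm_nonneg _) h1 2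
        have h3 := mul_le_mul_of_nonneg_left (hSge i hxb) (sq_nonneg b)
        rw [mul_pow] at h2
        linarith [sq_nonneg a, mul_nonneg (sq_nonneg b) hSnn]
      -- On the remaining elements, inside or outside clusters, the interpolation error of the
      -- modified function is `O(h)`; the gradient of the correction is then added back.
      · have h1 := norm_sub_affGrad_le hangle (by positivity) hvjet hK.2 (not_lt.1 hbad)
          (hT.tri_subset hK) (fun x hx y hy => dist_le_meshSize hT hK hx hy) hA' hxt
        rw [hwx]
        have e : G x - affGrad A' = (G x - ∑ i, F i x - affGrad A') + ∑ i, F i x := by abel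
        have h2 : ‖G x - affGrad A'‖ ≤ a + ‖∑ i, F i x‖ := by
          rw [e]; exact (norm_add_le _ _).trans (by linarith)
        have h3 : ‖∑ i, F i x‖ ^ 2 ≤ b ^ 2 *
            ∑ i, r i ^ 2 * (Metric.ball (c i) (2 * r i)).indicator (1 : Plane → ℝ) x := by
          by_cases hex : ∃ i, x ∈ Metric.ball (c i) (2 * r i)
          · obtain ⟨i, hi⟩ := hex
            rw [(hsum_eq i x hi).2]
            calc ‖F i x‖ ^ 2 ≤ (b * r i) ^ 2 :=
                  pow_le_pow_left₀ (norm_nonneg _) (hFB i x hxc) 2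
              _ = b ^ 2 * r i ^ 2 := by ring
              _ ≤ _ := mul_le_mul_of_nonneg_left (hSge i hi) (sq_nonneg b)
          · rw [(hsum_zero x fun i hi => hex ⟨i, hi⟩).2, norm_zero]
            rw [zero_pow two_ne_zero]
            exact mul_nonneg (sq_nonneg b) hSnn
        have h4 : ‖G x - affGrad A'‖ ^ 2 ≤ (a + ‖∑ i, F i x‖) ^ 2 :=
          pow_le_pow_left₀ (norm_nonneg _) h2 2
        have h5 : (a + ‖∑ i, F i x‖) ^ 2 ≤ 2 * (a ^ 2 + ‖∑ i, F i x‖ ^ 2) := add_sq_le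
        linarith
    have hInt := setIntegral_norm_sq_le hΩ.isBounded hr hR hpt
    have hfin : 2 * a ^ 2 * volume.real Ω + 8 * Real.pi * b ^ 2 * (C₁ * h) ^ 2 =
        Q * (M * h) ^ 2 := by
      rw [hQ, ha, hb, hB, hL, hk₂, hV]; ring
    rw [hfin] at hInt
    rw [semiDistH1]
    calc √(∫ x in Ω, ‖u.grad x - w.grad x‖ ^ 2) ≤ √(Q * (M * h) ^ 2) := Real.sqrt_le_sqrt hInt
      _ = √Q * (M * h) := by rw [Real.sqrt_mul hQ0, Real.sqrt_sq (by positivity)]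
      _ = √Q * M * h := by ring
      _ ≤ _ := by
        gcongr
        have : 0 ≤ Ca * Cj * |C₁| := by positivity
        linarith

end ClusterFEM

/-! ### The convergence theorem -/

open ClusterFEM in
/-- `O(h)` convergence of the finite element method for `u ∈ W^{2,∞}(Ω)` on triangulations whose
elements violating the maximum angle condition are grouped into clusters. The constant `C` depends
only on `Ω`, `α₀`, `C₁`, so the bound is uniform over every family of such triangulations. -/
theorem theorem3p4 (Ω : Set Plane) (hΩ : IsPolygonalDomain Ω)
    (α₀ : ℝ) (hα₀ : α₀ < Real.pi) (C₁ : ℝ) :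
    ∃ C : ℝ, ∀ (T : Geometry.SimplicialComplex ℝ Plane), IsTriangulation Ω T →
      ∀ (N : ℕ) (𝒞 : Fin N → Set (Finset Plane)), IsClusterFamily T α₀ C₁ 𝒞 →
      ∀ (u : H1 Ω) (D2 : Fin 2 → Plane → Plane), IsW2Inf u D2 →
      ∃ g : H1 Ω, IsBoundaryApprox T 𝒞 u (C * semiNormW2Inf Ω D2 * meshSize T) g ∧
        ∀ f : Plane → ℝ, MemLp f 2 (volume.restrict Ω) → IsWeakSolution f u →
          ∀ U : H1 Ω, IsFEMSolution T f g U →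
            semiDistH1 u U ≤ C * semiNormW2Inf Ω D2 * meshSize T := by
  obtain ⟨C, hC, hmain⟩ := exists_feApprox hΩ hα₀ C₁
  refine ⟨C, fun T hT N 𝒞 h𝒞 u D2 hu => ?_⟩
  obtain ⟨w, hwFE, hw1, hw2, hw3, hw4⟩ := hmain T hT N 𝒞 h𝒞 u D2 hu
  -- For zero boundary data the lift must be zero; then `w` belongs to the trial space and is the
  -- competitor. Otherwise `w` itself is the lift.
  by_cases h0 : ∀ x ∈ frontier Ω, u x = 0
  · have hε : 0 ≤ C * semiNormW2Inf Ω D2 * meshSize T :=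
      mul_nonneg (mul_nonneg hC (semiNormW2Inf_nonneg Ω D2)) (meshSize_nonneg T)
    set g : H1 Ω := H1.ofLipschitz hΩ.isOpen hΩ.isBounded
      (LipschitzWith.const (0 : ℝ) (α := Plane)) with hg
    have hgv : ∀ x, g x = 0 := fun _ => rfl
    have hgg : ∀ x, g.grad x = 0 := fun x => gradient_const x (0 : ℝ)
    refine ⟨g, ⟨⟨continuousOn_const, fun K _ => ⟨0, fun x _ => rfl⟩⟩, fun p _ hpf => ?_,
      fun p _ hpf _ => ?_, fun _ x _ => hgv x⟩, ?_⟩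
    · rw [hgv, h0 p hpf, sub_zero, abs_zero]; exact hε
    · rw [hgv, h0 p hpf]
    · rintro f - hsol U ⟨⟨U₀, hU₀, rfl⟩, hU⟩
      -- Since `w` is in `V_h`, the difference of the discrete solution and the competitor is an
      -- admissible test function.
      have hz : IsFEFunction0 T (U₀ + w.negate) :=
        ⟨hU₀.1.add_negate hwFE, hU₀.2.add_negate (hw3 h0)⟩
      refine (semiDistH1_le_of_orthogonal (z := U₀ + w.negate) (fun x => ?_) ?_).trans hw4
      · have e1 : (U₀ + g).grad x = U₀.grad x + g.grad x := rfl
        have e2 : (U₀ + w.negate).grad x = U₀.grad x + -w.grad x := rfl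
        rw [e1, e2, hgg]; abel
      · rw [hsol _ hz.2, hU _ hz]
  · refine ⟨w, ⟨hwFE, hw1, hw2, fun h => absurd h h0⟩, ?_⟩
    rintro f - hsol U ⟨⟨U₀, hU₀, rfl⟩, hU⟩
    refine (semiDistH1_le_of_orthogonal (z := U₀) (fun x => ?_) ?_).trans hw4
    · have e1 : (U₀ + w).grad x = U₀.grad x + w.grad x := rfl
      rw [e1, add_comm]
    · rw [hsol _ hU₀.2, hU _ hU₀]
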